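/- Let $N\ge 3$, $2^*=\frac{2N}{N-2}$, $a,b>0$ and $\eta\in(0,1)$. Let $V_1,V_2\in C(\mathbb R^N,\mathbb R)$ and $W\in C(\mathbb R^N\times\mathbb R^2,[0,\infty))$, all $1$-periodic in each of $x_1,\dots,x_N$, where for every $x$ the function $z=(u,v)\mapsto W(x,z)$ is continuously differentiable with gradient $W_z=(W_u,W_v)$, and $W(x,0)=0$. Assume: * $|V_2(x)|\le \frac{2\eta ab}{a^2+b^2}V_1(x)$ for all $x$, and $0<\inf V_1\le\sup V_1<\infty$; * there are $p\in(2,2^*)$ and $C_0>0$ with $|W_z(x,z)|\le C_0(1+|z|^{p-1})$ for all $(x,z)\in\mathbb R^N\times\mathbb R^2$; * $W_z(x,z)=o(|z|)$ as $|z|\to0$, uniformly in $x\in\mathbb R^N$; * for a.e. $x\in\mathbb R^N$, $\frac{|W(x,u,v)|}{|au+bv|^2}\to\infty$ as $|au+bv|\to\infty$; * for all $x\in\mathbb R^N$, $\theta\ge0$ and $z,\zeta\in\mathbb R^2$, $$\frac{1-\theta^2}{2}W_z(x,z)\cdot z-\theta\, W_z(x,z)\cdot\zeta+W(x,\theta z+\zeta)-W(x,z)\ge0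 .$$ On the Hilbert space $E=H^1(\mathbb R^N)\times H^1(\mathbb R^N)$ let $$\Phi(z)=\int_{\mathbb R^N}\Big[\nabla u\cdot\nabla v+V_1(x)uv+\tfrac12V_2(x)|z|^2\Big]dx-\int_{\mathbb R^N}W(x,z)\,dx,\qquad z=(u,v)\in E,$$ let $E^-=\{(-\frac wa,\frac wb): w\in H^1(\mathbb R^N)\}$, and let $$\mathcal N^-=\{z\in E\setminus E^-:\ \langle\Phi'(z),z\rangle=\langle\Phi'(z),\zeta\rangle=0\ \text{ for all }\zeta\in E^-\}.$$ Then the system $$-\Delta u+V_1(x)u+V_2(x)v=W_v(x,u,v),\qquad -\Delta v+V_1(x)v+V_2(x)u=W_u(x,u,v)\qquad\text{in }\mathbb R^N$$ has a weak solution $z^*=(u^*,v^*)\in E$ (tested against all functions in $H^1(\mathbb R^N)$) with $z^*\in\mathcal N^-$ and $\Phi(z^*)=\inf_{\mathcal N^-}\Phi>0$. -/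

import Mathlib

open MeasureTheory Filter
open scoped ContDiff InnerProductSpace ENNReal

noncomputable section

namespace HamSys

/-- The Euclidean space `ℝ^n`. -/
abbrev Sp (n : ℕ) : Type := EuclideanSpace ℝ (Fin n)

/-- The Euclidean plane `ℝ²`, in which `z = (u, v)` takes its values. -/
abbrev Plane : Type := EuclideanSpace ℝ (Fin 2)

/-- `G` is the weak gradient of `u` on `ℝ^N`: `∫ u ∂ᵢφ = - ∫ Gᵢ φ` for all `φ ∈ C_c^∞(ℝ^N)`. -/
def IsWeakGradient {N : ℕ} (u : Sp N → ℝ) (G : Sp N → Sp N) : Prop :=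
  ∀ φ : Sp N → ℝ, ContDiff ℝ ∞ φ → HasCompactSupport φ → ∀ i : Fin N,
    ∫ x, u x * fderiv ℝ φ x (EuclideanSpace.single i 1) = - ∫ x, G x i * φ x

lemma memLp_two_of_continuous_compact {N : ℕ} {f : Sp N → ℝ} (hf : Continuous f)
    (hc : HasCompactSupport f) : MemLp f 2 (volume : Measure (Sp N)) :=
  hf.memLp_of_hasCompactSupport hc

lemma memLp_two_partial {N : ℕ} {φ : Sp N → ℝ} (hφ : ContDiff ℝ ∞ φ) (hc : HasCompactSupport φ)
    (e : Sp N) : MemLp (fun x => fderiv ℝ φ x e) 2 (volume : Measure (Sp N)) :=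
  memLp_two_of_continuous_compact
    ((hφ.continuous_fderiv (by simp)).clm_apply continuous_const) (hc.fderiv_apply ℝ e)

lemma memLp_two_coord {N : ℕ} {G : Sp N → Sp N} (hG : MemLp G 2 (volume : Measure (Sp N)))
    (i : Fin N) : MemLp (fun x => G x i) 2 (volume : Measure (Sp N)) :=
  (EuclideanSpace.proj (𝕜 := ℝ) i).comp_memLp' hG

/-- The Sobolev space `H¹(ℝ^N)`, as the space of pairs `(u, ∇u)` with `u ∈ L²` and with weak
gradient `∇u ∈ L²`. The pair is determined by `u`, and the inner product inherited from
`L² × L²` is the standard one, `(u, w) = ∫ (∇u · ∇w + u w)`. -/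
def H1 (N : ℕ) : Submodule ℝ (WithLp 2 (Lp ℝ 2 (volume : Measure (Sp N)) ×
    Lp (Sp N) 2 (volume : Measure (Sp N)))) where
  carrier := {p | IsWeakGradient (p.fst : Sp N → ℝ) (p.snd : Sp N → Sp N)}
  zero_mem' := by
    intro φ _ _ i
    simp
  add_mem' := by
    intro p q hp hq φ hφ hc i
    have hd := memLp_two_partial hφ hc (EuclideanSpace.single i 1)
    have hφ2 := memLp_two_of_continuous_compact hφ.continuous hc
    have e1 : ∫ x, ((p + q).fst : Sp N → ℝ) x * fderiv ℝ φ x (EuclideanSpace.single i 1)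
        = (∫ x, (p.fst : Sp N → ℝ) x * fderiv ℝ φ x (EuclideanSpace.single i 1))
          + ∫ x, (q.fst : Sp N → ℝ) x * fderiv ℝ φ x (EuclideanSpace.single i 1) := by
      have hp1 : Integrable (fun x => (p.fst : Sp N → ℝ) x *
          fderiv ℝ φ x (EuclideanSpace.single i 1)) := (Lp.memLp p.fst).integrable_mul hd
      have hq1 : Integrable (fun x => (q.fst : Sp N → ℝ) x *
          fderiv ℝ φ x (EuclideanSpace.single i 1)) := (Lp.memLp q.fst).integrable_mul hd
      rw [← integral_add hp1 hq1]
      refine integral_congr_ae ?_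
      filter_upwards [Lp.coeFn_add p.fst q.fst] with x hx
      simp only [WithLp.add_fst, hx, Pi.add_apply, add_mul]
    have e2 : ∫ x, ((p + q).snd : Sp N → Sp N) x i * φ x
        = (∫ x, (p.snd : Sp N → Sp N) x i * φ x) + ∫ x, (q.snd : Sp N → Sp N) x i * φ x := by
      have hp2 : Integrable (fun x => (p.snd : Sp N → Sp N) x i * φ x) :=
        (memLp_two_coord (Lp.memLp p.snd) i).integrable_mul hφ2
      have hq2 : Integrable (fun x => (q.snd : Sp N → Sp N) x i * φ x) :=
        (memLp_two_coord (Lp.memLp q.snd) i).integrable_mul hφ2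
      rw [← integral_add hp2 hq2]
      refine integral_congr_ae ?_
      filter_upwards [Lp.coeFn_add p.snd q.snd] with x hx
      simp only [WithLp.add_snd, hx, Pi.add_apply, PiLp.add_apply, add_mul]
    rw [e1, e2, hp φ hφ hc i, hq φ hφ hc i]
    ring
  smul_mem' := by
    intro c p hp φ hφ hc i
    have e1 : ∫ x, ((c • p).fst : Sp N → ℝ) x * fderiv ℝ φ x (EuclideanSpace.single i 1)
        = c * ∫ x, (p.fst : Sp N → ℝ) x * fderiv ℝ φ x (EuclideanSpace.single i 1) := by
      rw [← integral_const_mul]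
      refine integral_congr_ae ?_
      filter_upwards [Lp.coeFn_smul c p.fst] with x hx
      simp only [WithLp.smul_fst, hx, Pi.smul_apply, smul_eq_mul, mul_assoc]
    have e2 : ∫ x, ((c • p).snd : Sp N → Sp N) x i * φ x
        = c * ∫ x, (p.snd : Sp N → Sp N) x i * φ x := by
      rw [← integral_const_mul]
      refine integral_congr_ae ?_
      filter_upwards [Lp.coeFn_smul c p.snd] with x hx
      simp only [WithLp.smul_snd, hx, Pi.smul_apply, PiLp.smul_apply, smul_eq_mul, mul_assoc]
    rw [e1, e2, hp φ hφ hc i]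
    ring

/-- The values of an element of `H¹(ℝ^N)`. -/
def val {N : ℕ} (u : H1 N) : Sp N → ℝ := (u.1.fst : Sp N → ℝ)

/-- The weak gradient of an element of `H¹(ℝ^N)`. -/
def grad {N : ℕ} (u : H1 N) : Sp N → Sp N := (u.1.snd : Sp N → Sp N)

/-- The Hilbert space `E = H¹(ℝ^N) × H¹(ℝ^N)`, with the Hilbert norm of the product. -/
abbrev E (N : ℕ) : Type := WithLp 2 (H1 N × H1 N)

/-- The values `z(x) = (u(x), v(x))` of `z = (u, v) ∈ E`. -/
def vec {N : ℕ} (z : E N) (x : Sp N) : Plane := !₂[val z.fst x, val z.snd x]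

/-- `E⁻ = {(-w/a, w/b) : w ∈ H¹(ℝ^N)}`. -/
def Eminus (N : ℕ) (a b : ℝ) : Set (E N) :=
  {z | ∃ w : H1 N, z = WithLp.toLp 2 (-(a⁻¹ • w), b⁻¹ • w)}

/-- The function `f` on `ℝ^N` is `1`-periodic in each coordinate. -/
def OnePeriodic {N : ℕ} {α : Type*} (f : Sp N → α) : Prop :=
  ∀ (i : Fin N) (x : Sp N), f (x + EuclideanSpace.single i 1) = f x

/-- Continuity and boundedness of the potentials, and the domination of `V₂` by `V₁`. -/
structure CondV0 {N : ℕ} (a b η : ℝ) (V₁ V₂ : Sp N → ℝ) : Prop where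
  a_pos : 0 < a
  b_pos : 0 < b
  η_pos : 0 < η
  η_lt_one : η < 1
  continuous₁ : Continuous V₁
  continuous₂ : Continuous V₂
  abs_le : ∀ x, |V₂ x| ≤ 2 * η * a * b / (a ^ 2 + b ^ 2) * V₁ x
  inf_pos : ∃ m : ℝ, 0 < m ∧ ∀ x, m ≤ V₁ x
  sup_lt : ∃ M : ℝ, ∀ x, V₁ x ≤ M

/-- Regularity, nonnegativity and subcritical growth of `W`; `gradient (W x) z` is `W_z(x, z) = (W_u(x, u, v), W_v(x, u, v))`, and
`2 N / (N - 2)` is the critical exponent `2^*`. -/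
structure CondW0 {N : ℕ} (W : Sp N → Plane → ℝ) : Prop where
  continuous : Continuous (fun q : Sp N × Plane => W q.1 q.2)
  nonneg : ∀ x z, 0 ≤ W x z
  contDiff : ∀ x, ContDiff ℝ 1 (W x)
  growth : ∃ p C₀ : ℝ, 2 < p ∧ p < 2 * (N : ℝ) / ((N : ℝ) - 2) ∧ 0 < C₀ ∧
    ∀ x z, ‖gradient (W x) z‖ ≤ C₀ * (1 + ‖z‖ ^ (p - 1))

/-- Behaviour at zero: `W_z(x, z) = o(|z|)` as `|z| → 0`, uniformly in `x`. -/
def CondW1 {N : ℕ} (W : Sp N → Plane → ℝ) : Prop :=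
  ∀ ε : ℝ, 0 < ε → ∃ δ : ℝ, 0 < δ ∧ ∀ (x : Sp N) (z : Plane), ‖z‖ < δ → ‖gradient (W x) z‖ ≤ ε * ‖z‖

/-- Superquadratic growth: for a.e. `x`, `|W(x, u, v)| / |a u + b v|² → ∞` as `|a u + b v| → ∞`. -/
def CondW2 {N : ℕ} (a b : ℝ) (W : Sp N → Plane → ℝ) : Prop :=
  ∀ᵐ x : Sp N, Tendsto (fun z : Plane => |W x z| / |a * z 0 + b * z 1| ^ 2)
    (comap (fun z : Plane => |a * z 0 + b * z 1|) atTop) atTop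

/-- The monotonicity-type inequality for `W`. -/
def CondW4 {N : ℕ} (W : Sp N → Plane → ℝ) : Prop :=
  ∀ (x : Sp N) (θ : ℝ), 0 ≤ θ → ∀ z ζ : Plane,
    0 ≤ (1 - θ ^ 2) / 2 * ⟪gradient (W x) z, z⟫_ℝ - θ * ⟪gradient (W x) z, ζ⟫_ℝ
      + W x (θ • z + ζ) - W x z

/-- The energy functional
`Φ(z) = ∫ (∇u · ∇v + V₁ u v + V₂ |z|² / 2) dx - ∫ W(x, z) dx`, `z = (u, v) ∈ E`. -/
def Phi {N : ℕ} (V₁ V₂ : Sp N → ℝ) (W : Sp N → Plane → ℝ) (z : E N) : ℝ :=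
  (∫ x, (⟪grad z.fst x, grad z.snd x⟫_ℝ + V₁ x * (val z.fst x * val z.snd x)
      + 1 / 2 * V₂ x * ‖vec z x‖ ^ 2))
    - ∫ x, W x (vec z x)

/-- The Nehari–Pankov set: the `z ∈ E ∖ E⁻` with `⟨Φ'(z), z⟩ = ⟨Φ'(z), ζ⟩ = 0` for all `ζ ∈ E⁻`,
where `Φ'` is the Fréchet derivative of `Φ` on `E`. -/
def NehariPankov {N : ℕ} (a b : ℝ) (V₁ V₂ : Sp N → ℝ) (W : Sp N → Plane → ℝ) : Set (E N) :=
  {z | z ∉ Eminus N a b ∧ fderiv ℝ (Phi V₁ V₂ W) z z = 0 ∧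
    ∀ ζ ∈ Eminus N a b, fderiv ℝ (Phi V₁ V₂ W) z ζ = 0}

/-- `z = (u, v) ∈ H¹ × H¹` is a weak solution of
`-Δu + V₁ u + V₂ v = W_v(x, u, v)`, `-Δv + V₁ v + V₂ u = W_u(x, u, v)` on `ℝ^N`,
with test functions in `H¹(ℝ^N)`. -/
def IsWeakSolution {N : ℕ} (V₁ V₂ : Sp N → ℝ) (W : Sp N → Plane → ℝ) (z : E N) : Prop :=
  ∀ φ : H1 N,
    Integrable (fun x => gradient (W x) (vec z x) 1 * val φ x) ∧
    Integrable (fun x => gradient (W x) (vec z x) 0 * val φ x) ∧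
    ∫ x, (⟪grad z.fst x, grad φ x⟫_ℝ + V₁ x * val z.fst x * val φ x
        + V₂ x * val z.snd x * val φ x)
      = ∫ x, gradient (W x) (vec z x) 1 * val φ x ∧
    ∫ x, (⟪grad z.snd x, grad φ x⟫_ℝ + V₁ x * val z.snd x * val φ x
        + V₂ x * val z.fst x * val φ x)
      = ∫ x, gradient (W x) (vec z x) 0 * val φ x

end HamSys

end

open scoped Topology Convolution

noncomputable section

namespace HamSys

/-! ### Ekeland's variational principle -/

/-! Put `Tp y = (y/a, y/b)` and `Tm w = (-w/a, w/b)`. Then `E` is the direct sum of the ranges of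
`Tp` and `Tm`, the latter being `E⁻`. Since `V₂` is dominated by `V₁` with `η < 1`, the quadratic
part of `Φ` is positive definite on the first range and negative definite on the second. So `Φ(z) =
A(z, z)/2 - I(z)` with `I(z) = ∫ W(x, z)`, a strongly indefinite functional.

The last inequality on `W` does two things. At `θ = 1` it says that `W` is convex in `z`, so `Φ` is
concave and weakly upper semicontinuous in the `E⁻` directions. For general `θ` it says that each
point `z` of the Nehari–Pankov set maximizes `Φ` over the fibre of all `θ z + ζ`, `θ ≥ 0`, `ζ ∈ E⁻`.
Minimizing `Φ` over that set thus amounts to minimizing, over the unit sphere of `H¹`, the function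
`Ψ(y) = max Φ(s Tp y + Tm v)` over `s ≥ 0` and `v`. The maximum is attained because superquadratic
growth bounds maximizing sequences (`exists_bound`, `exists_isFiberMax`).

The maximizer on a fibre need not be unique, so `Ψ` is not known to be differentiable; it is only
lower semicontinuous. Two maximizers are however proportional, and `I'` scales by the same factor
(`fiberMax_unique`). This is enough to turn the slope inequality of Ekeland's principle for `Ψ` into
smallness of `Φ'` at the maximizers (`energy_deriv_ge`).

For the resulting minimizing sequence Lions' lemma excludes vanishing. After integer translations,
which leave `Φ` invariant, the sphere points converge weakly to a nonzero limit, and superquadratic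
growth then bounds the maximizers. Their weak limit is critical because `I'` is sequentially weakly
continuous, and it lies outside `E⁻`. Fatou's lemma for `W_z · z / 2 - W ≥ 0` puts its level at or
below the infimum, so it is a minimizer (`exists_ground_state`).

The rest supplies the analysis on `H¹`: the Sobolev, Lions and Rellich theorems by mollification,
and the calculus of `∫ W(x, z)` from convexity and subcritical growth. -/

theorem ekeland {X : Type*} [MetricSpace X] [CompleteSpace X] {f : X → ℝ}
    (hf : LowerSemicontinuous f) {m : ℝ} (hm : ∀ x, m ≤ f x) {ε : ℝ} (hε : 0 < ε) (x₀ : X) :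
    ∃ x, f x ≤ f x₀ ∧ ∀ y, f x - ε * dist x y ≤ f y := by
  -- `y ∈ S x` is a partial order. The iteration picks in `S (x n)` a point that minimizes `f` there
  -- up to `1 / (n + 1)`.
  set S : X → Set X := fun x => {y | f y + ε * dist x y ≤ f x} with hS
  have self_mem : ∀ x, x ∈ S x := fun x => by simp [hS]
  have trans : ∀ x y z, y ∈ S x → z ∈ S y → z ∈ S x := by
    intro x y z hy hz
    simp only [hS, Set.mem_ofPred_eq] at hy hz ⊢
    have := mul_le_mul_of_nonneg_left (dist_triangle x y z) hε.le
    linarith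
  have next : ∀ (n : ℕ) (x : X), ∃ y ∈ S x, ∀ z ∈ S x, f y ≤ f z + 1 / ((n : ℝ) + 1) := by
    intro n x
    have hbd : BddBelow (f '' S x) := ⟨m, by rintro _ ⟨y, -, rfl⟩; exact hm y⟩
    obtain ⟨_, ⟨y, hy, rfl⟩, hlt⟩ := exists_lt_of_csInf_lt (Set.Nonempty.image f ⟨x, self_mem x⟩)
      (lt_add_of_pos_right (sInf (f '' S x)) (Nat.one_div_pos_of_nat (α := ℝ) (n := n)))
    refine ⟨y, hy, fun z hz => ?_⟩
    have := csInf_le hbd (Set.mem_image_of_mem f hz)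
    linarith
  choose g hgS hg using next
  let x : ℕ → X := fun n => Nat.rec x₀ (fun k y => g k y) n
  have hx : ∀ n, x (n + 1) = g n (x n) := fun n => rfl
  have hstep : ∀ n k, n ≤ k → x k ∈ S (x n) := by
    intro n k hnk
    induction k, hnk using Nat.le_induction with
    | base => exact self_mem _
    | succ k _ ih => exact trans _ _ _ ih (hx k ▸ hgS k (x k))
  have hanti : Antitone (fun n => f (x n)) := by
    intro n k hnk
    have := hstep n k hnk
    simp only [hS, Set.mem_ofPred_eq] at this
    have h2 := mul_nonneg hε.le (dist_nonneg (x := x n) (y := x k))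
    show f (x k) ≤ f (x n)
    linarith
  have hlim := tendsto_atTop_ciInf hanti ⟨m, by rintro _ ⟨n, rfl⟩; exact hm _⟩
  set l := ⨅ n, f (x n)
  have hle : ∀ n, l ≤ f (x n) := fun n =>
    ciInf_le ⟨m, by rintro _ ⟨n, rfl⟩; exact hm _⟩ n
  -- Membership in `S` bounds `ε` times the distance by the drop of `f`, and all later drops are at
  -- most `f (x n) - l`.
  have hcau : CauchySeq x := by
    refine cauchySeq_of_le_tendsto_0' (fun n => (f (x n) - l) / ε) ?_ ?_
    · intro n k hnk
      have := hstep n k hnk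
      simp only [hS, Set.mem_ofPred_eq] at this
      rw [le_div_iff₀ hε]
      linarith [hle k]
    · have : Tendsto (fun n => (f (x n) - l) / ε) atTop (𝓝 ((l - l) / ε)) :=
        (hlim.sub_const l).div_const ε
      simpa using this
  obtain ⟨xs, hxs⟩ := cauchySeq_tendsto_of_complete hcau
  have hclosed : ∀ n, IsClosed (S (x n)) := by
    intro n
    have : LowerSemicontinuous (fun y => f y + ε * dist (x n) y) :=
      hf.add (Continuous.lowerSemicontinuous (by fun_prop))
    exact this.isClosed_preimage (f (x n))
  have hmem : ∀ n, xs ∈ S (x n) := fun n =>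
    (hclosed n).mem_of_tendsto hxs (eventually_atTop.2 ⟨n, fun k hk => hstep n k hk⟩)
  have hfle : ∀ n, f xs ≤ f (x n) := by
    intro n
    have := hmem n
    simp only [hS, Set.mem_ofPred_eq] at this
    have h2 := mul_nonneg hε.le (dist_nonneg (x := x n) (y := xs))
    linarith
  refine ⟨xs, hfle 0, fun y => ?_⟩
  by_contra! hlt
  -- A point violating the inequality lies in `S xs`, hence in every `S (x n)`, so it competed at
  -- each step; as the tolerances vanish, `f xs ≤ f y`.
  have hy : y ∈ S xs := by simp only [hS, Set.mem_ofPred_eq]; linarith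
  have h1 : ∀ n : ℕ, f xs ≤ f y + 1 / ((n : ℝ) + 1) := fun n =>
    (hfle (n + 1)).trans (hx n ▸ hg n (x n) y (trans _ _ _ (hmem n) hy))
  have h2 : f xs ≤ f y + 0 := ge_of_tendsto'
    (tendsto_const_nhds.add tendsto_one_div_add_atTop_nhds_zero_nat) h1
  have h3 := mul_nonneg hε.le (dist_nonneg (x := xs) (y := y))
  linarith

/-! ### Weak convergence of sequences -/

section Weak

variable {H : Type*} [NormedAddCommGroup H] [NormedSpace ℝ H]
variable {X : Type*} [NormedAddCommGroup X] [NormedSpace ℝ X]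

/-- Weak convergence of a sequence in a normed space. -/
def WeaklyTendsto (u : ℕ → H) (x : H) : Prop :=
  ∀ l : H →L[ℝ] ℝ, Tendsto (fun n => l (u n)) atTop (𝓝 (l x))

namespace WeaklyTendsto

lemma of_tendsto {u : ℕ → H} {x : H} (h : Tendsto u atTop (𝓝 x)) : WeaklyTendsto u x :=
  fun l => (l.continuous.tendsto x).comp h

lemma subseq {u : ℕ → H} {x : H} (h : WeaklyTendsto u x) {σ : ℕ → ℕ}
    (hσ : Tendsto σ atTop atTop) : WeaklyTendsto (u ∘ σ) x := fun l => (h l).comp hσ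

lemma map {u : ℕ → H} {x : H} (h : WeaklyTendsto u x) (T : H →L[ℝ] X) :
    WeaklyTendsto (fun n => T (u n)) (T x) := fun l => h (l.comp T)

lemma add {u v : ℕ → H} {x y : H} (h : WeaklyTendsto u x) (h' : WeaklyTendsto v y) :
    WeaklyTendsto (fun n => u n + v n) (x + y) := fun l => by
  simpa using (h l).add (h' l)

lemma smul {u : ℕ → H} {x : H} (h : WeaklyTendsto u x) {t : ℕ → ℝ} {s : ℝ}
    (ht : Tendsto t atTop (𝓝 s)) : WeaklyTendsto (fun n => t n • u n) (s • x) := fun l => by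
  simpa using ht.mul (h l)

/-- Uniform boundedness principle for the images of `u n` in the bidual. -/
lemma bounded {u : ℕ → H} {x : H} (h : WeaklyTendsto u x) : ∃ C, ∀ n, ‖u n‖ ≤ C := by
  have h1 : ∀ l : H →L[ℝ] ℝ, ∃ C, ∀ n, ‖NormedSpace.inclusionInDoubleDual ℝ H (u n) l‖ ≤ C := by
    intro l
    obtain ⟨C, hC⟩ := (h l).norm.bddAbove_range
    exact ⟨C, fun n => hC ⟨n, rfl⟩⟩
  obtain ⟨C, hC⟩ := banach_steinhaus h1
  exact ⟨C, fun n => by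
    rw [← (NormedSpace.inclusionInDoubleDualLi ℝ (E := H)).norm_map (u n)]; exact hC n⟩

end WeaklyTendsto

end Weak

/-- Sequential Banach–Alaoglu in the dual of a separable space, carried back to `H` by the Riesz
isomorphism. -/
lemma exists_weaklyTendsto_subseq {H : Type*} [NormedAddCommGroup H] [InnerProductSpace ℝ H]
    [CompleteSpace H] [TopologicalSpace.SeparableSpace H] {u : ℕ → H} {C : ℝ}
    (hu : ∀ n, ‖u n‖ ≤ C) :
    ∃ (x : H) (σ : ℕ → ℕ), StrictMono σ ∧ WeaklyTendsto (u ∘ σ) x := by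
  let D := InnerProductSpace.toDual ℝ H
  have hmem : ∀ n, StrongDual.toWeakDual (D (u n)) ∈
      (WeakDual.toStrongDual (𝕜 := ℝ) (E := H)) ⁻¹' Metric.closedBall 0 C := by
    intro n
    simp only [Set.mem_preimage, Metric.mem_closedBall, dist_zero_right]
    exact (D.norm_map (u n)).le.trans (hu n)
  obtain ⟨f, -, σ, hσ, hf⟩ := WeakDual.isSeqCompact_closedBall ℝ H 0 C hmem
  refine ⟨D.symm (WeakDual.toStrongDual f), σ, hσ, fun l => ?_⟩
  have key : ∀ x, l x = inner ℝ x (D.symm l) := fun x => by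
    rw [real_inner_comm, ← InnerProductSpace.toDual_apply_apply (𝕜 := ℝ) (E := H),
      LinearIsometryEquiv.apply_symm_apply]
  have h2 := ((WeakDual.eval_continuous (D.symm l)).tendsto f).comp hf
  rw [key]
  have h3 : inner ℝ (D.symm (WeakDual.toStrongDual f)) (D.symm l) = f (D.symm l) := by
    rw [← InnerProductSpace.toDual_apply_apply (𝕜 := ℝ) (E := H),
      LinearIsometryEquiv.apply_symm_apply]
    rfl
  rw [h3]
  refine h2.congr fun n => ?_
  rw [key]
  rfl

lemma exists_subseq_tendsto_weaklyTendsto {H : Type*} [NormedAddCommGroup H]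
    [InnerProductSpace ℝ H] [CompleteSpace H] [TopologicalSpace.SeparableSpace H]
    {t : ℕ → ℝ} {w : ℕ → H} {C : ℝ} (ht0 : ∀ n, 0 ≤ t n) (ht : ∀ n, t n ≤ C)
    (hw : ∀ n, ‖w n‖ ≤ C) :
    ∃ (σ : ℕ → ℕ) (s : ℝ) (x : H), StrictMono σ ∧ 0 ≤ s ∧ Tendsto (t ∘ σ) atTop (𝓝 s) ∧
      WeaklyTendsto (w ∘ σ) x := by
  obtain ⟨s, hs, σ, hσ, hts⟩ := isCompact_Icc.tendsto_subseq
    (fun n => (⟨ht0 n, ht n⟩ : t n ∈ Set.Icc 0 C))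
  obtain ⟨x, τ, hτ, hx⟩ := exists_weaklyTendsto_subseq (u := w ∘ σ) (fun n => hw _)
  exact ⟨σ ∘ τ, s, x, hσ.comp hτ, hs.1, hts.comp hτ.tendsto_atTop, hx⟩

end HamSys
end

noncomputable section

namespace HamSys

/-! ### Strongly indefinite functionals with convex nonlinear part -/

section Abstract

variable {H : Type*} [NormedAddCommGroup H] [InnerProductSpace ℝ H]
variable {X : Type*} [NormedAddCommGroup X] [NormedSpace ℝ X]

/-- The functional `z ↦ A(z, z) / 2 - I(z)`. -/
def energy (A : X →L[ℝ] X →L[ℝ] ℝ) (I : X → ℝ) (z : X) : ℝ := 1 / 2 * A z z - I z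

/-- The structural assumptions on a functional `A(z, z) / 2 - I(z)` on `X = Tp H ⊕ Tm H`, where
`A` is positive definite on `Tp H` and negative definite on `Tm H`. -/
structure IndefiniteFunctional (Tp Tm : H →L[ℝ] X) (A : X →L[ℝ] X →L[ℝ] ℝ) (I : X → ℝ)
    (I' : X → X →L[ℝ] ℝ) (c : ℝ) : Prop where
  symm : ∀ z ζ, A z ζ = A ζ z
  c_pos : 0 < c
  pos : ∀ y, c * ‖y‖ ^ 2 ≤ A (Tp y) (Tp y)
  neg : ∀ w, A (Tm w) (Tm w) ≤ -(c * ‖w‖ ^ 2)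
  decomp : ∀ z, ∃ y w, z = Tp y + Tm w
  hasFDerivAt : ∀ z, HasFDerivAt I (I' z) z
  nonneg : ∀ z, 0 ≤ I z
  zero : I 0 = 0
  ineq : ∀ θ : ℝ, 0 ≤ θ → ∀ z ζ,
    0 ≤ (1 - θ ^ 2) / 2 * I' z z - θ * I' z ζ + I (θ • z + ζ) - I z
  weak : ∀ (u : ℕ → X) (z : X), WeaklyTendsto u z → ∀ φ,
    Tendsto (fun n => I' (u n) φ) atTop (𝓝 (I' z φ))
  -- No bound on `w` is required: in the application `a u + b v` does not depend on the `Tm`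
  -- component.
  superquadratic : ∀ (y : ℕ → H) (y₀ : H), WeaklyTendsto y y₀ → y₀ ≠ 0 → ∀ t : ℕ → ℝ,
    Tendsto t atTop atTop → ∀ w : ℕ → H,
    Tendsto (fun n => I (t n • Tp (y n) + Tm (w n)) / t n ^ 2) atTop atTop
  small : ∃ ρ : ℝ, 0 < ρ ∧ ∀ y, ‖y‖ = ρ → I (Tp y) ≤ c / 4 * ‖y‖ ^ 2
  fatou : ∀ (u : ℕ → X) (z : X), WeaklyTendsto u z → ∀ l,
    Tendsto (fun n => 1 / 2 * I' (u n) (u n) - I (u n)) atTop (𝓝 l) → 1 / 2 * I' z z - I z ≤ l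
  -- The isometries `τ n` stand for translations, acting on both components at once; the weak limit
  -- is recovered only after applying them.
  nonvanishing : ∀ y : ℕ → H, (∀ n, ‖y n‖ ≤ 1) → ∀ R δ : ℝ, 0 < δ →
    (∀ n, δ ≤ I (R • Tp (y n))) → ∃ (τ : ℕ → (H ≃ₗᵢ[ℝ] H)) (σ : ℕ → ℕ) (y₀ : H),
      (∀ n y w, energy A I (Tp (τ n y) + Tm (τ n w)) = energy A I (Tp y + Tm w)) ∧
      StrictMono σ ∧ y₀ ≠ 0 ∧ WeaklyTendsto (fun n => τ n (y (σ n))) y₀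

/-- `(t, w)` maximizes the energy of `s Tp y + Tm v` over `s ≥ 0` and `v`. -/
def IsFiberMax (Tp Tm : H →L[ℝ] X) (A : X →L[ℝ] X →L[ℝ] ℝ) (I : X → ℝ) (y : H) (t : ℝ) (w : H) :
    Prop :=
  0 ≤ t ∧ ∀ s : ℝ, 0 ≤ s → ∀ v, energy A I (s • Tp y + Tm v) ≤ energy A I (t • Tp y + Tm w)

variable {Tp Tm : H →L[ℝ] X} {A : X →L[ℝ] X →L[ℝ] ℝ} {I : X → ℝ} {I' : X → X →L[ℝ] ℝ} {c : ℝ}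

lemma fiberMax_normalize {y : H} (hy : y ≠ 0) {t : ℝ} {w : H} (h : IsFiberMax Tp Tm A I y t w) :
    IsFiberMax Tp Tm A I (‖y‖⁻¹ • y) (t * ‖y‖) w ∧
      (t * ‖y‖) • Tp (‖y‖⁻¹ • y) + Tm w = t • Tp y + Tm w := by
  have hn : ‖y‖ ≠ 0 := norm_ne_zero_iff.2 hy
  have e : (t * ‖y‖) • Tp (‖y‖⁻¹ • y) = t • Tp y := by
    rw [map_smul, smul_smul]; congr 1; field_simp
  refine ⟨⟨mul_nonneg h.1 (norm_nonneg _), fun s hs v => ?_⟩, by rw [e]⟩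
  rw [e, map_smul, smul_smul]
  exact h.2 _ (mul_nonneg hs (inv_nonneg.2 (norm_nonneg _))) v

namespace IndefiniteFunctional

lemma convex_ineq (S : IndefiniteFunctional Tp Tm A I I' c)
    (z h : X) : I z + I' z h ≤ I (z + h) := by
  have := S.ineq 1 zero_le_one z h
  simp only [one_smul] at this
  linarith

lemma quad_add (S : IndefiniteFunctional Tp Tm A I I' c)
    (z h : X) : A (z + h) (z + h) = A z z + 2 * A z h + A h h := by
  simp only [map_add, add_apply, S.symm h z]
  ring

lemma energy_zero (S : IndefiniteFunctional Tp Tm A I I' c)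
    : energy A I 0 = 0 := by simp [energy, S.zero]

lemma hasFDerivAt_energy (S : IndefiniteFunctional Tp Tm A I I' c)
    (z : X) : HasFDerivAt (energy A I) (A z - I' z) z := by
  have h1 : HasFDerivAt (fun z => A z z) ((A z).comp (ContinuousLinearMap.id ℝ X) +
      (A.flip z)) z := by
    have := (A.hasFDerivAt (x := z)).clm_apply (hasFDerivAt_id z)
    simpa using this
  have h2 := (h1.const_mul (1 / 2)).sub (S.hasFDerivAt z)
  refine h2.congr_fderiv ?_
  ext ζ
  simp only [sub_apply, smul_apply,
    add_apply, ContinuousLinearMap.comp_apply, ContinuousLinearMap.flip_apply,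
    ContinuousLinearMap.id_apply, smul_eq_mul, S.symm ζ z]
  ring

lemma continuous_energy (S : IndefiniteFunctional Tp Tm A I I' c)
    : Continuous (energy A I) :=
  continuous_iff_continuousAt.2 fun z => (S.hasFDerivAt_energy z).continuousAt

/-- A common vector of the two ranges would have `A` both nonnegative and nonpositive on it. -/
lemma eq_zero_of_mem_range (S : IndefiniteFunctional Tp Tm A I I' c)
    {y w : H} (h : Tp y + Tm w ∈ Set.range Tm) : y = 0 := by
  obtain ⟨v, hv⟩ := h
  have h1 : Tp y = Tm (v - w) := by rw [map_sub, hv]; abel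
  have h2 := S.pos y
  have h3 := S.neg (v - w)
  rw [h1] at h2
  have h4 : 0 ≤ c * ‖v - w‖ ^ 2 := mul_nonneg S.c_pos.le (sq_nonneg _)
  have h5 : ‖y‖ ^ 2 ≤ 0 := by
    by_contra! h
    have := mul_pos S.c_pos h
    linarith
  simpa using pow_eq_zero_iff (two_ne_zero) |>.1 (le_antisymm h5 (sq_nonneg _))

/-- The exact identity behind both maximality and uniqueness: the gap between the energies of `z`
and `θ • z + Tm w` is a sum of two nonnegative terms, one from negative definiteness and one from
`ineq`. -/
lemma energy_eq_of_nehari (S : IndefiniteFunctional Tp Tm A I I' c)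
    {z : X} (hz : A z z = I' z z) {w : H} (hw : A z (Tm w) = I' z (Tm w))
    (θ : ℝ) : energy A I z = energy A I (θ • z + Tm w) - 1 / 2 * A (Tm w) (Tm w)
      + ((1 - θ ^ 2) / 2 * I' z z - θ * I' z (Tm w) + I (θ • z + Tm w) - I z) := by
  unfold energy
  rw [S.quad_add]
  simp only [map_smul, smul_apply, smul_eq_mul, hz, hw]
  ring

lemma energy_le_of_nehari (S : IndefiniteFunctional Tp Tm A I I' c)
    {z : X} (hz : A z z = I' z z) {w : H}
    (hw : A z (Tm w) = I' z (Tm w)) {θ : ℝ} (hθ : 0 ≤ θ) :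
    energy A I (θ • z + Tm w) ≤ energy A I z := by
  rw [S.energy_eq_of_nehari hz hw θ]
  have h1 := S.ineq θ hθ z (Tm w)
  have h2 := S.neg w
  have h3 : 0 ≤ c * ‖w‖ ^ 2 := mul_nonneg S.c_pos.le (sq_nonneg _)
  linarith

/-- The two ranges need not be orthogonal for `A`. Young's inequality absorbs the cross term into
half of the negative part, hence `c / 2`. -/
lemma exists_quad_le (S : IndefiniteFunctional Tp Tm A I I' c)
    : ∃ K : ℝ, 0 < K ∧ ∀ (t : ℝ) (y w : H),
    A (t • Tp y + Tm w) (t • Tp y + Tm w) ≤ K * (t * ‖y‖) ^ 2 - c / 2 * ‖w‖ ^ 2 := by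
  set M := ‖A‖ * ‖Tp‖ * ‖Tp‖ with hM
  set M' := ‖A‖ * ‖Tp‖ * ‖Tm‖ with hM'
  have hc := S.c_pos
  refine ⟨M + 2 * M' ^ 2 / c + 1, by positivity, fun t y w => ?_⟩
  have h1 : A (Tp y) (Tp y) ≤ M * ‖y‖ ^ 2 := by
    refine (le_abs_self _).trans ((A.le_opNorm₂ _ _).trans ?_)
    calc ‖A‖ * ‖Tp y‖ * ‖Tp y‖ ≤ ‖A‖ * (‖Tp‖ * ‖y‖) * (‖Tp‖ * ‖y‖) := by
          gcongr <;> exact Tp.le_opNorm y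
      _ = M * ‖y‖ ^ 2 := by rw [hM]; ring
  have h2 : t * A (Tp y) (Tm w) ≤ M' * (|t| * ‖y‖) * ‖w‖ := by
    refine (le_abs_self _).trans ?_
    rw [abs_mul]
    calc |t| * |A (Tp y) (Tm w)| ≤ |t| * (‖A‖ * (‖Tp‖ * ‖y‖) * (‖Tm‖ * ‖w‖)) := by
          gcongr
          refine (A.le_opNorm₂ _ _).trans ?_
          gcongr
          · exact Tp.le_opNorm y
          · exact Tm.le_opNorm w
      _ = M' * (|t| * ‖y‖) * ‖w‖ := by rw [hM']; ring
  have h3 := S.neg w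
  have h4 : 2 * (M' * (|t| * ‖y‖) * ‖w‖) ≤ 2 * M' ^ 2 / c * (t * ‖y‖) ^ 2 + c / 2 * ‖w‖ ^ 2 := by
    have h5 : 0 ≤ (2 * (M' * (|t| * ‖y‖)) - c * ‖w‖) ^ 2 / (2 * c) := by positivity
    have h6 : (2 * (M' * (|t| * ‖y‖)) - c * ‖w‖) ^ 2 / (2 * c)
        = 2 * M' ^ 2 / c * (|t| ^ 2 * ‖y‖ ^ 2) + c / 2 * ‖w‖ ^ 2
          - 2 * (M' * (|t| * ‖y‖) * ‖w‖) := by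
      field_simp
      ring
    rw [sq_abs, ← mul_pow] at h6
    linarith
  rw [S.quad_add]
  simp only [map_smul, smul_apply, smul_eq_mul]
  have h7 : t * (t * A (Tp y) (Tp y)) ≤ M * (t * ‖y‖) ^ 2 := by
    have := mul_le_mul_of_nonneg_left h1 (sq_nonneg t)
    calc t * (t * A (Tp y) (Tp y)) = t ^ 2 * A (Tp y) (Tp y) := by ring
      _ ≤ _ := this
      _ = _ := by ring
  have h8 : 0 ≤ (t * ‖y‖) ^ 2 := sq_nonneg _
  linarith

/-- If `t` were unbounded, the energy bound would keep `I / t²` below a constant, against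
superquadratic growth; once `t` is bounded, the negative part of `A` bounds `w`. This plays the role
of boundedness of Palais–Smale sequences. -/
lemma exists_bound (S : IndefiniteFunctional Tp Tm A I I' c)
    {y : ℕ → H} {y₀ : H} (hy : WeaklyTendsto y y₀) (hy₀ : y₀ ≠ 0) {t : ℕ → ℝ}
    (ht : ∀ n, 0 ≤ t n) {w : ℕ → H} (hE : ∀ n, -1 ≤ energy A I (t n • Tp (y n) + Tm (w n))) :
    ∃ C, ∀ n, t n ≤ C ∧ ‖w n‖ ≤ C := by
  obtain ⟨K, hK, hquad⟩ := S.exists_quad_le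
  obtain ⟨B, hB⟩ := hy.bounded
  have hB0 : 0 ≤ B := (norm_nonneg _).trans (hB 0)
  have hc := S.c_pos
  have main : ∃ C, ∀ n, t n ≤ C := by
    by_contra! hcon
    have hfreq : ∀ n : ℕ, ∃ᶠ k in atTop, (n : ℝ) + 1 < t k := by
      intro n
      rw [Filter.Frequently]
      intro hev
      have hb : IsBoundedUnder (· ≤ ·) atTop t :=
        ⟨(n : ℝ) + 1, by simpa [Filter.eventually_map] using hev⟩
      obtain ⟨C, hC⟩ := hb.bddAbove_range
      obtain ⟨k, hk⟩ := hcon C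
      exact absurd (hC ⟨k, rfl⟩) (not_le.2 hk)
    obtain ⟨σ, hσ, hlt⟩ := extraction_forall_of_frequently hfreq
    have htop : Tendsto (t ∘ σ) atTop atTop := by
      refine tendsto_atTop_mono (fun n => ?_) tendsto_natCast_atTop_atTop
      have := hlt n
      simp only [Function.comp]
      linarith
    have h1 := S.superquadratic (y ∘ σ) y₀ (hy.subseq hσ.tendsto_atTop) hy₀ (t ∘ σ) htop (w ∘ σ)
    have h2 : ∀ n, I ((t ∘ σ) n • Tp ((y ∘ σ) n) + Tm ((w ∘ σ) n)) / (t ∘ σ) n ^ 2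
        ≤ K * B ^ 2 + 1 := by
      intro n
      have ht1 : 1 ≤ t (σ n) := by
        have := hlt n
        have : (0 : ℝ) ≤ n := n.cast_nonneg
        linarith
      simp only [Function.comp]
      rw [div_le_iff₀ (by positivity)]
      have h3 := hE (σ n)
      have h4 := hquad (t (σ n)) (y (σ n)) (w (σ n))
      unfold energy at h3
      have h5 : (t (σ n) * ‖y (σ n)‖) ^ 2 ≤ t (σ n) ^ 2 * B ^ 2 := by
        rw [mul_pow]
        gcongr
        exact hB _
      have h6 : 0 ≤ c / 2 * ‖w (σ n)‖ ^ 2 := by positivity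
      have h7 := mul_le_mul_of_nonneg_left h5 hK.le
      have h8 : 1 ≤ t (σ n) ^ 2 := one_le_pow₀ ht1
      have h9 : 0 ≤ K * (t (σ n) ^ 2 * B ^ 2) := by positivity
      nlinarith
    obtain ⟨n, hn⟩ := (h1.eventually (eventually_gt_atTop (K * B ^ 2 + 1))).exists
    exact absurd (h2 n) (not_le.2 hn)
  obtain ⟨C, hC⟩ := main
  have hC0 : 0 ≤ C := (ht 0).trans (hC 0)
  -- The summand `2` comes from the energy bound `-1`, doubled because `A` enters with factor `1 /
  -- 2`.
  set Q := K * (C * B) ^ 2 + 2 with hQ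
  have hQ0 : 0 ≤ Q := by positivity
  refine ⟨max C (Q * 2 / c + 1), fun n => ⟨(hC n).trans (le_max_left _ _), ?_⟩⟩
  refine le_trans ?_ (le_max_right _ _)
  have h3 := hE n
  have h4 := hquad (t n) (y n) (w n)
  unfold energy at h3
  have h5 := S.nonneg (t n • Tp (y n) + Tm (w n))
  have h6 : (t n * ‖y n‖) ^ 2 ≤ (C * B) ^ 2 := by
    have := ht n
    gcongr
    · exact hC n
    · exact hB n
  have h7 := mul_le_mul_of_nonneg_left h6 hK.le
  have h8 : ‖w n‖ ^ 2 ≤ Q * 2 / c := by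
    rw [le_div_iff₀ hc]
    nlinarith
  have h9 : 0 ≤ Q * 2 / c := by positivity
  nlinarith [norm_nonneg (w n)]

/-- Upper semicontinuity when the `Tp` part converges strongly and the `Tm` part only weakly. The
convex `I` lies above its tangent at the limit and `A` is nonpositive on `Tm (w n - w₀)`, so the
terms without a limit have the right sign. -/
lemma le_energy_of_weaklyTendsto (S : IndefiniteFunctional Tp Tm A I I' c)
    {y : ℕ → H} {y₀ : H} (hy : Tendsto y atTop (𝓝 y₀))
    {t : ℕ → ℝ} {t₀ : ℝ} (ht : Tendsto t atTop (𝓝 t₀)) {w : ℕ → H} {w₀ : H}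
    (hw : WeaklyTendsto w w₀) {l : ℕ → ℝ} {l₀ : ℝ} (hl : Tendsto l atTop (𝓝 l₀))
    (hle : ∀ n, l n ≤ energy A I (t n • Tp (y n) + Tm (w n))) :
    l₀ ≤ energy A I (t₀ • Tp y₀ + Tm w₀) := by
  set z := t₀ • Tp y₀ + Tm w₀ with hz
  set d : ℕ → X := fun n => t n • Tp (y n) - t₀ • Tp y₀ with hd
  have hd0 : Tendsto d atTop (𝓝 0) := by
    have : Tendsto d atTop (𝓝 (t₀ • Tp y₀ - t₀ • Tp y₀)) :=
      (ht.smul ((Tp.continuous.tendsto y₀).comp hy)).sub_const _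
    simpa using this
  have hstep : ∀ n, energy A I (t n • Tp (y n) + Tm (w n)) ≤ energy A I z
      + (A z - I' z) (d n) + ((A z - I' z) (Tm (w n)) - (A z - I' z) (Tm w₀))
      + 1 / 2 * A (d n) (d n) + A (d n) (Tm (w n - w₀)) := by
    intro n
    have e1 : t n • Tp (y n) + Tm (w n) = z + (d n + Tm (w n - w₀)) := by
      simp only [hz, hd, map_sub]; abel
    rw [e1]
    clear_value z
    have h1 := S.convex_ineq z (d n + Tm (w n - w₀))
    have h2 := S.neg (w n - w₀)
    have h3 : 0 ≤ c * ‖w n - w₀‖ ^ 2 := mul_nonneg S.c_pos.le (sq_nonneg _)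
    unfold energy
    rw [S.quad_add z, S.quad_add (d n)]
    rw [map_add (I' z)] at h1
    simp only [map_add (A z), sub_apply]
    have h4 : A z (Tm (w n - w₀)) = A z (Tm (w n)) - A z (Tm w₀) := by simp only [map_sub]
    have h5 : I' z (Tm (w n - w₀)) = I' z (Tm (w n)) - I' z (Tm w₀) := by simp only [map_sub]
    linarith
  have lim1 : Tendsto (fun n => (A z - I' z) (d n)) atTop (𝓝 0) := by
    have := ((A z - I' z).continuous.tendsto 0).comp hd0
    rwa [map_zero] at this
  have lim2 : Tendsto (fun n => (A z - I' z) (Tm (w n)) - (A z - I' z) (Tm w₀)) atTop (𝓝 0) := by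
    simpa using ((hw.map Tm) (A z - I' z)).sub_const ((A z - I' z) (Tm w₀))
  have lim3 : Tendsto (fun n => 1 / 2 * A (d n) (d n)) atTop (𝓝 0) := by
    have : Continuous (fun x : X => 1 / 2 * A x x) :=
      continuous_const.mul (A.continuous.clm_apply continuous_id)
    have h0 := (this.tendsto 0).comp hd0
    rwa [map_zero, mul_zero] at h0
  have lim4 : Tendsto (fun n => A (d n) (Tm (w n - w₀))) atTop (𝓝 0) := by
    obtain ⟨B, hB⟩ := hw.bounded
    have hn : Tendsto (fun n => ‖A‖ * ‖d n‖ * (‖Tm‖ * (B + ‖w₀‖))) atTop (𝓝 0) := by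
      have := ((hd0.norm).const_mul ‖A‖).mul_const (‖Tm‖ * (B + ‖w₀‖))
      simpa using this
    refine squeeze_zero_norm (fun n => (A.le_opNorm₂ _ _).trans ?_) hn
    gcongr
    refine (Tm.le_opNorm _).trans ?_
    gcongr
    exact (norm_sub_le _ _).trans (by gcongr; exact hB n)
  have lim := (((tendsto_const_nhds (x := energy A I z)).add lim1).add lim2).add lim3 |>.add lim4
  simp only [add_zero] at lim
  exact le_of_tendsto_of_tendsto' hl lim fun n => (hle n).trans (hstep n)

lemma energy_fiberMax_nonneg (S : IndefiniteFunctional Tp Tm A I I' c)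
    {y : H} {t : ℝ} {w : H} (h : IsFiberMax Tp Tm A I y t w) :
    0 ≤ energy A I (t • Tp y + Tm w) := by
  have := h.2 0 le_rfl 0
  simpa [S.energy_zero] using this

lemma energy_Tm_nonpos (S : IndefiniteFunctional Tp Tm A I I' c)
    (w : H) : energy A I (Tm w) ≤ 0 := by
  have h2 := S.neg w
  have h3 : 0 ≤ c * ‖w‖ ^ 2 := mul_nonneg S.c_pos.le (sq_nonneg _)
  have h4 := S.nonneg (Tm w)
  unfold energy
  linarith

lemma nehari_of_fiberMax (S : IndefiniteFunctional Tp Tm A I I' c)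
    {y : H} {t : ℝ} {w : H} (h : IsFiberMax Tp Tm A I y t w)
    (hpos : 0 < energy A I (t • Tp y + Tm w)) :
    0 < t ∧ A (t • Tp y + Tm w) (t • Tp y + Tm w) = I' (t • Tp y + Tm w) (t • Tp y + Tm w) ∧
      ∀ v, A (t • Tp y + Tm w) (Tm v) = I' (t • Tp y + Tm w) (Tm v) := by
  set z := t • Tp y + Tm w with hz
  have htpos : 0 < t := by
    rcases h.1.lt_or_eq with h0 | h0
    · exact h0
    · exfalso
      rw [← h0, zero_smul, zero_add] at hz
      rw [hz] at hpos
      exact absurd (S.energy_Tm_nonpos w) (not_le.2 hpos)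
  have hder : ∀ ζ : X, HasDerivAt (fun s : ℝ => energy A I (z + s • ζ)) ((A z - I' z) ζ) 0 := by
    intro ζ
    have h1 : HasDerivAt (fun s : ℝ => z + s • ζ) ζ 0 := by
      simpa using ((hasDerivAt_id (0 : ℝ)).smul_const ζ).const_add z
    have h2 : HasFDerivAt (energy A I) (A z - I' z) (z + (0 : ℝ) • ζ) := by
      rw [zero_smul, add_zero]
      exact S.hasFDerivAt_energy z
    exact h2.comp_hasDerivAt (0 : ℝ) h1
  refine ⟨htpos, ?_, fun v => ?_⟩
  -- As `t > 0`, the constraint `s ≥ 0` on the fibre is inactive near `z`, and the radial derivative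
  -- vanishes from both sides.
  · have hmax : IsLocalMax (fun s : ℝ => energy A I (z + s • z)) 0 := by
      filter_upwards [Ioi_mem_nhds (show (-1 : ℝ) < 0 by norm_num)] with s hs
      have hs' : (0 : ℝ) ≤ 1 + s := by simp only [Set.mem_Ioi] at hs; linarith
      have := h.2 ((1 + s) * t) (mul_nonneg hs' htpos.le) ((1 + s) • w)
      rw [map_smul, mul_smul, ← smul_add, add_smul, one_smul, ← hz] at this
      simpa using this
    have := hmax.hasDerivAt_eq_zero (hder z)
    simpa [sub_eq_zero] using this
  · have hmax : IsLocalMax (fun s : ℝ => energy A I (z + s • Tm v)) 0 := by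
      refine Eventually.of_forall fun s => ?_
      have := h.2 t htpos.le (w + s • v)
      rw [map_add, map_smul, ← add_assoc, ← hz] at this
      simpa using this
    have := hmax.hasDerivAt_eq_zero (hder (Tm v))
    simpa [sub_eq_zero] using this

/-- Equality of the two maximal energies in `energy_eq_of_nehari` makes both nonnegative terms
vanish. So the points are proportional, and the expression in `ineq` attains its minimum `0` at `ζ =
0`; its first-order condition there is the scaling of `I'`. -/
lemma fiberMax_unique (S : IndefiniteFunctional Tp Tm A I I' c)
    {y : H} {t t' : ℝ} {w w' : H} (h : IsFiberMax Tp Tm A I y t w)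
    (h' : IsFiberMax Tp Tm A I y t' w') (hpos : 0 < energy A I (t • Tp y + Tm w)) :
    t' • Tp y + Tm w' = (t' / t) • (t • Tp y + Tm w) ∧
      I' (t' • Tp y + Tm w') = (t' / t) • I' (t • Tp y + Tm w) := by
  obtain ⟨ht, hz1, hz2⟩ := S.nehari_of_fiberMax h hpos
  set z := t • Tp y + Tm w with hz
  set θ := t' / t with hθ
  have hθ0 : 0 ≤ θ := div_nonneg h'.1 ht.le
  have hz' : t' • Tp y + Tm w' = θ • z + Tm (w' - θ • w) := by
    have : θ * t = t' := by rw [hθ]; field_simp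
    rw [hz, smul_add, smul_smul, this, map_sub, map_smul]
    abel
  have heq := S.energy_eq_of_nehari hz1 (hz2 (w' - θ • w)) θ
  have hineq := S.ineq θ hθ0 z (Tm (w' - θ • w))
  have hneg := S.neg (w' - θ • w)
  have h1 : energy A I z ≤ energy A I (θ • z + Tm (w' - θ • w)) := by
    rw [← hz']
    exact h'.2 t h.1 w
  have hw0 : ‖w' - θ • w‖ ^ 2 ≤ 0 := by
    by_contra! hlt
    have := mul_pos S.c_pos hlt
    linarith
  have hw : w' - θ • w = 0 := by
    simpa using pow_eq_zero_iff (two_ne_zero) |>.1 (le_antisymm hw0 (sq_nonneg _))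
  rw [hw, map_zero, add_zero] at hz'
  rw [hw, map_zero, add_zero] at heq h1
  refine ⟨hz', ?_⟩
  have hD : (1 - θ ^ 2) / 2 * I' z z - θ * I' z 0 + I (θ • z + 0) - I z = 0 := by
    have h2 := S.ineq θ hθ0 z 0
    rw [add_zero] at h2 ⊢
    simp only [map_zero] at heq h2 ⊢
    linarith
  set D : X → ℝ := fun ζ => (1 - θ ^ 2) / 2 * I' z z - θ * I' z ζ + I (θ • z + ζ) - I z
  have hmin : IsLocalMin D 0 := Eventually.of_forall fun ζ => by
    show D 0 ≤ D ζ
    rw [show D 0 = 0 from hD]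
    exact S.ineq θ hθ0 z ζ
  have hder : HasFDerivAt D (-(θ • I' z) + I' (θ • z)) 0 := by
    have e1 : HasFDerivAt (fun ζ => I (θ • z + ζ)) (I' (θ • z)) 0 := by
      have h2 : HasFDerivAt I (I' (θ • z)) (θ • z + id (0 : X)) := by
        rw [id_eq, add_zero]
        exact S.hasFDerivAt (θ • z)
      have h3 := h2.comp (0 : X) ((hasFDerivAt_id (0 : X)).const_add (θ • z))
      rwa [ContinuousLinearMap.comp_id] at h3
    have e2 : HasFDerivAt (fun ζ => θ * I' z ζ) (θ • I' z) 0 := (I' z).hasFDerivAt.const_mul θ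
    have := ((e2.const_sub ((1 - θ ^ 2) / 2 * I' z z)).add e1).sub_const (I z)
    exact this
  have h0 := hmin.hasFDerivAt_eq_zero hder
  rw [hz']
  rw [neg_add_eq_zero] at h0
  exact h0.symm

/-- Direct method: `exists_bound` shows that the supremum is finite and that maximizing sequences
are bounded; upper semicontinuity passes to the limit. -/
lemma exists_isFiberMax (S : IndefiniteFunctional Tp Tm A I I' c)
    [CompleteSpace H] [TopologicalSpace.SeparableSpace H] {y : H}
    (hy : y ≠ 0) : ∃ t w, IsFiberMax Tp Tm A I y t w := by
  set V : Set ℝ := {r | ∃ (s : ℝ) (v : H), 0 ≤ s ∧ r = energy A I (s • Tp y + Tm v)} with hV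
  have h0 : (0 : ℝ) ∈ V := ⟨0, 0, le_rfl, by simp [S.energy_zero]⟩
  have hyc : WeaklyTendsto (fun _ : ℕ => y) y := fun l => tendsto_const_nhds
  have hbdd : BddAbove V := by
    by_contra hcon
    rw [not_bddAbove_iff] at hcon
    have : ∀ n : ℕ, ∃ (s : ℝ) (v : H), 0 ≤ s ∧ (n : ℝ) < energy A I (s • Tp y + Tm v) := by
      intro n
      obtain ⟨_, ⟨s, v, hs, rfl⟩, hlt⟩ := hcon n
      exact ⟨s, v, hs, hlt⟩
    choose s v hs hlt using this
    obtain ⟨C, hC⟩ := S.exists_bound hyc hy hs (w := v) (fun n => by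
      have := hlt n
      have : (0 : ℝ) ≤ n := n.cast_nonneg
      linarith)
    obtain ⟨K, hK, hquad⟩ := S.exists_quad_le
    obtain ⟨n, hn⟩ := exists_nat_gt (K * (C * ‖y‖) ^ 2)
    have h1 := hquad (s n) y (v n)
    have h2 := hlt n
    have h3 := S.nonneg (s n • Tp y + Tm (v n))
    have h4 : 0 ≤ c / 2 * ‖v n‖ ^ 2 := mul_nonneg (half_pos S.c_pos).le (sq_nonneg _)
    have h5 : (s n * ‖y‖) ^ 2 ≤ (C * ‖y‖) ^ 2 := by
      have := hs n
      gcongr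
      exact (hC n).1
    have h6 := mul_le_mul_of_nonneg_left h5 hK.le
    have h7 : 0 ≤ K * (C * ‖y‖) ^ 2 := by positivity
    unfold energy at h2
    linarith
  have hseq : ∀ n : ℕ, ∃ (s : ℝ) (v : H), 0 ≤ s ∧
      sSup V - 1 / ((n : ℝ) + 1) ≤ energy A I (s • Tp y + Tm v) := by
    intro n
    obtain ⟨_, ⟨s, v, hs, rfl⟩, hlt⟩ := exists_lt_of_lt_csSup ⟨0, h0⟩
      (sub_lt_self (sSup V) (Nat.one_div_pos_of_nat (α := ℝ) (n := n)))
    exact ⟨s, v, hs, hlt.le⟩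
  choose s v hs hle using hseq
  have hsup : 0 ≤ sSup V := le_csSup hbdd h0
  obtain ⟨C, hC⟩ := S.exists_bound hyc hy hs (w := v) (fun n => by
    have h1 := hle n
    have h2 : 1 / ((n : ℝ) + 1) ≤ 1 := by
      rw [div_le_one (by positivity)]
      have : (0 : ℝ) ≤ n := n.cast_nonneg
      linarith
    linarith)
  obtain ⟨σ, t, w, hσ, ht, hts, hw⟩ := exists_subseq_tendsto_weaklyTendsto hs
    (fun n => (hC n).1) (fun n => (hC n).2)
  have hlim : Tendsto (fun n => sSup V - 1 / ((σ n : ℝ) + 1)) atTop (𝓝 (sSup V)) := by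
    have := (tendsto_one_div_add_atTop_nhds_zero_nat (𝕜 := ℝ)).comp hσ.tendsto_atTop
    simpa using this.const_sub (sSup V)
  have hfin := S.le_energy_of_weaklyTendsto (tendsto_const_nhds (x := y)) hts hw hlim
    (fun n => hle (σ n))
  exact ⟨t, w, ht, fun s' hs' v' => (le_csSup hbdd ⟨s', v', hs', rfl⟩).trans hfin⟩

/-- If the fiberwise maximum decreases at `y` at a rate of at most `ε`, then the derivative of the
energy at the maximizer is small. -/
lemma energy_deriv_ge (S : IndefiniteFunctional Tp Tm A I I' c)
    [CompleteSpace H] [TopologicalSpace.SeparableSpace H] {y : H}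
    (hy : ‖y‖ = 1) {t : ℝ} {w : H} (h : IsFiberMax Tp Tm A I y t w) {α K ε : ℝ} (hα : 0 < α)
    (hαle : α ≤ energy A I (t • Tp y + Tm w)) (hK : 0 < K)
    (hquad : ∀ (t : ℝ) (y w : H),
      A (t • Tp y + Tm w) (t • Tp y + Tm w) ≤ K * (t * ‖y‖) ^ 2 - c / 2 * ‖w‖ ^ 2)
    (hε : 0 ≤ ε) (hslope : ∀ (y' : H) (t' : ℝ) (w' : H), y' ≠ 0 → IsFiberMax Tp Tm A I y' t' w' →
      energy A I (t • Tp y + Tm w) - ε * ‖y' - y‖ ≤ energy A I (t' • Tp y' + Tm w'))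
    (h₁ : H) : -(ε * t * K / (2 * α)) * ‖h₁‖ ≤
      (A (t • Tp y + Tm w) - I' (t • Tp y + Tm w)) (Tp h₁) := by
  set z := t • Tp y + Tm w with hz
  have hpos : 0 < energy A I z := hα.trans_le hαle
  -- The summand `‖h₁‖` keeps `s n * ‖h₁‖ < 1 = ‖y‖`, so that `y + s n • h₁` never vanishes.
  set s : ℕ → ℝ := fun n => 1 / ((n : ℝ) + 1 + ‖h₁‖) with hs
  have hspos : ∀ n, 0 < s n := fun n => by positivity
  have hs0 : Tendsto s atTop (𝓝 0) := by
    refine squeeze_zero (fun n => (hspos n).le) (fun n => ?_)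
      (tendsto_one_div_add_atTop_nhds_zero_nat (𝕜 := ℝ))
    simp only [hs]
    exact one_div_le_one_div_of_le (by positivity) (by linarith [norm_nonneg h₁])
  set yn : ℕ → H := fun n => y + s n • h₁ with hyn
  have hyn0 : ∀ n, yn n ≠ 0 := by
    intro n h0
    have h1 : y = -(s n • h₁) := eq_neg_of_add_eq_zero_left h0
    have h2 : ‖y‖ = s n * ‖h₁‖ := by
      rw [h1, norm_neg, norm_smul, Real.norm_of_nonneg (hspos n).le]
    rw [hy] at h2
    have h3 : s n * ‖h₁‖ < 1 := by
      simp only [hs]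
      rw [one_div, inv_mul_lt_iff₀ (by positivity)]
      have : (0 : ℝ) ≤ n := n.cast_nonneg
      linarith
    linarith
  have hynlim : Tendsto yn atTop (𝓝 y) := by
    simpa using (hs0.smul_const h₁).const_add y
  have hy0 : y ≠ 0 := by
    intro h0
    rw [h0, norm_zero] at hy
    exact zero_ne_one hy
  choose tn wn hmax using fun n => S.exists_isFiberMax (hyn0 n)
  obtain ⟨C, hC⟩ := S.exists_bound (WeaklyTendsto.of_tendsto hynlim) hy0 (fun n => (hmax n).1)
    (w := wn) (fun n => by linarith [S.energy_fiberMax_nonneg (hmax n)])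
  obtain ⟨σ, t₁, w₁, hσ, ht₁, htlim, hwlim⟩ := exists_subseq_tendsto_weaklyTendsto
    (fun n => (hmax n).1) (fun n => (hC n).1) (fun n => (hC n).2)
  have hyσ := hynlim.comp hσ.tendsto_atTop
  have hsσ := hs0.comp hσ.tendsto_atTop
  have hval : ∀ n, energy A I z - ε * (s n * ‖h₁‖) ≤
      energy A I (tn n • Tp (yn n) + Tm (wn n)) := by
    intro n
    have := hslope (yn n) (tn n) (wn n) (hyn0 n) (hmax n)
    rwa [show yn n - y = s n • h₁ by simp [hyn], norm_smul, Real.norm_of_nonneg (hspos n).le]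
      at this
  have hllim : Tendsto (fun n => energy A I z - ε * ((s ∘ σ) n * ‖h₁‖)) atTop
      (𝓝 (energy A I z)) := by
    simpa using ((hsσ.mul_const ‖h₁‖).const_mul ε).const_sub (energy A I z)
  -- The maximizers over the perturbed vectors converge weakly to some maximizer over `y`, possibly
  -- different from `(t, w)`.
  have hge := S.le_energy_of_weaklyTendsto hyσ htlim hwlim hllim (fun n => hval (σ n))
  have hmax₁ : IsFiberMax Tp Tm A I y t₁ w₁ :=
    ⟨ht₁, fun s' hs' v' => (h.2 s' hs' v').trans hge⟩
  obtain ⟨ht, -, -⟩ := S.nehari_of_fiberMax h hpos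
  obtain ⟨hz₁, hI₁⟩ := S.fiberMax_unique h hmax₁ hpos
  set z₁ := t₁ • Tp y + Tm w₁ with hz₁def
  have hz₁lim : WeaklyTendsto
      (fun n => (tn ∘ σ) n • Tp ((yn ∘ σ) n) + Tm ((wn ∘ σ) n)) z₁ :=
    (((WeaklyTendsto.of_tendsto hyσ).map Tp).smul htlim).add (hwlim.map Tm)
  have hz₂lim : WeaklyTendsto (fun n => (tn ∘ σ) n • Tp y + Tm ((wn ∘ σ) n)) z₁ :=
    (WeaklyTendsto.smul (fun l => tendsto_const_nhds) htlim).add (hwlim.map Tm)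
  -- The same pair `(tn n, wn n)` is used over `yn n` and over `y`. Over `y` its energy is at most
  -- that of `z`, convexity linearizes `I` at that point, and `s n` is divided out. The last term is
  -- subtracted because `A` is evaluated at the perturbed point.
  have hineq : ∀ n, -(ε * ‖h₁‖) ≤ tn n * (A (tn n • Tp (yn n) + Tm (wn n)) (Tp h₁)
      - I' (tn n • Tp y + Tm (wn n)) (Tp h₁)) - 1 / 2 * (s n * tn n ^ 2 * A (Tp h₁) (Tp h₁)) := by
    intro n
    have e1 : tn n • Tp (yn n) + Tm (wn n)
        = (tn n • Tp y + Tm (wn n)) + (s n * tn n) • Tp h₁ := by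
      simp only [hyn, map_add, map_smul, smul_add, smul_smul]
      rw [mul_comm (tn n) (s n)]
      abel
    have h1 := hval n
    have h2 := h.2 (tn n) (hmax n).1 (wn n)
    have h3 := S.convex_ineq (tn n • Tp y + Tm (wn n)) ((s n * tn n) • Tp h₁)
    rw [e1] at h1 ⊢
    rw [← hz] at h2
    have hsn := hspos n
    clear_value z
    generalize tn n • Tp y + Tm (wn n) = ζ at h1 h2 h3 ⊢
    unfold energy at h1 h2
    rw [S.quad_add ζ] at h1
    simp only [map_add, map_smul, smul_apply, add_apply, smul_eq_mul] at h1 h3 ⊢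
    refine le_of_mul_le_mul_left ?_ hsn
    linarith
  have hlim : Tendsto (fun n => (tn ∘ σ) n * (A ((tn ∘ σ) n • Tp ((yn ∘ σ) n) + Tm ((wn ∘ σ) n))
      (Tp h₁) - I' ((tn ∘ σ) n • Tp y + Tm ((wn ∘ σ) n)) (Tp h₁))
      - 1 / 2 * ((s ∘ σ) n * (tn ∘ σ) n ^ 2 * A (Tp h₁) (Tp h₁))) atTop
      (𝓝 (t₁ * (A z₁ (Tp h₁) - I' z₁ (Tp h₁)) - 1 / 2 * (0 * t₁ ^ 2 * A (Tp h₁) (Tp h₁)))) := by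
    have l1 := hz₁lim (A.flip (Tp h₁))
    simp only [ContinuousLinearMap.flip_apply] at l1
    exact (htlim.mul (l1.sub (S.weak _ _ hz₂lim (Tp h₁)))).sub
      (((hsσ.mul (htlim.pow 2)).mul_const _).const_mul _)
  have hfin := ge_of_tendsto' hlim (fun n => hineq (σ n))
  -- The level `α` keeps `t₁` away from `0`, so the factor `t₁ ^ 2` in the limit inequality can be
  -- removed.
  have hαt : α ≤ 1 / 2 * (K * t₁ ^ 2) := by
    have h1 := hquad t₁ y w₁
    have h2 := S.nonneg z₁
    have h3 : 0 ≤ c / 2 * ‖w₁‖ ^ 2 := mul_nonneg (half_pos S.c_pos).le (sq_nonneg _)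
    have h4 := hαle.trans hge
    rw [hy, mul_one] at h1
    unfold energy at h4
    linarith
  -- By proportionality the derivative at the limit `z₁` is `t₁ / t` times the derivative at `z`, so
  -- the bound moves from `z₁` back to the given maximizer.
  rw [hz₁, ← hz₁, hI₁, hz₁] at hfin
  simp only [map_smul, smul_apply, smul_eq_mul, zero_mul, mul_zero,
    sub_zero] at hfin
  set p := (A z - I' z) (Tp h₁) with hp
  have hp' : A z (Tp h₁) - I' z (Tp h₁) = p := rfl
  have hfin' : -(ε * ‖h₁‖) * t ≤ t₁ ^ 2 * p := by
    have : t₁ * (t₁ / t * (A z) (Tp h₁) - t₁ / t * (I' z) (Tp h₁)) = t₁ ^ 2 * p / t := by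
      rw [← hp']; field_simp
    rw [this, le_div_iff₀ ht] at hfin
    exact hfin
  rcases le_or_gt 0 p with hp0 | hp0
  · refine le_trans ?_ hp0
    have : 0 ≤ ε * t * K / (2 * α) * ‖h₁‖ := by positivity
    linarith
  · have h1 : t₁ ^ 2 * p ≤ 2 * α / K * p := by
      refine mul_le_mul_of_nonpos_right ?_ hp0.le
      rw [div_le_iff₀ hK]
      linarith
    have h2 := hfin'.trans h1
    have h3 : -(ε * t * K / (2 * α)) * ‖h₁‖ = -(ε * ‖h₁‖) * t * (K / (2 * α)) := by
      field_simp
    rw [h3]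
    have h4 := mul_le_mul_of_nonneg_right h2 (show 0 ≤ K / (2 * α) by positivity)
    have h5 : 2 * α / K * p * (K / (2 * α)) = p := by field_simp
    linarith

end IndefiniteFunctional

end Abstract

end HamSys
end

noncomputable section

namespace HamSys

/-! ### Existence of a ground state for the abstract functional. -/

section Abstract

variable {H : Type*} [NormedAddCommGroup H] [InnerProductSpace ℝ H]
variable {X : Type*} [NormedAddCommGroup X] [NormedSpace ℝ X]
variable {Tp Tm : H →L[ℝ] X} {A : X →L[ℝ] X →L[ℝ] ℝ} {I : X → ℝ} {I' : X → X →L[ℝ] ℝ} {c : ℝ}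

lemma IsFiberMax.energy_eq {y : H} {t t' : ℝ} {w w' : H} (h : IsFiberMax Tp Tm A I y t w)
    (h' : IsFiberMax Tp Tm A I y t' w') :
    energy A I (t • Tp y + Tm w) = energy A I (t' • Tp y + Tm w') :=
  le_antisymm (h'.2 t h.1 w) (h.2 t' h'.1 w')

lemma IsFiberMax.map {y : H} {t : ℝ} {w : H} (h : IsFiberMax Tp Tm A I y t w) (τ : H ≃ₗᵢ[ℝ] H)
    (hτ : ∀ y w, energy A I (Tp (τ y) + Tm (τ w)) = energy A I (Tp y + Tm w)) :
    IsFiberMax Tp Tm A I (τ y) t (τ w) ∧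
      energy A I (t • Tp (τ y) + Tm (τ w)) = energy A I (t • Tp y + Tm w) := by
  have key : ∀ (s : ℝ) (v : H),
      energy A I (s • Tp (τ y) + Tm (τ v)) = energy A I (s • Tp y + Tm v) := by
    intro s v
    have := hτ (s • y) v
    simpa only [map_smul] using this
  refine ⟨⟨h.1, fun s hs v => ?_⟩, key t w⟩
  have h1 := h.2 s hs (τ.symm v)
  rw [← key, ← key, LinearIsometryEquiv.apply_symm_apply] at h1
  exact h1

/-- Maximal energies depend only on the ray through `y'`. With this bound Ekeland's inequality on
the sphere extends to all nonzero vectors, at the cost of a factor `2`. -/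
lemma norm_normalize_sub_le {y y' : H} (hy : ‖y‖ = 1) (hy' : y' ≠ 0) :
    ‖‖y'‖⁻¹ • y' - y‖ ≤ 2 * ‖y' - y‖ := by
  have hn : ‖y'‖ ≠ 0 := norm_ne_zero_iff.2 hy'
  have h1 : ‖‖y'‖⁻¹ • y' - y'‖ ≤ ‖y' - y‖ := by
    have e : ‖y'‖⁻¹ • y' - y' = (‖y'‖⁻¹ - 1) • y' := by rw [sub_smul, one_smul]
    rw [e, norm_smul, Real.norm_eq_abs, ← abs_norm y', ← abs_mul, abs_norm, sub_mul,
      inv_mul_cancel₀ hn, one_mul, ← hy, norm_sub_rev]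
    exact abs_norm_sub_norm_le y y'
  calc ‖‖y'‖⁻¹ • y' - y‖ = ‖(‖y'‖⁻¹ • y' - y') + (y' - y)‖ := by congr 1; abel
    _ ≤ _ := norm_add_le _ _
    _ ≤ _ := by linarith

/-- A strongly indefinite functional as above has a critical point which minimizes it over the
Nehari–Pankov set, at a positive level. -/
theorem IndefiniteFunctional.exists_ground_state [CompleteSpace H]
    [TopologicalSpace.SeparableSpace H] [Nontrivial H]
    (S : IndefiniteFunctional Tp Tm A I I' c) :
    ∃ z, A z = I' z ∧ z ∉ Set.range Tm ∧ 0 < energy A I z ∧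
      ∀ ζ, ζ ∉ Set.range Tm → A ζ ζ = I' ζ ζ → (∀ w, A ζ (Tm w) = I' ζ (Tm w)) →
        energy A I z ≤ energy A I ζ := by
  obtain ⟨K, hK, hquad⟩ := S.exists_quad_le
  obtain ⟨ρ, hρ, hsmall⟩ := S.small
  have hc := S.c_pos
  set α := c / 4 * ρ ^ 2 with hα
  have hαpos : 0 < α := by positivity
  have hne : ∀ y : Metric.sphere (0 : H) 1, (y : H) ≠ 0 := fun y h0 => by
    have := y.2
    rw [mem_sphere_zero_iff_norm, h0, norm_zero] at this
    exact zero_ne_one this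
  have hn1 : ∀ y : Metric.sphere (0 : H) 1, ‖(y : H)‖ = 1 := fun y =>
    mem_sphere_zero_iff_norm.1 y.2
  choose T Wm hTW using fun y : Metric.sphere (0 : H) 1 => S.exists_isFiberMax (hne y)
  set Ψ : Metric.sphere (0 : H) 1 → ℝ := fun y => energy A I (T y • Tp y + Tm (Wm y)) with hΨ
  -- Test the fibre at `ρ Tp y`: the quadratic part is at least `c / 2 * ρ ^ 2`, and `I` takes away
  -- at most half of it.
  have hΨα : ∀ y, α ≤ Ψ y := by
    intro y
    have h1 := (hTW y).2 ρ hρ.le 0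
    refine le_trans ?_ h1
    have h2 := hsmall (ρ • (y : H)) (by rw [norm_smul, hn1, mul_one, Real.norm_of_nonneg hρ.le])
    have h3 := S.pos (ρ • (y : H))
    rw [norm_smul, hn1, mul_one, Real.norm_of_nonneg hρ.le, map_smul] at h2 h3
    rw [map_zero, add_zero]
    unfold energy
    linarith
  -- `Ψ` is a supremum of continuous functions of `y`; only the one attaining it at `y` is needed.
  have hlsc : LowerSemicontinuous Ψ := by
    intro y r hr
    have hcont : Continuous (fun y' : Metric.sphere (0 : H) 1 =>
        energy A I (T y • Tp (y' : H) + Tm (Wm y))) :=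
      S.continuous_energy.comp (((Tp.continuous.comp continuous_subtype_val).const_smul
        (T y)).add continuous_const)
    filter_upwards [(hcont.tendsto y).eventually (lt_mem_nhds hr)] with y' hy'
    exact hy'.trans_le ((hTW y').2 _ (hTW y).1 _)
  have : Nonempty (Metric.sphere (0 : H) 1) :=
    (NormedSpace.sphere_nonempty.2 zero_le_one).to_subtype
  have hbdd : BddBelow (Set.range Ψ) := ⟨α, by rintro _ ⟨y, rfl⟩; exact hΨα y⟩
  set m := ⨅ y, Ψ y with hm
  have hmle : ∀ y, m ≤ Ψ y := fun y => ciInf_le hbdd y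
  have hαm : α ≤ m := le_ciInf hΨα
  have : CompleteSpace (Metric.sphere (0 : H) 1) := Metric.isClosed_sphere.completeSpace_coe
  set ε : ℕ → ℝ := fun n => 1 / ((n : ℝ) + 1) with hεdef
  have hε : ∀ n, 0 < ε n := fun n => by positivity
  have hε0 : Tendsto ε atTop (𝓝 0) := tendsto_one_div_add_atTop_nhds_zero_nat
  have hek : ∀ n : ℕ, ∃ y : Metric.sphere (0 : H) 1, Ψ y ≤ m + ε n ∧
      ∀ y', Ψ y - ε n * dist y y' ≤ Ψ y' := by
    intro n
    obtain ⟨x₀, hx₀⟩ := exists_lt_of_ciInf_lt (lt_add_of_pos_right m (hε n))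
    obtain ⟨y, hy, hy'⟩ := ekeland hlsc hmle (hε n) x₀
    exact ⟨y, hy.trans hx₀.le, hy'⟩
  choose y hyle hyek using hek
  -- values of `Ψ` at arbitrary nonzero vectors
  have hslope : ∀ n (y' : H) (t' : ℝ) (w' : H), y' ≠ 0 → IsFiberMax Tp Tm A I y' t' w' →
      Ψ (y n) - 2 * ε n * ‖y' - y n‖ ≤ energy A I (t' • Tp y' + Tm w') := by
    intro n y' t' w' hy' hmax
    obtain ⟨h1, h2⟩ := fiberMax_normalize hy' hmax
    have hmem : ‖y'‖⁻¹ • y' ∈ Metric.sphere (0 : H) 1 := by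
      rw [mem_sphere_zero_iff_norm, norm_smul, norm_inv, norm_norm,
        inv_mul_cancel₀ (norm_ne_zero_iff.2 hy')]
    have h3 := hyek n ⟨_, hmem⟩
    have h4 : Ψ ⟨_, hmem⟩ = energy A I (t' • Tp y' + Tm w') := by
      rw [← h2]; exact (hTW ⟨_, hmem⟩).energy_eq h1
    rw [h4] at h3
    refine le_trans ?_ h3
    have h5 : dist (y n) ⟨_, hmem⟩ ≤ 2 * ‖y' - y n‖ := by
      rw [dist_comm, Subtype.dist_eq, dist_eq_norm]
      exact norm_normalize_sub_le (hn1 _) hy'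
    have := mul_le_mul_of_nonneg_left h5 (hε n).le
    linarith
  have hε1 : ∀ n, ε n ≤ 1 := fun n => by
    simp only [hεdef]
    rw [div_le_one (by positivity)]
    have : (0 : ℝ) ≤ n := n.cast_nonneg
    linarith
  -- nonvanishing
  obtain ⟨R, hR0, hR⟩ : ∃ R : ℝ, 0 ≤ R ∧ m + 2 ≤ c / 2 * R ^ 2 := by
    refine ⟨Real.sqrt ((m + 2) * 2 / c), Real.sqrt_nonneg _, ?_⟩
    have : 0 ≤ (m + 2) * 2 / c := by
      have : 0 ≤ m := hαpos.le.trans hαm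
      positivity
    rw [Real.sq_sqrt this]
    exact le_of_eq (by field_simp)
  -- The energy at `R Tp (y n)` is at most `Ψ (y n) ≤ m + 1`, while its quadratic part is at least
  -- `m + 2` by the choice of `R`; hence `I (R Tp (y n)) ≥ 1`.
  obtain ⟨τ, σ, y₀, hτ, hσ, hy₀, hweak⟩ := S.nonvanishing (fun n => (y n : H))
    (fun n => (hn1 _).le) R 1 one_pos (fun n => by
      have h1 := (hTW (y n)).2 R hR0 0
      have h2 := S.pos (R • (y n : H))
      rw [norm_smul, hn1, mul_one, Real.norm_of_nonneg hR0, map_smul] at h2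
      rw [map_zero, add_zero] at h1
      have h3 := h1.trans (hyle n)
      have h4 := hε1 n
      unfold energy at h3
      linarith)
  set u : ℕ → H := fun n => τ n (y (σ n)) with hu
  have hun : ∀ n, ‖u n‖ = 1 := fun n => by rw [hu]; simp only [LinearIsometryEquiv.norm_map, hn1]
  set t : ℕ → ℝ := fun n => T (y (σ n)) with ht
  set w : ℕ → H := fun n => τ n (Wm (y (σ n))) with hw
  have hmax : ∀ n, IsFiberMax Tp Tm A I (u n) (t n) (w n) := fun n =>
    ((hTW (y (σ n))).map (τ n) (hτ n)).1
  have hval : ∀ n, energy A I (t n • Tp (u n) + Tm (w n)) = Ψ (y (σ n)) := fun n =>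
    ((hTW (y (σ n))).map (τ n) (hτ n)).2
  set z : ℕ → X := fun n => t n • Tp (u n) + Tm (w n) with hz
  have hpos : ∀ n, 0 < energy A I (z n) := fun n => by
    rw [hval]; exact hαpos.trans_le (hΨα _)
  -- `energy_deriv_ge` is applied after translation; the slope inequality survives because `τ n` is
  -- an isometry that preserves energies of fibre maxima.
  have hgrad : ∀ n h, -(2 * ε (σ n) * t n * K / (2 * α)) * ‖h‖ ≤ (A (z n) - I' (z n)) (Tp h) := by
    intro n h
    refine S.energy_deriv_ge (hun n) (hmax n) hαpos ((hval n).symm ▸ hΨα _) hK hquad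
      (by have := hε (σ n); positivity) ?_ h
    intro y' t' w' hy' hmax'
    have hτinv : ∀ y w, energy A I (Tp ((τ n).symm y) + Tm ((τ n).symm w))
        = energy A I (Tp y + Tm w) := by
      intro y w
      have := hτ n ((τ n).symm y) ((τ n).symm w)
      simpa using this.symm
    obtain ⟨h1, h2⟩ := hmax'.map (τ n).symm hτinv
    have h3 := hslope (σ n) _ _ _ (by simpa using hy') h1
    rw [h2] at h3
    rw [hval]
    have h4 : ‖(τ n).symm y' - (y (σ n) : H)‖ = ‖y' - u n‖ := by
      rw [← (τ n).norm_map, map_sub, LinearIsometryEquiv.apply_symm_apply]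
    rwa [h4] at h3
  obtain ⟨C, hC⟩ := S.exists_bound hweak hy₀ (fun n => (hmax n).1) (w := w)
    (fun n => by have := hpos n; simp only [hz] at this; linarith)
  obtain ⟨κ, t₀, w₀, hκ, ht₀, htlim, hwlim⟩ := exists_subseq_tendsto_weaklyTendsto
    (fun n => (hmax n).1) (fun n => (hC n).1) (fun n => (hC n).2)
  set z₀ := t₀ • Tp y₀ + Tm w₀ with hz₀
  have hzlim : WeaklyTendsto (z ∘ κ) z₀ :=
    (((hweak.subseq hκ.tendsto_atTop).map Tp).smul htlim).add (hwlim.map Tm)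
  have hneh := fun n => S.nehari_of_fiberMax (hmax n) (hpos n)
  have hσκ := hσ.tendsto_atTop.comp hκ.tendsto_atTop
  have hcrit_lim : ∀ φ, Tendsto (fun n => (A (z (κ n)) - I' (z (κ n))) φ) atTop
      (𝓝 ((A z₀ - I' z₀) φ)) := by
    intro φ
    have l1 := hzlim (A.flip φ)
    simp only [ContinuousLinearMap.flip_apply] at l1
    exact l1.sub (S.weak _ _ hzlim φ)
  have hcrit : A z₀ = I' z₀ := by
    -- The bound is one-sided, but it holds for `h` and `-h`, so the derivative vanishes.
    have hp : ∀ h, 0 ≤ (A z₀ - I' z₀) (Tp h) := by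
      intro h
      have l2 : Tendsto (fun n => -(2 * ε (σ (κ n)) * t (κ n) * K / (2 * α)) * ‖h‖) atTop
          (𝓝 (-(2 * 0 * t₀ * K / (2 * α)) * ‖h‖)) :=
        ((((((hε0.comp hσκ).const_mul 2).mul htlim).mul_const K).div_const _).neg).mul_const _
      have l3 := le_of_tendsto_of_tendsto' l2 (hcrit_lim (Tp h)) (fun n => hgrad (κ n) h)
      simpa using l3
    have hp0 : ∀ h, (A z₀ - I' z₀) (Tp h) = 0 := by
      intro h
      refine le_antisymm ?_ (hp h)
      have := hp (-h)
      rw [map_neg, map_neg] at this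
      linarith
    have hm0 : ∀ v, (A z₀ - I' z₀) (Tm v) = 0 := by
      intro v
      refine tendsto_nhds_unique (hcrit_lim (Tm v)) (tendsto_const_nhds.congr fun n => ?_)
      have := (hneh (κ n)).2.2 v
      simp only [sub_apply]
      simp only [hz]
      rw [this, sub_self]
    ext φ
    obtain ⟨a, b, rfl⟩ := S.decomp φ
    have h1 := hp0 a
    have h2 := hm0 b
    simp only [sub_apply] at h1 h2
    rw [map_add (A z₀), map_add (I' z₀)]
    linarith
  -- The level `α` bounds every `t n` from below; since `y₀ ≠ 0`, the weak limit then has a nonzero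
  -- `Tp` component.
  have ht₀pos : 0 < t₀ := by
    have h1 : ∀ n, 2 * α / K ≤ t n ^ 2 := by
      intro n
      have h1 := hquad (t n) (u n) (w n)
      have h2 := S.nonneg (z n)
      have h3 : 0 ≤ c / 2 * ‖w n‖ ^ 2 := by positivity
      have h4 : α ≤ energy A I (z n) := (hval n).symm ▸ hΨα _
      rw [hun, mul_one] at h1
      unfold energy at h4
      rw [div_le_iff₀ hK]
      simp only [hz] at h2 h4
      linarith
    have h2 : 2 * α / K ≤ t₀ ^ 2 := ge_of_tendsto' (htlim.pow 2) (fun n => h1 (κ n))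
    have h3 : 0 < 2 * α / K := by positivity
    rcases ht₀.lt_or_eq with h | h
    · exact h
    · rw [← h] at h2; norm_num at h2; linarith
  have hz₀range : z₀ ∉ Set.range Tm := by
    intro hmem
    rw [hz₀, ← map_smul] at hmem
    have := S.eq_zero_of_mem_range hmem
    exact (smul_ne_zero ht₀pos.ne' hy₀) this
  -- A Nehari–Pankov point `Tp a + Tm b` maximizes the energy on the fibre of `a`, with `t = 1`;
  -- hence its level is a value of `Ψ`.
  have hmin : ∀ ζ, ζ ∉ Set.range Tm → A ζ ζ = I' ζ ζ → (∀ w, A ζ (Tm w) = I' ζ (Tm w)) →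
      m ≤ energy A I ζ := by
    intro ζ hζ h1 h2
    obtain ⟨a, b, rfl⟩ := S.decomp ζ
    have ha : a ≠ 0 := by
      rintro rfl
      exact hζ ⟨b, by simp⟩
    have hmaxa : IsFiberMax Tp Tm A I a 1 b := by
      refine ⟨zero_le_one, fun s hs v => ?_⟩
      have h3 := S.energy_le_of_nehari h1 (h2 (v - s • b)) hs
      rw [one_smul]
      convert h3 using 2
      rw [map_sub, map_smul, smul_add]
      abel
    obtain ⟨h3, h4⟩ := fiberMax_normalize ha hmaxa
    have hmem : ‖a‖⁻¹ • a ∈ Metric.sphere (0 : H) 1 := by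
      rw [mem_sphere_zero_iff_norm, norm_smul, norm_inv, norm_norm,
        inv_mul_cancel₀ (norm_ne_zero_iff.2 ha)]
    have h5 : Ψ ⟨_, hmem⟩ = energy A I (Tp a + Tm b) := by
      rw [one_smul] at h4
      rw [← h4]; exact (hTW ⟨_, hmem⟩).energy_eq h3
    rw [← h5]
    exact hmle _
  -- On the Nehari–Pankov set `A(z, z) = I'(z) z`, so the energy takes the form to which Fatou's
  -- lemma applies.
  have hlim : Tendsto (fun n => 1 / 2 * I' ((z ∘ κ) n) ((z ∘ κ) n) - I ((z ∘ κ) n)) atTop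
      (𝓝 m) := by
    have e : ∀ n, 1 / 2 * I' ((z ∘ κ) n) ((z ∘ κ) n) - I ((z ∘ κ) n) = Ψ (y (σ (κ n))) := by
      intro n
      rw [← hval, energy, (hneh (κ n)).2.1]
      rfl
    simp_rw [e]
    have l : Tendsto (fun n => m + ε (σ (κ n))) atTop (𝓝 (m + 0)) :=
      tendsto_const_nhds.add (hε0.comp hσκ)
    rw [add_zero] at l
    exact tendsto_of_tendsto_of_tendsto_of_le_of_le tendsto_const_nhds l
      (fun n => hmle _) (fun n => hyle _)
  have hle : energy A I z₀ ≤ m := by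
    have := S.fatou _ _ hzlim m hlim
    rw [energy, hcrit]
    exact this
  refine ⟨z₀, hcrit, hz₀range, ?_, fun ζ h1 h2 h3 => hle.trans (hmin ζ h1 h2 h3)⟩
  exact hαpos.trans_le (hαm.trans (hmin z₀ hz₀range (by rw [hcrit]) (fun w => by rw [hcrit])))

end Abstract

end HamSys
end

noncomputable section

namespace HamSys

/-! ### Mollification of functions with a weak gradient -/

/-- Cauchy–Schwarz with `f` split as `√f * √f`, that is, in `L²` of the measure with density `f`. -/
lemma lintegral_mul_sq_le {α : Type*} [MeasurableSpace α] {μ : Measure α} {f g : α → ℝ≥0∞}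
    (hf : AEMeasurable f μ) (hg : AEMeasurable g μ) :
    (∫⁻ x, f x * g x ∂μ) ^ 2 ≤ (∫⁻ x, f x ∂μ) * ∫⁻ x, f x * g x ^ 2 ∂μ := by
  have h := ENNReal.lintegral_mul_le_Lp_mul_Lq μ Real.HolderConjugate.two_two
    (hf.pow_const (1 / 2 : ℝ)) ((hf.pow_const (1 / 2 : ℝ)).mul hg)
  have e1 : ∀ x, f x ^ (1 / 2 : ℝ) * f x ^ (1 / 2 : ℝ) = f x := fun x => by
    rw [← ENNReal.rpow_add_of_nonneg _ _ (by norm_num) (by norm_num)]; norm_num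
  have e2 : ∀ x, (f x ^ (1 / 2 : ℝ)) ^ (2 : ℝ) = f x := fun x => by
    rw [← ENNReal.rpow_mul]; norm_num
  have e3 : ∀ x, (f x ^ (1 / 2 : ℝ) * g x) ^ (2 : ℝ) = f x * g x ^ 2 := fun x => by
    rw [ENNReal.mul_rpow_of_nonneg _ _ (by norm_num), e2, ENNReal.rpow_two]
  simp only [Pi.mul_apply, ← mul_assoc, e1, e2, e3] at h
  calc (∫⁻ x, f x * g x ∂μ) ^ 2
      ≤ ((∫⁻ x, f x ∂μ) ^ (1 / 2 : ℝ) * (∫⁻ x, f x * g x ^ 2 ∂μ) ^ (1 / 2 : ℝ)) ^ 2 := by gcongr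
    _ = _ := by
      rw [mul_pow, ← ENNReal.rpow_two, ← ENNReal.rpow_two, ← ENNReal.rpow_mul, ← ENNReal.rpow_mul]
      norm_num

variable {N : ℕ}

/-- The convolution of `w` with a normalized bump function. -/
def mollify {F : Type*} [NormedAddCommGroup F] [NormedSpace ℝ F] (φ : ContDiffBump (0 : Sp N))
    (w : Sp N → F) : Sp N → F :=
  (φ.normed volume) ⋆[ContinuousLinearMap.lsmul ℝ ℝ, volume] w

lemma lintegral_enorm_normed (φ : ContDiffBump (0 : Sp N)) :
    ∫⁻ t, ‖φ.normed (volume : Measure (Sp N)) t‖ₑ = 1 := by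
  have h1 := ofReal_integral_eq_lintegral_ofReal (φ.integrable_normed (μ := volume))
    (Eventually.of_forall fun x => φ.nonneg_normed x)
  rw [φ.integral_normed, ENNReal.ofReal_one] at h1
  rw [h1]
  exact lintegral_congr fun t => Real.enorm_of_nonneg (φ.nonneg_normed t)

lemma enorm_mollify_sq_le {F : Type*} [NormedAddCommGroup F] [NormedSpace ℝ F]
    (φ : ContDiffBump (0 : Sp N)) {w : Sp N → F} (hw : AEStronglyMeasurable w volume) (x : Sp N) :
    ‖mollify φ w x‖ₑ ^ 2 ≤ ∫⁻ t, ‖φ.normed volume t‖ₑ * ‖w (x - t)‖ₑ ^ 2 := by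
  have hwx : AEMeasurable (fun t => ‖w (x - t)‖ₑ) volume :=
    (hw.comp_quasiMeasurePreserving
      (Measure.measurePreserving_sub_left volume x).quasiMeasurePreserving).enorm
  have h2 : ‖mollify φ w x‖ₑ ≤ ∫⁻ t, ‖φ.normed volume t‖ₑ * ‖w (x - t)‖ₑ := by
    refine (enorm_integral_le_lintegral_enorm _).trans (le_of_eq (lintegral_congr fun t => ?_))
    simp [enorm_smul]
  calc ‖mollify φ w x‖ₑ ^ 2 ≤ (∫⁻ t, ‖φ.normed volume t‖ₑ * ‖w (x - t)‖ₑ) ^ 2 := by gcongr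
    _ ≤ _ := lintegral_mul_sq_le (φ.continuous_normed.aestronglyMeasurable.enorm) hwx
    _ = _ := by rw [lintegral_enorm_normed, one_mul]

lemma lintegral_enorm_mollify_sq_le {F : Type*} [NormedAddCommGroup F] [NormedSpace ℝ F]
    (φ : ContDiffBump (0 : Sp N)) {w : Sp N → F} (hw : AEStronglyMeasurable w volume) :
    ∫⁻ x, ‖mollify φ w x‖ₑ ^ 2 ≤ ∫⁻ x, ‖w x‖ₑ ^ 2 := by
  calc ∫⁻ x, ‖mollify φ w x‖ₑ ^ 2
      ≤ ∫⁻ x, ∫⁻ t, ‖φ.normed volume t‖ₑ * ‖w (x - t)‖ₑ ^ 2 :=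
        lintegral_mono fun x => enorm_mollify_sq_le φ hw x
    _ = ∫⁻ t, ∫⁻ x, ‖φ.normed volume t‖ₑ * ‖w (x - t)‖ₑ ^ 2 := by
        refine lintegral_lintegral_swap ?_
        have h1 : AEStronglyMeasurable (fun p : Sp N × Sp N => w (p.1 - p.2))
            (volume.prod volume) :=
          hw.comp_quasiMeasurePreserving (quasiMeasurePreserving_sub _ _)
        refine AEMeasurable.mul ?_ (h1.enorm.pow_const 2)
        exact (φ.continuous_normed.comp continuous_snd).aestronglyMeasurable.enorm
    _ = ∫⁻ t, ‖φ.normed volume t‖ₑ * ∫⁻ x, ‖w x‖ₑ ^ 2 := by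
        refine lintegral_congr fun t => ?_
        rw [lintegral_const_mul' _ _ (by simp)]
        congr 1
        exact lintegral_sub_right_eq_self (fun x => ‖w x‖ₑ ^ 2) t
    _ = _ := by
        rw [lintegral_mul_const'' _ φ.continuous_normed.aestronglyMeasurable.enorm,
          lintegral_enorm_normed, one_mul]

lemma contDiff_mollify (φ : ContDiffBump (0 : Sp N)) {w : Sp N → ℝ}
    (hw : LocallyIntegrable w volume) : ContDiff ℝ 1 (mollify φ w) :=
  φ.hasCompactSupport_normed.contDiff_convolution_left (n := 1) _ φ.contDiff_normed hw

/-- The derivative falls on the kernel; testing the weak gradient against `t ↦ ρ (x - t)` moves it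
to `w`, the reflection and the integration by parts each giving a minus sign. -/
lemma hasFDerivAt_mollify (φ : ContDiffBump (0 : Sp N)) {w : Sp N → ℝ} {G : Sp N → Sp N}
    (hw : LocallyIntegrable w volume) (hG : LocallyIntegrable G volume)
    (hwG : IsWeakGradient w G) (x : Sp N) :
    HasFDerivAt (mollify φ w) (innerSL ℝ (mollify φ G x)) x := by
  set ρ := φ.normed (volume : Measure (Sp N)) with hρ
  have hρc : HasCompactSupport ρ := φ.hasCompactSupport_normed
  have hρs : ContDiff ℝ ∞ ρ := φ.contDiff_normed
  have hd := hρc.hasFDerivAt_convolution_left (ContinuousLinearMap.lsmul ℝ ℝ) (μ := volume)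
    (hρs.of_le (by simp)) hw x
  refine hd.congr_fderiv ?_
  have hex : ConvolutionExistsAt (fderiv ℝ ρ) w x
      (ContinuousLinearMap.precompL (Sp N) (ContinuousLinearMap.lsmul ℝ ℝ)) volume :=
    (hρc.fderiv ℝ).convolutionExists_left _ (hρs.continuous_fderiv (by simp)) hw x
  have hexG : ConvolutionExistsAt ρ G x (ContinuousLinearMap.lsmul ℝ ℝ) volume :=
    hρc.convolutionExists_left _ hρs.continuous hG x
  apply ContinuousLinearMap.coe_injective
  refine (EuclideanSpace.basisFun (Fin N) ℝ).toBasis.ext fun i => ?_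
  simp only [OrthonormalBasis.coe_toBasis, EuclideanSpace.basisFun_apply,
    ContinuousLinearMap.coe_coe, innerSL_apply_apply, EuclideanSpace.inner_single_right]
  have e1 : (fderiv ℝ ρ ⋆[(ContinuousLinearMap.lsmul ℝ ℝ).precompL (Sp N), volume] w) x
      (EuclideanSpace.single i 1)
      = ∫ t, fderiv ℝ ρ t (EuclideanSpace.single i 1) * w (x - t) := by
    rw [convolution_def, ContinuousLinearMap.integral_apply hex]
    rfl
  have e2 : mollify φ G x i = ∫ t, ρ t * G (x - t) i := by
    have := (EuclideanSpace.proj (𝕜 := ℝ) i).integral_comp_comm hexG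
    exact this.symm
  have hφs : ContDiff ℝ ∞ (fun t => ρ (x - t)) := hρs.comp (contDiff_const.sub contDiff_id)
  have hφc : HasCompactSupport (fun t => ρ (x - t)) :=
    hρc.comp_homeomorph (Homeomorph.subLeft x)
  have h := hwG _ hφs hφc i
  have e3 : ∀ t, fderiv ℝ (fun t => ρ (x - t)) t (EuclideanSpace.single i 1)
      = - fderiv ℝ ρ (x - t) (EuclideanSpace.single i 1) := by
    intro t
    have h1 : HasFDerivAt ρ (fderiv ℝ ρ (x - t)) (x - t) :=
      (hρs.differentiable (by simp) _).hasFDerivAt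
    have h2 := h1.comp t ((hasFDerivAt_id t).const_sub x)
    have h3 : HasFDerivAt (fun t => ρ (x - t)) _ t := h2
    rw [h3.fderiv]
    simp
  simp only [e3, mul_neg, integral_neg, neg_inj] at h
  rw [e1, e2, ← integral_sub_left_eq_self _ volume x]
  simp only [sub_sub_cancel]
  rw [← integral_sub_left_eq_self (fun t => ρ t * G (x - t) i) volume x]
  simp only [sub_sub_cancel]
  simp only [mul_comm (fderiv ℝ ρ _ _), mul_comm (ρ _)]
  simpa using h

/-- The outer radius is kept at twice the inner one, as Lebesgue differentiation requires. The same
sequence must serve both a function and its gradient. -/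
lemma exists_mollifiers : ∃ φ : ℕ → ContDiffBump (0 : Sp N), ∀ {F : Type} [NormedAddCommGroup F]
    [NormedSpace ℝ F] [CompleteSpace F] (w : Sp N → F), LocallyIntegrable w volume →
    ∀ᵐ x, Tendsto (fun n => mollify (φ n) w x) atTop (𝓝 (w x)) := by
  refine ⟨fun n => ⟨1 / ((n : ℝ) + 1), 2 / ((n : ℝ) + 1), by positivity, by gcongr; norm_num⟩, ?_⟩
  intro F _ _ _ w hw
  refine ContDiffBump.ae_convolution_tendsto_right_of_locallyIntegrable (K := 2) ?_ ?_ hw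
  · have := (tendsto_one_div_add_atTop_nhds_zero_nat (𝕜 := ℝ)).const_mul 2
    simpa [div_eq_mul_inv] using this
  · exact Eventually.of_forall fun n => by simp [← div_eq_mul_inv]

lemma eLpNorm_two_le_iff {α F F' : Type*} [MeasurableSpace α] [NormedAddCommGroup F]
    [NormedAddCommGroup F'] {μ : Measure α} {f : α → F} {g : α → F'} :
    eLpNorm f 2 μ ≤ eLpNorm g 2 μ ↔ ∫⁻ x, ‖f x‖ₑ ^ 2 ∂μ ≤ ∫⁻ x, ‖g x‖ₑ ^ 2 ∂μ := by
  rw [eLpNorm_eq_lintegral_rpow_enorm_toReal (by norm_num) (by norm_num),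
    eLpNorm_eq_lintegral_rpow_enorm_toReal (by norm_num) (by norm_num)]
  simp only [ENNReal.toReal_ofNat, ENNReal.rpow_two]
  exact ENNReal.rpow_le_rpow_iff (by norm_num)

/-- The critical Sobolev exponent `2 N / (N - 2)`. -/
def critExp (N : ℕ) : ℝ := 2 * (N : ℝ) / ((N : ℝ) - 2)

/-- Sobolev's inequality for compactly supported functions with weak gradient in `L²`. -/
lemma exists_sobolev_const (hN : 3 ≤ N) : ∃ C : NNReal, ∀ (w : Sp N → ℝ) (G : Sp N → Sp N),
    MemLp w 2 volume → MemLp G 2 volume → IsWeakGradient w G → HasCompactSupport w →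
    eLpNorm w (ENNReal.ofReal (critExp N)) volume ≤ C * eLpNorm G 2 volume := by
  refine ⟨SNormLESNormFDerivOfEqConst ℝ (volume : Measure (Sp N)) (2 : NNReal), ?_⟩
  intro w G hw hG hwG hc
  obtain ⟨φ, hφ⟩ := exists_mollifiers (N := N)
  have hwl := hw.locallyIntegrable (by norm_num)
  have hGl := hG.locallyIntegrable (by norm_num)
  -- Mollification keeps compact support and does not increase the `L²` norm of the gradient, so the
  -- inequality for `C¹` functions has a constant independent of `n`; Fatou's lemma then removes the
  -- mollifier.
  have hbound : ∀ n, eLpNorm (mollify (φ n) w) (ENNReal.ofReal (critExp N)) volume ≤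
      SNormLESNormFDerivOfEqConst ℝ (volume : Measure (Sp N)) (2 : NNReal)
        * eLpNorm G 2 volume := by
    intro n
    have hN' : (3 : ℝ) ≤ N := by exact_mod_cast hN
    have h1 := eLpNorm_le_eLpNorm_fderiv_of_eq (volume : Measure (Sp N)) (p := 2)
      (p' := (critExp N).toNNReal) (contDiff_mollify (φ n) hwl)
      (HasCompactSupport.convolution _ (φ n).hasCompactSupport_normed hc) (by norm_num)
      (by rw [finrank_euclideanSpace_fin]; omega)
      (by
        have h2 : 0 < (N : ℝ) - 2 := by linarith
        rw [finrank_euclideanSpace_fin, Real.coe_toNNReal _ (by unfold critExp; positivity)]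
        unfold critExp
        push_cast
        field_simp)
    refine h1.trans ?_
    gcongr
    rw [ENNReal.coe_ofNat, eLpNorm_two_le_iff]
    refine le_trans (le_of_eq (lintegral_congr fun x => ?_))
      (lintegral_enorm_mollify_sq_le (φ n) hG.1)
    rw [(hasFDerivAt_mollify (φ n) hwl hGl hwG x).fderiv]
    congr 1
    rw [← ofReal_norm, innerSL_apply_norm, ofReal_norm]
  refine (Lp.eLpNorm_lim_le_liminf_eLpNorm
    (fun n => (contDiff_mollify (φ n) hwl).continuous.aestronglyMeasurable) w (hφ w hwl)).trans ?_
  exact liminf_le_of_le (by isBoundedDefault)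
    (fun b hb => let ⟨n, hn⟩ := hb.exists; hn.trans (hbound n))

/-- Fundamental theorem of calculus along the segment from `x` to `x + h`, then Cauchy–Schwarz. -/
lemma enorm_sub_sq_le_of_hasFDerivAt {f : Sp N → ℝ} {g : Sp N → Sp N} (hg : Continuous g)
    (hf : ∀ x, HasFDerivAt f (innerSL ℝ (g x)) x) (x h : Sp N) :
    ‖f (x + h) - f x‖ₑ ^ 2 ≤ ‖h‖ₑ ^ 2 * ∫⁻ s in Set.Icc (0 : ℝ) 1, ‖g (x + s • h)‖ₑ ^ 2 := by
  have hd : ∀ s : ℝ, HasDerivAt (fun s : ℝ => f (x + s • h)) (⟪g (x + s • h), h⟫_ℝ) s := by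
    intro s
    have h1 : HasDerivAt (fun s : ℝ => x + s • h) h s := by
      simpa using ((hasDerivAt_id s).smul_const h).const_add x
    exact (hf (x + s • h)).comp_hasDerivAt s h1
  have hcont : Continuous (fun s : ℝ => ⟪g (x + s • h), h⟫_ℝ) := by fun_prop
  have h1 := intervalIntegral.integral_eq_sub_of_hasDerivAt (a := 0) (b := 1)
    (fun s _ => hd s) (hcont.intervalIntegrable 0 1)
  simp only [one_smul, zero_smul, add_zero] at h1
  rw [intervalIntegral.integral_of_le zero_le_one, ← integral_Icc_eq_integral_Ioc] at h1
  have hgm : AEMeasurable (fun s : ℝ => ‖g (x + s • h)‖ₑ) (volume.restrict (Set.Icc 0 1)) :=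
    (Continuous.aestronglyMeasurable (by fun_prop)).enorm
  have h2 : ‖f (x + h) - f x‖ₑ ≤ ‖h‖ₑ * ∫⁻ s in Set.Icc (0 : ℝ) 1, ‖g (x + s • h)‖ₑ := by
    rw [← h1, ← lintegral_const_mul' _ _ (by simp)]
    refine (enorm_integral_le_lintegral_enorm _).trans (lintegral_mono fun s => ?_)
    rw [mul_comm, ← ofReal_norm, ← ofReal_norm, ← ofReal_norm, ← ENNReal.ofReal_mul (norm_nonneg _)]
    exact ENNReal.ofReal_le_ofReal (norm_inner_le_norm _ _)
  have h3 : (∫⁻ s in Set.Icc (0 : ℝ) 1, ‖g (x + s • h)‖ₑ) ^ 2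
      ≤ ∫⁻ s in Set.Icc (0 : ℝ) 1, ‖g (x + s • h)‖ₑ ^ 2 := by
    have := lintegral_mul_sq_le (f := fun _ => 1) aemeasurable_const hgm
    simpa using this
  calc ‖f (x + h) - f x‖ₑ ^ 2 ≤ (‖h‖ₑ * ∫⁻ s in Set.Icc (0 : ℝ) 1, ‖g (x + s • h)‖ₑ) ^ 2 := by
        gcongr
    _ ≤ _ := by rw [mul_pow]; gcongr

/-- Difference quotients are controlled by the weak gradient. -/
lemma lintegral_enorm_translate_sub_sq_le {w : Sp N → ℝ} {G : Sp N → Sp N}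
    (hw : MemLp w 2 volume) (hG : MemLp G 2 volume) (hwG : IsWeakGradient w G) (h : Sp N) :
    ∫⁻ x, ‖w (x + h) - w x‖ₑ ^ 2 ≤ ‖h‖ₑ ^ 2 * ∫⁻ x, ‖G x‖ₑ ^ 2 := by
  obtain ⟨φ, hφ⟩ := exists_mollifiers (N := N)
  have hwl := hw.locallyIntegrable (by norm_num)
  have hGl := hG.locallyIntegrable (by norm_num)
  have hGc : ∀ n, Continuous (mollify (φ n) G) := fun n =>
    (φ n).hasCompactSupport_normed.continuous_convolution_left _ (φ n).continuous_normed hGl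
  have hwc : ∀ n, Continuous (mollify (φ n) w) := fun n =>
    (φ n).hasCompactSupport_normed.continuous_convolution_left _ (φ n).continuous_normed hwl
  have hbound : ∀ n, ∫⁻ x, ‖mollify (φ n) w (x + h) - mollify (φ n) w x‖ₑ ^ 2
      ≤ ‖h‖ₑ ^ 2 * ∫⁻ x, ‖G x‖ₑ ^ 2 := by
    intro n
    calc ∫⁻ x, ‖mollify (φ n) w (x + h) - mollify (φ n) w x‖ₑ ^ 2
        ≤ ∫⁻ x, ‖h‖ₑ ^ 2 * ∫⁻ s in Set.Icc (0 : ℝ) 1, ‖mollify (φ n) G (x + s • h)‖ₑ ^ 2 :=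
          lintegral_mono fun x => enorm_sub_sq_le_of_hasFDerivAt (hGc n)
            (hasFDerivAt_mollify (φ n) hwl hGl hwG) x h
      _ = ‖h‖ₑ ^ 2 * ∫⁻ s in Set.Icc (0 : ℝ) 1, ∫⁻ x, ‖mollify (φ n) G (x + s • h)‖ₑ ^ 2 := by
          rw [lintegral_const_mul' _ _ (by simp)]
          congr 1
          refine lintegral_lintegral_swap ?_
          have : Continuous (fun p : Sp N × ℝ => mollify (φ n) G (p.1 + p.2 • h)) :=
            (hGc n).comp (by fun_prop)
          exact this.aestronglyMeasurable.enorm.pow_const 2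
      _ = ‖h‖ₑ ^ 2 * ∫⁻ x, ‖mollify (φ n) G x‖ₑ ^ 2 := by
          congr 1
          have : ∀ s : ℝ, ∫⁻ x, ‖mollify (φ n) G (x + s • h)‖ₑ ^ 2
              = ∫⁻ x, ‖mollify (φ n) G x‖ₑ ^ 2 := fun s =>
            lintegral_add_right_eq_self (fun x => ‖mollify (φ n) G x‖ₑ ^ 2) (s • h)
          simp [this]
      _ ≤ _ := mul_le_mul' le_rfl (lintegral_enorm_mollify_sq_le (φ n) hG.1)
  have hae : ∀ᵐ x, Tendsto (fun n => ‖mollify (φ n) w (x + h) - mollify (φ n) w x‖ₑ ^ 2) atTop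
      (𝓝 (‖w (x + h) - w x‖ₑ ^ 2)) := by
    have h1 := hφ w hwl
    have h2 := (measurePreserving_add_right (volume : Measure (Sp N)) h).quasiMeasurePreserving.ae h1
    filter_upwards [h1, h2] with x hx1 hx2
    exact (ENNReal.continuous_pow 2).continuousAt.tendsto.comp
      ((continuous_enorm.tendsto _).comp (hx2.sub hx1))
  calc ∫⁻ x, ‖w (x + h) - w x‖ₑ ^ 2
      = ∫⁻ x, liminf (fun n => ‖mollify (φ n) w (x + h) - mollify (φ n) w x‖ₑ ^ 2) atTop := by
        refine lintegral_congr_ae ?_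
        filter_upwards [hae] with x hx
        exact hx.liminf_eq.symm
    _ ≤ liminf (fun n => ∫⁻ x, ‖mollify (φ n) w (x + h) - mollify (φ n) w x‖ₑ ^ 2) atTop := by
        refine lintegral_liminf_le' fun n => ?_
        have h1 := hwc n
        have h2 : Continuous fun x => mollify (φ n) w (x + h) - mollify (φ n) w x := by fun_prop
        exact h2.aestronglyMeasurable.enorm.pow_const 2
    _ ≤ _ := liminf_le_of_le (by isBoundedDefault)
        (fun b hb => let ⟨n, hn⟩ := hb.exists; hn.trans (hbound n))

end HamSys
end

noncomputable section

namespace HamSys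

variable {N : ℕ}

/-! ### The Hilbert space `H¹` -/

lemma memLp_val (u : H1 N) : MemLp (val u) 2 volume := Lp.memLp _

lemma memLp_grad (u : H1 N) : MemLp (grad u) 2 volume := Lp.memLp _

lemma isWeakGradient_val (u : H1 N) : IsWeakGradient (val u) (grad u) := u.2

lemma val_add (u v : H1 N) : val (u + v) =ᵐ[volume] fun x => val u x + val v x :=
  Lp.coeFn_add u.1.fst v.1.fst

lemma val_sub (u v : H1 N) : val (u - v) =ᵐ[volume] fun x => val u x - val v x :=
  Lp.coeFn_sub u.1.fst v.1.fst

lemma val_smul (c : ℝ) (u : H1 N) : val (c • u) =ᵐ[volume] fun x => c * val u x :=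
  Lp.coeFn_smul c u.1.fst

lemma val_zero : val (0 : H1 N) =ᵐ[volume] fun _ => 0 := Lp.coeFn_zero _ _ _

lemma eLpNorm_val_le (u : H1 N) : eLpNorm (val u) 2 volume ≤ ‖u‖ₑ := by
  have h : eLpNorm (val u) 2 volume = ‖u.1.fst‖ₑ := Lp.enorm_def _ |>.symm
  rw [h, ← ofReal_norm, ← ofReal_norm]
  exact ENNReal.ofReal_le_ofReal (WithLp.norm_fst_le (x := u.1))

lemma eLpNorm_grad_le (u : H1 N) : eLpNorm (grad u) 2 volume ≤ ‖u‖ₑ := by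
  have h : eLpNorm (grad u) 2 volume = ‖u.1.snd‖ₑ := Lp.enorm_def _ |>.symm
  rw [h, ← ofReal_norm, ← ofReal_norm]
  exact ENNReal.ofReal_le_ofReal (WithLp.norm_snd_le (x := u.1))

lemma lintegral_sq_le_of_eLpNorm_le {F : Type*} [NormedAddCommGroup F] {f : Sp N → F} {c : ℝ≥0∞}
    (h : eLpNorm f 2 volume ≤ c) : ∫⁻ x, ‖f x‖ₑ ^ 2 ≤ c ^ 2 := by
  rw [eLpNorm_eq_lintegral_rpow_enorm_toReal (by norm_num) (by norm_num)] at h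
  simp only [ENNReal.toReal_ofNat, ENNReal.rpow_two] at h
  calc ∫⁻ x, ‖f x‖ₑ ^ 2 = ((∫⁻ x, ‖f x‖ₑ ^ 2) ^ (1 / 2 : ℝ)) ^ 2 := by
        rw [← ENNReal.rpow_two, ← ENNReal.rpow_mul]; norm_num
    _ ≤ _ := by gcongr

lemma lintegral_val_sq_le (u : H1 N) : ∫⁻ x, ‖val u x‖ₑ ^ 2 ≤ ‖u‖ₑ ^ 2 :=
  lintegral_sq_le_of_eLpNorm_le (eLpNorm_val_le u)

lemma lintegral_grad_sq_le (u : H1 N) : ∫⁻ x, ‖grad u x‖ₑ ^ 2 ≤ ‖u‖ₑ ^ 2 :=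
  lintegral_sq_le_of_eLpNorm_le (eLpNorm_grad_le u)

lemma norm_sq_eq_integral (u : H1 N) :
    ‖u‖ ^ 2 = (∫ x, ⟪grad u x, grad u x⟫_ℝ) + ∫ x, val u x * val u x := by
  have h1 : ‖u‖ ^ 2 = ‖u.1.fst‖ ^ 2 + ‖u.1.snd‖ ^ 2 := WithLp.prod_norm_sq_eq_of_L2 u.1
  rw [h1, ← real_inner_self_eq_norm_sq, ← real_inner_self_eq_norm_sq, L2.inner_def, L2.inner_def,
    add_comm]
  rfl

lemma integral_mul_eq_inner {f : Sp N → ℝ} (hf : MemLp f 2 volume)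
    (p : Lp ℝ 2 (volume : Measure (Sp N))) : ∫ x, p x * f x = ⟪hf.toLp f, p⟫_ℝ := by
  rw [L2.inner_def]
  refine integral_congr_ae ?_
  filter_upwards [hf.coeFn_toLp] with x hx
  rw [hx]
  rfl

/-- Each defining identity equates two continuous functionals of the pair, inner products with fixed
`L²` functions. -/
lemma isClosed_H1 : IsClosed ((H1 N : Submodule ℝ _) : Set (WithLp 2
    (Lp ℝ 2 (volume : Measure (Sp N)) × Lp (Sp N) 2 (volume : Measure (Sp N))))) := by
  have : ((H1 N : Submodule ℝ _) : Set (WithLp 2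
      (Lp ℝ 2 (volume : Measure (Sp N)) × Lp (Sp N) 2 (volume : Measure (Sp N))))) =
      ⋂ φ : {φ : Sp N → ℝ // ContDiff ℝ ∞ φ ∧ HasCompactSupport φ}, ⋂ i : Fin N,
        {p | ∫ x, (p.fst : Sp N → ℝ) x * fderiv ℝ φ.1 x (EuclideanSpace.single i 1)
          = - ∫ x, (p.snd : Sp N → Sp N) x i * φ.1 x} := by
    ext p
    simp only [Set.mem_iInter, Set.mem_ofPred_eq, Subtype.forall]
    exact ⟨fun h φ hφ i => h φ hφ.1 hφ.2 i, fun h φ h1 h2 i => h φ ⟨h1, h2⟩ i⟩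
  rw [this]
  refine isClosed_iInter fun φ => isClosed_iInter fun i => ?_
  have hd := memLp_two_partial φ.2.1 φ.2.2 (EuclideanSpace.single i 1)
  have hφ := memLp_two_of_continuous_compact φ.2.1.continuous φ.2.2
  have hφi : MemLp (fun x => φ.1 x • (EuclideanSpace.single i 1 : Sp N)) 2 volume :=
    (φ.2.1.continuous.smul continuous_const).memLp_of_hasCompactSupport φ.2.2.smul_right
  have e : ∀ p : WithLp 2 (Lp ℝ 2 (volume : Measure (Sp N)) ×
      Lp (Sp N) 2 (volume : Measure (Sp N))), ∫ x, (p.snd : Sp N → Sp N) x i * φ.1 x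
      = ⟪hφi.toLp _, p.snd⟫_ℝ := by
    intro p
    rw [L2.inner_def]
    refine integral_congr_ae ?_
    filter_upwards [hφi.coeFn_toLp] with x hx
    rw [hx, real_inner_smul_left, EuclideanSpace.inner_single_left]
    simp [mul_comm]
  simp only [integral_mul_eq_inner hd, e]
  refine isClosed_eq ?_ ?_
  · exact (continuous_const.inner (WithLp.prod_continuous_ofLp 2 _ _ |>.fst))
  · exact (continuous_const.inner (WithLp.prod_continuous_ofLp 2 _ _ |>.snd)).neg

instance : CompleteSpace (H1 N) := isClosed_H1.completeSpace_coe

instance : TopologicalSpace.SeparableSpace (H1 N) := by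
  have : Fact ((2 : ℝ≥0∞) ≠ ⊤) := ⟨by norm_num⟩
  have : SecondCountableTopology (Lp ℝ 2 (volume : Measure (Sp N))) := Lp.SecondCountableTopology
  have : SecondCountableTopology (Lp (Sp N) 2 (volume : Measure (Sp N))) :=
    Lp.SecondCountableTopology
  have : SecondCountableTopology (WithLp 2
    (Lp ℝ 2 (volume : Measure (Sp N)) × Lp (Sp N) 2 (volume : Measure (Sp N)))) :=
    (WithLp.homeomorphProd 2 _ _).secondCountableTopology
  infer_instance

lemma IsWeakGradient.congr {w w' : Sp N → ℝ} {G G' : Sp N → Sp N} (h : IsWeakGradient w G)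
    (hw : w' =ᵐ[volume] w) (hG : G' =ᵐ[volume] G) : IsWeakGradient w' G' := by
  intro φ h1 h2 i
  have e1 : ∫ x, w' x * fderiv ℝ φ x (EuclideanSpace.single i 1)
      = ∫ x, w x * fderiv ℝ φ x (EuclideanSpace.single i 1) := by
    refine integral_congr_ae ?_
    filter_upwards [hw] with x hx
    rw [hx]
  have e2 : ∫ x, G' x i * φ x = ∫ x, G x i * φ x := by
    refine integral_congr_ae ?_
    filter_upwards [hG] with x hx
    rw [hx]
  rw [e1, e2]
  exact h φ h1 h2 i

lemma exists_H1 {w : Sp N → ℝ} {G : Sp N → Sp N} (hw : MemLp w 2 volume) (hG : MemLp G 2 volume)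
    (h : IsWeakGradient w G) : ∃ u : H1 N, val u =ᵐ[volume] w ∧ grad u =ᵐ[volume] G :=
  ⟨⟨WithLp.toLp 2 (hw.toLp w, hG.toLp G), h.congr hw.coeFn_toLp hG.coeFn_toLp⟩,
    hw.coeFn_toLp, hG.coeFn_toLp⟩

/-! ### Cutoff -/

lemma gradient_apply_eq {χ : Sp N → ℝ} (x : Sp N) (i : Fin N) :
    gradient χ x i = fderiv ℝ χ x (EuclideanSpace.single i 1) := by
  have h : ⟪gradient χ x, EuclideanSpace.single i (1 : ℝ)⟫_ℝ
      = fderiv ℝ χ x (EuclideanSpace.single i 1) := by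
    rw [gradient, InnerProductSpace.toDual_symm_apply]
  rw [← h, EuclideanSpace.inner_single_right]
  simp

lemma continuous_gradient {χ : Sp N → ℝ} (hχ : ContDiff ℝ ∞ χ) : Continuous (gradient χ) :=
  (LinearIsometryEquiv.continuous _).comp (hχ.continuous_fderiv (by simp))

/-- Test with `χ φ` and expand by the product rule. -/
lemma IsWeakGradient.mul {w : Sp N → ℝ} {G : Sp N → Sp N} (h : IsWeakGradient w G)
    (hw : MemLp w 2 volume) (hG : MemLp G 2 volume) {χ : Sp N → ℝ} (hχ : ContDiff ℝ ∞ χ) :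
    IsWeakGradient (fun x => χ x * w x) (fun x => χ x • G x + w x • gradient χ x) := by
  intro φ hφ hc i
  set e : Sp N := EuclideanSpace.single i 1
  have hχφ : ContDiff ℝ ∞ (fun x => χ x * φ x) := hχ.mul hφ
  have hχφc : HasCompactSupport (fun x => χ x * φ x) := hc.mul_left
  have hd : ∀ x, fderiv ℝ (fun x => χ x * φ x) x e = χ x * fderiv ℝ φ x e + φ x * fderiv ℝ χ x e := by
    intro x
    rw [fderiv_fun_mul (hχ.differentiable (by simp) x) (hφ.differentiable (by simp) x)]
    simp
  have h1 := h _ hχφ hχφc i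
  have hm1 : Integrable (fun x => w x * (χ x * fderiv ℝ φ x e)) := by
    refine hw.integrable_mul (q := 2) (memLp_two_of_continuous_compact ?_ ?_)
    · exact hχ.continuous.mul ((hφ.continuous_fderiv (by simp)).clm_apply continuous_const)
    · exact (hc.fderiv_apply ℝ e).mul_left
  have hm2 : Integrable (fun x => w x * (φ x * fderiv ℝ χ x e)) := by
    refine hw.integrable_mul (q := 2) (memLp_two_of_continuous_compact ?_ ?_)
    · exact hφ.continuous.mul ((hχ.continuous_fderiv (by simp)).clm_apply continuous_const)
    · exact hc.mul_right
  have hm3 : Integrable (fun x => G x i * (χ x * φ x)) :=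
    (memLp_two_coord hG i).integrable_mul (q := 2)
      (memLp_two_of_continuous_compact hχφ.continuous hχφc)
  have e1 : ∫ x, w x * fderiv ℝ (fun x => χ x * φ x) x e
      = (∫ x, w x * (χ x * fderiv ℝ φ x e)) + ∫ x, w x * (φ x * fderiv ℝ χ x e) := by
    rw [← integral_add hm1 hm2]
    exact integral_congr_ae (Eventually.of_forall fun x => by simp only [hd]; ring)
  have e2 : ∫ x, (χ x • G x + w x • gradient χ x) i * φ x
      = (∫ x, G x i * (χ x * φ x)) + ∫ x, w x * (φ x * fderiv ℝ χ x e) := by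
    rw [← integral_add hm3 hm2]
    refine integral_congr_ae (Eventually.of_forall fun x => ?_)
    simp only [PiLp.add_apply, PiLp.smul_apply, smul_eq_mul, gradient_apply_eq]
    ring
  have e3 : ∫ x, χ x * w x * fderiv ℝ φ x e = ∫ x, w x * (χ x * fderiv ℝ φ x e) :=
    integral_congr_ae (Eventually.of_forall fun x => by ring)
  rw [e1] at h1
  rw [e2, e3]
  linarith

/-- Sobolev's inequality for `χ u`. The right side is restricted to the support of `χ`, so that the
same estimate gives both the local inequality and, with growing cutoffs, the global one. -/
lemma exists_sobolev_cutoff (hN : 3 ≤ N) : ∃ C : NNReal, ∀ (u : H1 N) (χ : Sp N → ℝ) (M : NNReal),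
    ContDiff ℝ ∞ χ → HasCompactSupport χ → (∀ x, |χ x| ≤ 1) → (∀ x, ‖gradient χ x‖ ≤ M) →
    eLpNorm (fun x => χ x * val u x) (ENNReal.ofReal (critExp N)) volume ^ 2 ≤
      C ^ 2 * (2 * (1 + M ^ 2)) * ∫⁻ x in tsupport χ, (‖val u x‖ₑ ^ 2 + ‖grad u x‖ₑ ^ 2) := by
  obtain ⟨C, hC⟩ := exists_sobolev_const hN
  refine ⟨C, fun u χ M hχ hc h1 hM => ?_⟩
  have hb1 : MemLp χ ∞ (volume : Measure (Sp N)) := hχ.continuous.memLp_of_hasCompactSupport hc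
  have hgc : HasCompactSupport (gradient χ) :=
    (hc.fderiv ℝ).comp_left (g := (InnerProductSpace.toDual ℝ (Sp N)).symm) (by simp)
  have hb2 : MemLp (gradient χ) ∞ (volume : Measure (Sp N)) :=
    (continuous_gradient hχ).memLp_of_hasCompactSupport hgc
  have hw : MemLp (fun x => χ x * val u x) 2 volume := (memLp_val u).mul hb1
  have hG : MemLp (fun x => χ x • grad u x + val u x • gradient χ x) 2 volume :=
    ((memLp_grad u).smul hb1).add (hb2.smul (memLp_val u))
  have h2 := hC _ _ hw hG ((isWeakGradient_val u).mul (memLp_val u) (memLp_grad u) hχ) hc.mul_right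
  have h3 : ∫⁻ x, ‖χ x • grad u x + val u x • gradient χ x‖ₑ ^ 2 ≤
      (2 * (1 + M ^ 2)) * ∫⁻ x in tsupport χ, (‖val u x‖ₑ ^ 2 + ‖grad u x‖ₑ ^ 2) := by
    rw [← lintegral_const_mul' _ _ (by finiteness),
      ← lintegral_indicator (isClosed_tsupport χ).measurableSet]
    refine lintegral_mono fun x => ?_
    by_cases hx : x ∈ tsupport χ
    · rw [Set.indicator_of_mem hx]
      have e : ∀ r : ℝ, 0 ≤ r → ENNReal.ofReal r ^ 2 = ENNReal.ofReal (r ^ 2) := fun r hr =>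
        (ENNReal.ofReal_pow hr 2).symm
      rw [← ofReal_norm, ← ofReal_norm, ← ofReal_norm, e _ (norm_nonneg _), e _ (norm_nonneg _),
        e _ (norm_nonneg _), ← ENNReal.ofReal_add (sq_nonneg _) (sq_nonneg _)]
      have e2 : (2 * (1 + (M : ℝ≥0∞) ^ 2)) = ENNReal.ofReal (2 * (1 + (M : ℝ) ^ 2)) := by
        rw [ENNReal.ofReal_mul (by norm_num), ENNReal.ofReal_add (by norm_num) (by positivity),
          ENNReal.ofReal_pow (by positivity)]
        simp
      rw [e2, ← ENNReal.ofReal_mul (by positivity)]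
      refine ENNReal.ofReal_le_ofReal ?_
      have h4 : ‖χ x • grad u x + val u x • gradient χ x‖ ≤ ‖grad u x‖ + ‖val u x‖ * M := by
        refine (norm_add_le _ _).trans ?_
        rw [norm_smul, norm_smul]
        gcongr
        · rw [Real.norm_eq_abs]
          exact mul_le_of_le_one_left (norm_nonneg _) (h1 x)
        · exact hM x
      calc ‖χ x • grad u x + val u x • gradient χ x‖ ^ 2 ≤ (‖grad u x‖ + ‖val u x‖ * M) ^ 2 := by
            gcongr
        _ ≤ _ := by
            nlinarith [sq_nonneg (‖grad u x‖ - ‖val u x‖ * M), sq_nonneg (‖grad u x‖ * M),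
              sq_nonneg (‖val u x‖)]
    · rw [Set.indicator_of_notMem hx]
      have hχ0 : χ x = 0 := image_eq_zero_of_notMem_tsupport hx
      have hf0 : fderiv ℝ χ x = 0 :=
        image_eq_zero_of_notMem_tsupport (fun h => hx (tsupport_fderiv_subset ℝ h))
      have hg0 : gradient χ x = 0 := by rw [gradient, hf0, map_zero]
      simp [hχ0, hg0]
  have h4 : eLpNorm (fun x => χ x • grad u x + val u x • gradient χ x) 2 volume ^ 2
      = ∫⁻ x, ‖χ x • grad u x + val u x • gradient χ x‖ₑ ^ 2 := by
    rw [eLpNorm_eq_lintegral_rpow_enorm_toReal (by norm_num) (by norm_num)]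
    simp only [ENNReal.toReal_ofNat, ENNReal.rpow_two]
    rw [← ENNReal.rpow_two, ← ENNReal.rpow_mul]; norm_num
  calc _ ≤ (C * eLpNorm (fun x => χ x • grad u x + val u x • gradient χ x) 2 volume) ^ 2 := by
        gcongr
    _ = C ^ 2 * ∫⁻ x, ‖χ x • grad u x + val u x • gradient χ x‖ₑ ^ 2 := by rw [mul_pow, h4]
    _ ≤ C ^ 2 * ((2 * (1 + M ^ 2)) *
        ∫⁻ x in tsupport χ, (‖val u x‖ₑ ^ 2 + ‖grad u x‖ₑ ^ 2)) := by gcongr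
    _ = _ := (mul_assoc _ _ _).symm

end HamSys
end

noncomputable section

namespace HamSys

variable {N : ℕ}

/-! ### Sobolev's inequality on `H¹` -/

lemma critExp_pos (hN : 3 ≤ N) : 2 < critExp N := by
  have hN' : (3 : ℝ) ≤ N := by exact_mod_cast hN
  unfold critExp
  rw [lt_div_iff₀ (by linarith)]
  linarith

/-- A smooth cutoff function, equal to `1` on the unit ball and supported in the ball of
radius `2`. -/
def bump (N : ℕ) : ContDiffBump (0 : Sp N) := ⟨1, 2, one_pos, one_lt_two⟩

lemma exists_cutoff_bound : ∃ M : NNReal, ∀ s : ℝ, 0 < s → s ≤ 1 → ∀ y : Sp N,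
    ContDiff ℝ ∞ (fun x => bump N (s • (x - y))) ∧
    HasCompactSupport (fun x => bump N (s • (x - y))) ∧
    (∀ x, |bump N (s • (x - y))| ≤ 1) ∧
    ∀ x, ‖gradient (fun x => bump N (s • (x - y))) x‖ ≤ M := by
  have hs : ContDiff ℝ ∞ (bump N) := (bump N).contDiff
  obtain ⟨M, hM⟩ := ((bump N).hasCompactSupport.fderiv ℝ).exists_bound_of_continuous
    (hs.continuous_fderiv (by simp))
  refine ⟨M.toNNReal, fun s hs0 hs1 y => ⟨hs.comp ?_, ?_, fun x => ?_, fun x => ?_⟩⟩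
  · exact (contDiff_id.sub contDiff_const).const_smul s
  · exact (bump N).hasCompactSupport.comp_homeomorph
      ((Homeomorph.subRight y).trans (Homeomorph.smulOfNeZero s hs0.ne'))
  · rw [abs_of_nonneg (bump N).nonneg]
    exact (bump N).le_one
  · have h1 : HasFDerivAt (bump N) (fderiv ℝ (bump N) (s • (x - y))) (s • (x - y)) :=
      (hs.differentiable (by simp) _).hasFDerivAt
    have h2 : HasFDerivAt (fun x : Sp N => s • (x - y)) (s • ContinuousLinearMap.id ℝ (Sp N)) x :=
      ((hasFDerivAt_id x).sub_const y).const_smul s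
    have h3 : HasFDerivAt (fun x => bump N (s • (x - y))) _ x :=
      HasFDerivAt.comp (g := bump N) (f := fun x => s • (x - y)) x h1 h2
    rw [gradient, LinearIsometryEquiv.norm_map, h3.fderiv, ContinuousLinearMap.comp_smul,
      ContinuousLinearMap.comp_id, norm_smul, Real.norm_of_nonneg hs0.le]
    calc s * ‖fderiv ℝ (bump N) (s • (x - y))‖ ≤ 1 * M :=
          mul_le_mul hs1 (hM _) (norm_nonneg _) zero_le_one
      _ = M := one_mul M
      _ ≤ _ := Real.le_coe_toNNReal M

/-- The cutoff is `1` on the unit ball and supported in the closed ball of radius `2`, inside the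
open ball of radius `3`; the constant does not depend on `y`. -/
lemma exists_sobolev_local (hN : 3 ≤ N) : ∃ C : NNReal, ∀ (u : H1 N) (y : Sp N),
    eLpNorm (val u) (ENNReal.ofReal (critExp N)) (volume.restrict (Metric.ball y 1)) ^ 2 ≤
      C * ∫⁻ x in Metric.ball y 3, (‖val u x‖ₑ ^ 2 + ‖grad u x‖ₑ ^ 2) := by
  obtain ⟨C, hC⟩ := exists_sobolev_cutoff hN
  obtain ⟨M, hM⟩ := exists_cutoff_bound (N := N)
  refine ⟨C ^ 2 * (2 * (1 + M ^ 2)), fun u y => ?_⟩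
  obtain ⟨h1, h2, h3, h4⟩ := hM 1 one_pos le_rfl y
  simp only [one_smul] at h1 h2 h3 h4
  have h5 := hC u _ M h1 h2 h3 h4
  have h6 : eLpNorm (val u) (ENNReal.ofReal (critExp N)) (volume.restrict (Metric.ball y 1))
      ≤ eLpNorm (fun x => bump N (x - y) * val u x) (ENNReal.ofReal (critExp N)) volume := by
    refine le_trans (le_of_eq (eLpNorm_congr_ae ?_)) (eLpNorm_restrict_le _ _ _
      (Metric.ball y 1))
    filter_upwards [ae_restrict_mem measurableSet_ball] with x hx
    rw [(bump N).one_of_mem_closedBall, one_mul]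
    rw [mem_closedBall_zero_iff, ← dist_eq_norm]
    exact (Metric.mem_ball.1 hx).le
  have h7 : tsupport (fun x => bump N (x - y)) ⊆ Metric.ball y 3 := by
    refine (closure_minimal (fun x hx => ?_) (Metric.isClosed_closedBall (x := y) (ε := 2))).trans
      (Metric.closedBall_subset_ball (by norm_num))
    by_contra hcon
    refine hx ((bump N).zero_of_le_dist ?_)
    rw [Metric.mem_closedBall, not_le] at hcon
    rw [dist_zero_right, ← dist_eq_norm]
    exact hcon.le
  push_cast
  calc _ ≤ _ := pow_le_pow_left' h6 2
    _ ≤ _ := h5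
    _ ≤ _ := by
      gcongr

set_option maxHeartbeats 1000000 in
-- Cutoffs at scale `n + 1` have uniformly bounded gradients and tend to `1` pointwise; Fatou's
-- lemma removes them.
lemma exists_sobolev (hN : 3 ≤ N) : ∃ C : NNReal, ∀ u : H1 N,
    eLpNorm (val u) (ENNReal.ofReal (critExp N)) volume ≤ C * ‖u‖ₑ := by
  obtain ⟨C, hC⟩ := exists_sobolev_cutoff hN
  obtain ⟨M, hM⟩ := exists_cutoff_bound (N := N)
  refine ⟨C * (2 * (1 + M)), fun u => ?_⟩
  set χ : ℕ → Sp N → ℝ := fun n x => bump N ((1 / ((n : ℝ) + 1)) • (x - 0)) with hχ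
  have hb : ∀ n, eLpNorm (fun x => χ n x * val u x) (ENNReal.ofReal (critExp N)) volume ≤
      (C * (2 * (1 + M)) : NNReal) * ‖u‖ₑ := by
    intro n
    obtain ⟨h1, h2, h3, h4⟩ := hM (1 / ((n : ℝ) + 1)) (by positivity)
      (by rw [div_le_one (by positivity)]; linarith [(n.cast_nonneg : (0 : ℝ) ≤ n)]) 0
    have h5 := hC u _ M h1 h2 h3 h4
    have h6 : ∫⁻ x in tsupport (χ n), (‖val u x‖ₑ ^ 2 + ‖grad u x‖ₑ ^ 2) ≤ 2 * ‖u‖ₑ ^ 2 := by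
      refine (setLIntegral_le_lintegral _ _).trans ?_
      rw [lintegral_add_left' ((memLp_val u).1.enorm.pow_const 2), two_mul]
      exact add_le_add (lintegral_val_sq_le u) (lintegral_grad_sq_le u)
    rw [← ENNReal.rpow_le_rpow_iff (z := 2) (by norm_num), ENNReal.rpow_two, ENNReal.rpow_two]
    refine h5.trans ?_
    calc _ ≤ (C : ℝ≥0∞) ^ 2 * (2 * (1 + M ^ 2)) * (2 * ‖u‖ₑ ^ 2) := by gcongr
      _ = C ^ 2 * 4 * (1 + M ^ 2) * ‖u‖ₑ ^ 2 := by ring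
      _ ≤ C ^ 2 * 4 * (1 + M) ^ 2 * ‖u‖ₑ ^ 2 := by
        gcongr
        calc (1 : ℝ≥0∞) + M ^ 2 ≤ 1 + M ^ 2 + 2 * M := le_self_add
          _ = _ := by ring
      _ = _ := by push_cast; ring
  refine (Lp.eLpNorm_lim_le_liminf_eLpNorm (fun n => ?_) (val u) (f := fun n x => χ n x * val u x)
    (Eventually.of_forall fun x => ?_)).trans (liminf_le_of_le (by isBoundedDefault)
      (fun b hb' => let ⟨n, hn⟩ := hb'.exists; hn.trans (hb n)))
  · have : Continuous (χ n) := (bump N).continuous.comp (by fun_prop)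
    exact this.aestronglyMeasurable.mul (memLp_val u).1
  · have h1 : Tendsto (fun n => χ n x) atTop (𝓝 (bump N 0)) := by
      refine ((bump N).continuous.tendsto 0).comp ?_
      have := (tendsto_one_div_add_atTop_nhds_zero_nat (𝕜 := ℝ)).smul_const (x - 0)
      simpa using this
    have h2 : bump N 0 = 1 :=
      (bump N).one_of_mem_closedBall (by simp [(bump N).rIn_pos.le])
    rw [h2] at h1
    simpa using h1.mul_const (val u x)

/-! ### Lions' lemma -/

/-- Tonelli. Averaging over all centres takes the place of a covering by balls of bounded overlap.
-/
lemma lintegral_lintegral_ball {F : Sp N → ℝ≥0∞} (hF : AEMeasurable F volume) (r : ℝ) :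
    ∫⁻ y, ∫⁻ x in Metric.ball y r, F x = volume (Metric.ball (0 : Sp N) r) * ∫⁻ x, F x := by
  have e1 : ∀ y, ∫⁻ x in Metric.ball y r, F x
      = ∫⁻ x, {p : Sp N × Sp N | dist p.1 p.2 < r}.indicator (fun _ => 1) (x, y) * F x := by
    intro y
    rw [← lintegral_indicator measurableSet_ball]
    refine lintegral_congr fun x => ?_
    by_cases h : dist x y < r
    · rw [Set.indicator_of_mem (Metric.mem_ball.2 h),
        Set.indicator_of_mem (show (x, y) ∈ {p : Sp N × Sp N | dist p.1 p.2 < r} from h), one_mul]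
    · rw [Set.indicator_of_notMem (fun h' => h (Metric.mem_ball.1 h')),
        Set.indicator_of_notMem (show (x, y) ∉ {p : Sp N × Sp N | dist p.1 p.2 < r} from h),
        zero_mul]
  have hm : MeasurableSet {p : Sp N × Sp N | dist p.1 p.2 < r} :=
    measurableSet_lt measurable_dist measurable_const
  simp_rw [e1]
  rw [lintegral_lintegral_swap]
  · rw [← lintegral_const_mul'' _ hF]
    refine lintegral_congr fun x => ?_
    rw [lintegral_mul_const]
    · congr 1
      have e2 : ∀ y, {p : Sp N × Sp N | dist p.1 p.2 < r}.indicator (fun _ => (1 : ℝ≥0∞)) (x, y)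
          = (Metric.ball x r).indicator (fun _ => 1) y := by
        intro y
        simp only [Set.indicator, Set.mem_ofPred_eq, Metric.mem_ball, dist_comm x y]
      simp_rw [e2]
      rw [lintegral_indicator measurableSet_ball, setLIntegral_one]
      exact Measure.addHaar_ball_center _ _ _
    · exact (measurable_const.indicator hm).comp measurable_prodMk_left
  · refine AEMeasurable.mul ?_ ?_
    · exact ((measurable_const.indicator hm).comp measurable_swap).aemeasurable
    · exact hF.comp_quasiMeasurePreserving Measure.quasiMeasurePreserving_snd

/-- The exponent `2 + 4 / N`, which lies between `2` and `critExp N`. -/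
def midExp (N : ℕ) : ℝ := 2 + 4 / (N : ℝ)

set_option maxHeartbeats 1000000 in
-- On each unit ball write `|u|^(2 + 4/N) = |u|^(4/N) |u|²` and apply Hölder with exponents `N/2`
-- and `N/(N-2)`. The first factor is a power of the local mass, and the second is exactly the
-- square of the local `L^(2^*)` norm, which local Sobolev bounds by an integral. Quadratic terms
-- can be integrated over all centres; this is why the exponent is `midExp N`.
lemma exists_lions_const (hN : 3 ≤ N) : ∃ C : NNReal, ∀ (u : H1 N) (δ : ℝ≥0∞),
    (∀ y, ∫⁻ x in Metric.ball y 1, ‖val u x‖ₑ ^ 2 ≤ δ) →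
    ∫⁻ x, ‖val u x‖ₑ ^ midExp N ≤ C * δ ^ (2 / (N : ℝ)) * ‖u‖ₑ ^ 2 := by
  have hN' : (3 : ℝ) ≤ N := by exact_mod_cast hN
  obtain ⟨C, hC⟩ := exists_sobolev_local hN
  set v₁ := volume (Metric.ball (0 : Sp N) 1) with hv₁
  set v₃ := volume (Metric.ball (0 : Sp N) 3) with hv₃
  have hv₁0 : v₁ ≠ 0 := (Metric.measure_ball_pos _ _ one_pos).ne'
  have hv₁t : v₁ ≠ ⊤ := measure_ball_lt_top.ne
  have hv₃t : v₃ ≠ ⊤ := measure_ball_lt_top.ne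
  refine ⟨C * 2 * (v₃ / v₁).toNNReal, fun u δ hδ => ?_⟩
  have hm : AEMeasurable (fun x => ‖val u x‖ₑ) volume := (memLp_val u).1.enorm
  have hloc : ∀ y, ∫⁻ x in Metric.ball y 1, ‖val u x‖ₑ ^ midExp N ≤
      δ ^ (2 / (N : ℝ)) * (C * ∫⁻ x in Metric.ball y 3, (‖val u x‖ₑ ^ 2 + ‖grad u x‖ₑ ^ 2)) := by
    intro y
    have hconj : ((N : ℝ) / 2).HolderConjugate (N / (N - 2)) := by
      have h2 : 0 < (N : ℝ) - 2 := by linarith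
      rw [Real.holderConjugate_iff]
      refine ⟨by rw [lt_div_iff₀ (by norm_num)]; linarith, ?_⟩
      field_simp
      ring
    have h1 := ENNReal.lintegral_mul_le_Lp_mul_Lq (volume.restrict (Metric.ball y 1)) hconj
      (hm.restrict.pow_const (4 / (N : ℝ))) (hm.restrict.pow_const (2 : ℝ))
    have e1 : ∀ x, ((fun x => ‖val u x‖ₑ ^ (4 / (N : ℝ))) * fun x => ‖val u x‖ₑ ^ (2 : ℝ)) x
        = ‖val u x‖ₑ ^ midExp N := by
      intro x
      rw [Pi.mul_apply, ← ENNReal.rpow_add_of_nonneg _ _ (by positivity) (by norm_num), midExp,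
        add_comm]
    have e2 : ∀ x, (‖val u x‖ₑ ^ (4 / (N : ℝ))) ^ ((N : ℝ) / 2) = ‖val u x‖ₑ ^ 2 := by
      intro x
      rw [← ENNReal.rpow_mul, show 4 / (N : ℝ) * (N / 2) = 2 by field_simp; norm_num,
        ENNReal.rpow_two]
    have e3 : ∀ x, (‖val u x‖ₑ ^ (2 : ℝ)) ^ ((N : ℝ) / (N - 2)) = ‖val u x‖ₑ ^ critExp N := by
      intro x
      rw [← ENNReal.rpow_mul, critExp, mul_div_assoc]
    simp only [e1, e2, e3] at h1
    refine h1.trans (mul_le_mul' ?_ ?_)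
    · rw [show 1 / ((N : ℝ) / 2) = 2 / N by rw [one_div_div]]
      exact ENNReal.rpow_le_rpow (hδ y) (by positivity)
    · refine le_trans (le_of_eq ?_) (hC u y)
      have hr := critExp_pos hN
      rw [eLpNorm_eq_lintegral_rpow_enorm_toReal (by simp; linarith) (by simp),
        ENNReal.toReal_ofReal (by linarith), ← ENNReal.rpow_two, ← ENNReal.rpow_mul]
      congr 1
      unfold critExp
      have h2 : 0 < (N : ℝ) - 2 := by linarith
      field_simp
  have hF : AEMeasurable (fun x => ‖val u x‖ₑ ^ 2 + ‖grad u x‖ₑ ^ 2) volume :=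
    (hm.pow_const 2).add ((memLp_grad u).1.enorm.pow_const 2)
  have hsum : v₁ * ∫⁻ x, ‖val u x‖ₑ ^ midExp N ≤
      δ ^ (2 / (N : ℝ)) * C * v₃ * (2 * ‖u‖ₑ ^ 2) := by
    rw [← lintegral_lintegral_ball (hm.pow_const _)]
    have hae : AEMeasurable (fun y => ∫⁻ x in Metric.ball y 3,
        (‖val u x‖ₑ ^ 2 + ‖grad u x‖ₑ ^ 2)) volume := by
      refine Measurable.aemeasurable ?_
      have : ∀ y, ∫⁻ x in Metric.ball y 3, (‖val u x‖ₑ ^ 2 + ‖grad u x‖ₑ ^ 2)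
          = ∫⁻ x in Metric.ball y 3, hF.mk _ x := fun y =>
        lintegral_congr_ae (ae_restrict_of_ae hF.ae_eq_mk)
      simp_rw [this]
      have e : ∀ y, ∫⁻ x in Metric.ball y 3, hF.mk _ x
          = ∫⁻ x, {p : Sp N × Sp N | dist p.2 p.1 < 3}.indicator (fun p => hF.mk _ p.2)
            (y, x) := by
        intro y
        rw [← lintegral_indicator measurableSet_ball]
        rfl
      simp_rw [e]
      refine Measurable.lintegral_prod_right' (f := {p : Sp N × Sp N | dist p.2 p.1 < 3}.indicator
        (fun p => hF.mk _ p.2)) ?_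
      exact (hF.measurable_mk.comp measurable_snd).indicator
        (measurableSet_lt (measurable_snd.dist measurable_fst) measurable_const)
    calc _ ≤ ∫⁻ y, δ ^ (2 / (N : ℝ)) *
          (C * ∫⁻ x in Metric.ball y 3, (‖val u x‖ₑ ^ 2 + ‖grad u x‖ₑ ^ 2)) :=
          lintegral_mono hloc
      _ = δ ^ (2 / (N : ℝ)) * (C * (v₃ * ∫⁻ x, (‖val u x‖ₑ ^ 2 + ‖grad u x‖ₑ ^ 2))) := by
          rw [lintegral_const_mul'' _ (hae.const_mul _), lintegral_const_mul'' _ hae,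
            lintegral_lintegral_ball hF]
      _ ≤ δ ^ (2 / (N : ℝ)) * (C * (v₃ * (2 * ‖u‖ₑ ^ 2))) := by
          refine mul_le_mul' le_rfl (mul_le_mul' le_rfl (mul_le_mul' le_rfl ?_))
          rw [lintegral_add_left' (hm.pow_const 2), two_mul]
          exact add_le_add (lintegral_val_sq_le u) (lintegral_grad_sq_le u)
      _ = _ := by ring
  have h9 : ∫⁻ x, ‖val u x‖ₑ ^ midExp N ≤
      (δ ^ (2 / (N : ℝ)) * C * v₃ * (2 * ‖u‖ₑ ^ 2)) / v₁ := by
    rw [ENNReal.le_div_iff_mul_le (Or.inl hv₁0) (Or.inl hv₁t), mul_comm]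
    exact hsum
  refine h9.trans (le_of_eq ?_)
  push_cast
  rw [ENNReal.coe_toNNReal (ENNReal.div_ne_top hv₃t hv₁0)]
  simp only [div_eq_mul_inv]
  ring

end HamSys
end

noncomputable section

namespace HamSys

variable {N : ℕ}

/-! ### Local compactness -/

/-- The difference is an average of `w (x - t) - w x` over `‖t‖ ≤ rOut`, and each such difference is
controlled by the gradient. -/
lemma lintegral_mollify_sub_sq_le (φ : ContDiffBump (0 : Sp N)) {w : Sp N → ℝ} {G : Sp N → Sp N}
    (hw : MemLp w 2 volume) (hG : MemLp G 2 volume) (hwG : IsWeakGradient w G) :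
    ∫⁻ x, ‖mollify φ w x - w x‖ₑ ^ 2 ≤ ENNReal.ofReal φ.rOut ^ 2 * ∫⁻ x, ‖G x‖ₑ ^ 2 := by
  have hwl := hw.locallyIntegrable (by norm_num)
  have hpt : ∀ x, ‖mollify φ w x - w x‖ₑ ^ 2 ≤
      ∫⁻ t, ‖φ.normed volume t‖ₑ * ‖w (x - t) - w x‖ₑ ^ 2 := by
    intro x
    have e : mollify φ w x - w x = mollify φ (fun s => w s - w x) x := by
      have hex : ConvolutionExistsAt (φ.normed volume) w x (ContinuousLinearMap.lsmul ℝ ℝ) volume :=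
        φ.hasCompactSupport_normed.convolutionExists_left _ φ.continuous_normed hwl x
      have hex' : Integrable (fun t => φ.normed volume t * w (x - t)) := hex
      have h1 : mollify φ (fun s => w s - w x) x
          = ∫ t, (φ.normed volume t * w (x - t) - φ.normed volume t * w x) := by
        refine integral_congr_ae (Eventually.of_forall fun t => ?_)
        simp [mul_sub]
      rw [h1, integral_sub hex' (φ.integrable_normed.mul_const _), integral_mul_const,
        φ.integral_normed, one_mul]
      rfl
    rw [e]
    exact enorm_mollify_sq_le φ (hw.1.sub aestronglyMeasurable_const) x
  calc ∫⁻ x, ‖mollify φ w x - w x‖ₑ ^ 2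
      ≤ ∫⁻ x, ∫⁻ t, ‖φ.normed volume t‖ₑ * ‖w (x - t) - w x‖ₑ ^ 2 := lintegral_mono hpt
    _ = ∫⁻ t, ∫⁻ x, ‖φ.normed volume t‖ₑ * ‖w (x - t) - w x‖ₑ ^ 2 := by
        refine lintegral_lintegral_swap ?_
        have h1 : AEStronglyMeasurable (fun p : Sp N × Sp N => w (p.1 - p.2))
            (volume.prod volume) :=
          hw.1.comp_quasiMeasurePreserving (quasiMeasurePreserving_sub _ _)
        have h2 : AEStronglyMeasurable (fun p : Sp N × Sp N => w p.1) (volume.prod volume) :=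
          hw.1.comp_quasiMeasurePreserving Measure.quasiMeasurePreserving_fst
        refine AEMeasurable.mul ?_ ((h1.sub h2).enorm.pow_const 2)
        exact (φ.continuous_normed.comp continuous_snd).aestronglyMeasurable.enorm
    _ ≤ ∫⁻ t, ‖φ.normed volume t‖ₑ * (ENNReal.ofReal φ.rOut ^ 2 * ∫⁻ x, ‖G x‖ₑ ^ 2) := by
        refine lintegral_mono fun t => ?_
        rw [lintegral_const_mul' _ _ (by simp)]
        by_cases ht : φ.rOut ≤ ‖t‖
        · have : φ.normed volume t = 0 := by
            rw [ContDiffBump.normed, φ.zero_of_le_dist (by simpa using ht), zero_div]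
          simp [this]
        · refine mul_le_mul' le_rfl ?_
          have h3 := lintegral_enorm_translate_sub_sq_le hw hG hwG (-t)
          simp only [← sub_eq_add_neg] at h3
          refine h3.trans (mul_le_mul' (pow_le_pow_left' ?_ 2) le_rfl)
          rw [enorm_neg, ← ofReal_norm]
          exact ENNReal.ofReal_le_ofReal (not_le.1 ht).le
    _ = _ := by
        rw [lintegral_mul_const'' _ φ.continuous_normed.aestronglyMeasurable.enorm,
          lintegral_enorm_normed, one_mul]

/-- The values of an element of `H¹`, as a continuous linear map into `L²`. -/
def valL (N : ℕ) : H1 N →L[ℝ] Lp ℝ 2 (volume : Measure (Sp N)) :=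
  (WithLp.fstL 2 ℝ _ _).comp (H1 N).subtypeL

/-- The value of the mollification at a fixed point is the pairing with a fixed `L²` function, hence
a bounded functional on `H¹`. -/
lemma tendsto_mollify_of_weaklyTendsto (φ : ContDiffBump (0 : Sp N)) {v : ℕ → H1 N}
    (hv : WeaklyTendsto v 0) (x : Sp N) :
    Tendsto (fun n => mollify φ (val (v n)) x) atTop (𝓝 0) := by
  have hm : MemLp (fun t => φ.normed volume (x - t)) 2 (volume : Measure (Sp N)) :=
    memLp_two_of_continuous_compact (φ.continuous_normed.comp (by fun_prop))
      (φ.hasCompactSupport_normed.comp_homeomorph (Homeomorph.subLeft x))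
  have e : ∀ u : H1 N, mollify φ (val u) x = ((innerSL ℝ (hm.toLp _)).comp (valL N)) u := by
    intro u
    have h1 := integral_mul_eq_inner hm u.1.fst
    have h2 : ((innerSL ℝ (hm.toLp _)).comp (valL N)) u = ⟪hm.toLp _, u.1.fst⟫_ℝ := rfl
    rw [h2, ← h1, ← integral_sub_left_eq_self _ volume x]
    refine integral_congr_ae (Eventually.of_forall fun t => ?_)
    simp [val, mul_comm]
  simp_rw [e]
  simpa using hv ((innerSL ℝ (hm.toLp _)).comp (valL N))

lemma exists_enorm_mollify_le (φ : ContDiffBump (0 : Sp N)) :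
    ∃ M : NNReal, ∀ (u : H1 N) (x : Sp N), ‖mollify φ (val u) x‖ₑ ^ 2 ≤ M * ‖u‖ₑ ^ 2 := by
  obtain ⟨M, hM⟩ := (φ.hasCompactSupport_normed (μ := (volume : Measure (Sp N)))).exists_bound_of_continuous
    φ.continuous_normed
  refine ⟨M.toNNReal, fun u x => (enorm_mollify_sq_le φ (memLp_val u).1 x).trans ?_⟩
  calc ∫⁻ t, ‖φ.normed volume t‖ₑ * ‖val u (x - t)‖ₑ ^ 2
      ≤ ∫⁻ t, (M.toNNReal : ℝ≥0∞) * ‖val u (x - t)‖ₑ ^ 2 := by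
        refine lintegral_mono fun t => mul_le_mul' ?_ le_rfl
        rw [← ofReal_norm]
        exact ENNReal.ofReal_le_ofReal (hM t)
    _ = M.toNNReal * ∫⁻ t, ‖val u t‖ₑ ^ 2 := by
        rw [lintegral_const_mul' _ _ (by simp)]
        congr 1
        exact lintegral_sub_left_eq_self (fun t => ‖val u t‖ₑ ^ 2) x
    _ ≤ _ := mul_le_mul' le_rfl (lintegral_val_sq_le u)

lemma enorm_sq_le_two_mul (a b : ℝ) : ‖a‖ₑ ^ 2 ≤ 2 * (‖b - a‖ₑ ^ 2 + ‖b‖ₑ ^ 2) := by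
  have h1 : ‖a‖ₑ ≤ ‖b - a‖ₑ + ‖b‖ₑ := by
    calc ‖a‖ₑ = ‖b - (b - a)‖ₑ := by rw [sub_sub_cancel]
      _ ≤ ‖b‖ₑ + ‖b - a‖ₑ := enorm_sub_le
      _ = _ := add_comm _ _
  have h2 := ENNReal.rpow_add_le_mul_rpow_add_rpow (‖b - a‖ₑ) (‖b‖ₑ) (p := 2) (by norm_num)
  norm_num at h2
  calc ‖a‖ₑ ^ 2 ≤ (‖b - a‖ₑ + ‖b‖ₑ) ^ 2 := by gcongr
    _ ≤ _ := h2

/-- Rellich's theorem on balls. -/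
lemma tendsto_lintegral_ball_of_weaklyTendsto {v : ℕ → H1 N} (hv : WeaklyTendsto v 0) (R : ℝ) :
    Tendsto (fun n => ∫⁻ x in Metric.ball 0 R, ‖val (v n) x‖ₑ ^ 2) atTop (𝓝 0) := by
  obtain ⟨K, hK⟩ := hv.bounded
  set k : ℝ≥0∞ := ENNReal.ofReal K with hk
  have hvk : ∀ n, ‖v n‖ₑ ≤ k := fun n => by
    rw [← ofReal_norm]; exact ENNReal.ofReal_le_ofReal (hK n)
  rw [ENNReal.tendsto_nhds_zero]
  intro ε hε
  have hε2 : 0 < ε / 2 := ENNReal.half_pos hε.ne'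
  -- The mollification error is uniform over the bounded sequence, so the kernel can be fixed before
  -- letting `n` grow.
  obtain ⟨φ, hφ⟩ : ∃ φ : ContDiffBump (0 : Sp N),
      2 * (ENNReal.ofReal φ.rOut ^ 2 * k ^ 2) ≤ ε / 2 := by
    have hlim : Tendsto (fun n : ℕ => 2 * (ENNReal.ofReal (2 / ((n : ℝ) + 1)) ^ 2 * k ^ 2)) atTop
        (𝓝 (2 * (ENNReal.ofReal (2 * 0) ^ 2 * k ^ 2))) := by
      refine ENNReal.Tendsto.const_mul ?_ (Or.inr (by norm_num))
      refine ENNReal.Tendsto.mul_const ?_ (Or.inr (by rw [hk]; finiteness))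
      refine ((ENNReal.continuous_pow 2).tendsto _).comp (ENNReal.tendsto_ofReal ?_)
      simpa [div_eq_mul_inv] using (tendsto_one_div_add_atTop_nhds_zero_nat (𝕜 := ℝ)).const_mul 2
    simp only [mul_zero, ENNReal.ofReal_zero, ne_eq, OfNat.ofNat_ne_zero, not_false_eq_true,
      zero_pow, zero_mul] at hlim
    obtain ⟨n, hn⟩ := ((ENNReal.tendsto_nhds_zero.1 hlim) _ hε2).exists
    exact ⟨⟨1 / ((n : ℝ) + 1), 2 / ((n : ℝ) + 1), by positivity, by gcongr; norm_num⟩, hn⟩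
  obtain ⟨M, hM⟩ := exists_enorm_mollify_le φ
  have hwl : ∀ n, LocallyIntegrable (val (v n)) volume := fun n =>
    (memLp_val (v n)).locallyIntegrable (by norm_num)
  have hcont : ∀ n, Continuous (mollify φ (val (v n))) := fun n =>
    (contDiff_mollify φ (hwl n)).continuous
  have hlim : Tendsto (fun n => ∫⁻ x in Metric.ball (0 : Sp N) R, ‖mollify φ (val (v n)) x‖ₑ ^ 2)
      atTop (𝓝 0) := by
    have := tendsto_lintegral_of_dominated_convergence' (μ := volume.restrict (Metric.ball (0 : Sp N) R))
      (F := fun n x => ‖mollify φ (val (v n)) x‖ₑ ^ 2) (f := fun _ => 0) (fun _ => M * k ^ 2)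
      (fun n => ((hcont n).aestronglyMeasurable.enorm.pow_const 2))
      (fun n => Eventually.of_forall fun x => (hM (v n) x).trans
        (mul_le_mul' le_rfl (pow_le_pow_left' (hvk n) 2)))
      (by
        rw [setLIntegral_const]
        exact ENNReal.mul_ne_top (by rw [hk]; finiteness) measure_ball_lt_top.ne)
      (Eventually.of_forall fun x => by
        have h1 := tendsto_mollify_of_weaklyTendsto φ hv x
        have h2 := ((ENNReal.continuous_pow 2).tendsto _).comp ((continuous_enorm.tendsto _).comp h1)
        rw [enorm_zero, zero_pow two_ne_zero] at h2
        exact h2)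
    simpa using this
  have hlim2 : Tendsto (fun n => 2 * ∫⁻ x in Metric.ball (0 : Sp N) R,
      ‖mollify φ (val (v n)) x‖ₑ ^ 2) atTop (𝓝 0) := by
    simpa using ENNReal.Tendsto.const_mul hlim (Or.inr (by norm_num : (2 : ℝ≥0∞) ≠ ⊤))
  filter_upwards [(ENNReal.tendsto_nhds_zero.1 hlim2) _ hε2] with n hn
  have hsub : ∫⁻ x in Metric.ball (0 : Sp N) R, ‖mollify φ (val (v n)) x - val (v n) x‖ₑ ^ 2
      ≤ ENNReal.ofReal φ.rOut ^ 2 * k ^ 2 :=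
    (setLIntegral_le_lintegral _ _).trans ((lintegral_mollify_sub_sq_le φ (memLp_val (v n))
      (memLp_grad (v n)) (isWeakGradient_val (v n))).trans (mul_le_mul' le_rfl
        ((lintegral_grad_sq_le (v n)).trans (pow_le_pow_left' (hvk n) 2))))
  calc ∫⁻ x in Metric.ball (0 : Sp N) R, ‖val (v n) x‖ₑ ^ 2
      ≤ ∫⁻ x in Metric.ball (0 : Sp N) R, 2 * (‖mollify φ (val (v n)) x - val (v n) x‖ₑ ^ 2
          + ‖mollify φ (val (v n)) x‖ₑ ^ 2) :=
        lintegral_mono fun x => enorm_sq_le_two_mul _ _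
    _ = 2 * (∫⁻ x in Metric.ball (0 : Sp N) R, ‖mollify φ (val (v n)) x - val (v n) x‖ₑ ^ 2)
        + 2 * ∫⁻ x in Metric.ball (0 : Sp N) R, ‖mollify φ (val (v n)) x‖ₑ ^ 2 := by
        rw [lintegral_const_mul' _ _ (by norm_num), lintegral_add_right', mul_add]
        exact (hcont n).aestronglyMeasurable.enorm.pow_const 2
    _ ≤ ε / 2 + ε / 2 := add_le_add ((mul_le_mul' le_rfl hsub).trans hφ) hn
    _ = ε := ENNReal.add_halves ε

/-- Rellich allows mass at most `2^(-k)` on the ball of radius `k` for the `k`-th term. The sum of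
these restricted squares is integrable, so they tend to `0` a.e.; growing balls avoid a diagonal
argument. -/
lemma exists_subseq_ae_tendsto_zero {v : ℕ → H1 N} (hv : WeaklyTendsto v 0) :
    ∃ σ : ℕ → ℕ, StrictMono σ ∧ ∀ᵐ x, Tendsto (fun n => val (v (σ n)) x) atTop (𝓝 0) := by
  have hev : ∀ k : ℕ, ∀ᶠ n in atTop,
      ∫⁻ x in Metric.ball (0 : Sp N) k, ‖val (v n) x‖ₑ ^ 2 ≤ (1 / 2) ^ k := fun k =>
    (ENNReal.tendsto_nhds_zero.1 (tendsto_lintegral_ball_of_weaklyTendsto hv k)) _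
      (ENNReal.pow_pos (by norm_num) k)
  obtain ⟨σ, hσ, hle⟩ := extraction_forall_of_eventually hev
  refine ⟨σ, hσ, ?_⟩
  set f : ℕ → Sp N → ℝ≥0∞ := fun k => (Metric.ball (0 : Sp N) k).indicator
    (fun x => ‖val (v (σ k)) x‖ₑ ^ 2) with hf
  have hfm : ∀ k, AEMeasurable (f k) volume := fun k =>
    ((memLp_val (v (σ k))).1.enorm.pow_const 2).indicator measurableSet_ball
  have hsum : ∫⁻ x, ∑' k, f k x ≠ ⊤ := by
    rw [lintegral_tsum hfm]
    refine ne_top_of_le_ne_top ?_ (ENNReal.tsum_le_tsum (g := fun k => (1 / 2 : ℝ≥0∞) ^ k)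
      fun k => ?_)
    · rw [ENNReal.tsum_geometric]
      norm_num
    · rw [lintegral_indicator measurableSet_ball]
      exact hle k
  filter_upwards [ae_lt_top' (AEMeasurable.tsum hfm) hsum] with x hx
  have h1 := ENNReal.tendsto_atTop_zero_of_tsum_ne_top hx.ne
  obtain ⟨n₀, hn₀⟩ := exists_nat_gt ‖x‖
  have h2 : Tendsto (fun n => ‖val (v (σ n)) x‖ₑ ^ 2) atTop (𝓝 0) := by
    refine h1.congr' ?_
    filter_upwards [eventually_ge_atTop n₀] with n hn
    rw [hf]
    refine Set.indicator_of_mem ?_ _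
    rw [mem_ball_zero_iff]
    exact hn₀.trans_le (by exact_mod_cast hn)
  have h3 : Tendsto (fun n => ‖val (v (σ n)) x‖ₑ) atTop (𝓝 0) := by
    have := (ENNReal.continuous_rpow_const (y := 1 / 2)).tendsto (0 : ℝ≥0∞) |>.comp h2
    rw [ENNReal.zero_rpow_of_pos (by norm_num)] at this
    refine this.congr fun n => ?_
    simp only [Function.comp]
    rw [← ENNReal.rpow_two, ← ENNReal.rpow_mul]
    norm_num
  rw [tendsto_zero_iff_norm_tendsto_zero]
  have h4 := (ENNReal.tendsto_toReal ENNReal.zero_ne_top).comp h3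
  rw [ENNReal.toReal_zero] at h4
  exact h4.congr fun n => toReal_enorm _

lemma exists_subseq_ae_tendsto {u : ℕ → H1 N} {u₀ : H1 N} (hu : WeaklyTendsto u u₀) :
    ∃ σ : ℕ → ℕ, StrictMono σ ∧ ∀ᵐ x, Tendsto (fun n => val (u (σ n)) x) atTop (𝓝 (val u₀ x)) := by
  have hv : WeaklyTendsto (fun n => u n - u₀) 0 := fun l => by
    simpa using (hu l).sub_const (l u₀)
  obtain ⟨σ, hσ, hae⟩ := exists_subseq_ae_tendsto_zero hv
  refine ⟨σ, hσ, ?_⟩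
  have hsub : ∀ᵐ x, ∀ n, val (u (σ n) - u₀) x = val (u (σ n)) x - val u₀ x :=
    ae_all_iff.2 fun n => val_sub (u (σ n)) u₀
  filter_upwards [hae, hsub] with x hx hs
  simp only [hs] at hx
  simpa using hx.add_const (val u₀ x)

lemma H1_ext {u v : H1 N} (h1 : val u =ᵐ[volume] val v) (h2 : grad u =ᵐ[volume] grad v) :
    u = v := by
  apply Subtype.ext
  have e1 : u.1.fst = v.1.fst := Lp.ext h1
  have e2 : u.1.snd = v.1.snd := Lp.ext h2
  exact WithLp.ofLp_injective 2 (Prod.ext e1 e2)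

instance : Nontrivial (H1 N) := by
  have hs : ContDiff ℝ ∞ (bump N) := (bump N).contDiff
  have hc := (bump N).hasCompactSupport
  have hgc : HasCompactSupport (gradient (bump N)) :=
    (hc.fderiv ℝ).comp_left (g := (InnerProductSpace.toDual ℝ (Sp N)).symm) (by simp)
  have hwg : IsWeakGradient (bump N) (gradient (bump N)) := by
    intro φ hφ hφc i
    simp only [gradient_apply_eq]
    refine integral_mul_fderiv_eq_neg_fderiv_mul_of_integrable ?_ ?_ ?_
      (fun x _ => hs.differentiable (by simp) x) (fun x _ => hφ.differentiable (by simp) x)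
    · exact (memLp_two_partial hs hc _).integrable_mul (q := 2)
        (memLp_two_of_continuous_compact hφ.continuous hφc)
    · exact (memLp_two_of_continuous_compact hs.continuous hc).integrable_mul (q := 2)
        (memLp_two_partial hφ hφc _)
    · exact (memLp_two_of_continuous_compact hs.continuous hc).integrable_mul (q := 2)
        (memLp_two_of_continuous_compact hφ.continuous hφc)
  obtain ⟨u, hu, -⟩ := exists_H1 (memLp_two_of_continuous_compact hs.continuous hc)
    ((continuous_gradient hs).memLp_of_hasCompactSupport hgc) hwg
  refine ⟨u, 0, fun h0 => ?_⟩
  rw [h0] at hu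
  have h1 : (bump N : Sp N → ℝ) =ᵐ[volume] fun _ => 0 := hu.symm.trans val_zero
  have h2 := (Continuous.ae_eq_iff_eq volume hs.continuous continuous_const).1 h1
  have h3 : bump N 0 = 1 := (bump N).one_of_mem_closedBall (by simp [(bump N).rIn_pos.le])
  rw [h2] at h3
  exact zero_ne_one h3

/-! ### Translations -/

lemma IsWeakGradient.translate {w : Sp N → ℝ} {G : Sp N → Sp N} (h : IsWeakGradient w G)
    (k : Sp N) : IsWeakGradient (fun x => w (x + k)) (fun x => G (x + k)) := by
  intro φ hφ hc i
  have h1 := h (fun x => φ (x - k)) (hφ.comp (contDiff_id.sub contDiff_const))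
    (hc.comp_homeomorph (Homeomorph.subRight k)) i
  rw [← integral_add_right_eq_self _ k, ← integral_add_right_eq_self (fun x => G x i * _) k] at h1
  simp only [fderiv_comp_sub, add_sub_cancel_right] at h1
  exact h1

/-- Translation on `H¹`. -/
def shiftLM (k : Sp N) : H1 N →ₗ[ℝ] H1 N where
  toFun u := ⟨WithLp.toLp 2
    (Lp.compMeasurePreservingₗᵢ ℝ _ (measurePreserving_add_right (volume : Measure (Sp N)) k)
      u.1.fst,
     Lp.compMeasurePreservingₗᵢ ℝ _ (measurePreserving_add_right (volume : Measure (Sp N)) k)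
      u.1.snd),
    ((isWeakGradient_val u).translate k).congr (Lp.coeFn_compMeasurePreserving _ _)
      (Lp.coeFn_compMeasurePreserving _ _)⟩
  map_add' u v := by
    apply Subtype.ext
    simp [WithLp.toLp_add, ← Prod.mk_add_mk, map_add]
  map_smul' c u := by
    apply Subtype.ext
    simp [← WithLp.toLp_smul, ← Prod.smul_mk, map_smul]

lemma val_shiftLM (k : Sp N) (u : H1 N) :
    val (shiftLM k u) =ᵐ[volume] fun x => val u (x + k) := Lp.coeFn_compMeasurePreserving _ _

lemma grad_shiftLM (k : Sp N) (u : H1 N) :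
    grad (shiftLM k u) =ᵐ[volume] fun x => grad u (x + k) := Lp.coeFn_compMeasurePreserving _ _

lemma shiftLM_shiftLM (k l : Sp N) (h : k + l = 0) (u : H1 N) : shiftLM k (shiftLM l u) = u := by
  have q := (measurePreserving_add_right (volume : Measure (Sp N)) k).quasiMeasurePreserving
  refine H1_ext ?_ ?_
  · filter_upwards [val_shiftLM k (shiftLM l u), q.ae (val_shiftLM l u)] with x h1 h2
    rw [h1, h2, add_assoc, h, add_zero]
  · filter_upwards [grad_shiftLM k (shiftLM l u), q.ae (grad_shiftLM l u)] with x h1 h2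
    rw [h1, h2, add_assoc, h, add_zero]

/-- Translation on `H¹`, as an isometric isomorphism. -/
def shift (k : Sp N) : H1 N ≃ₗᵢ[ℝ] H1 N where
  toLinearEquiv := LinearEquiv.ofLinearMap (shiftLM k) (shiftLM (-k))
    (LinearMap.ext fun u => shiftLM_shiftLM k (-k) (by simp) u)
    (LinearMap.ext fun u => shiftLM_shiftLM (-k) k (by simp) u)
  norm_map' u := by
    have h1 : ∀ u : H1 N, ‖u‖ ^ 2 = ‖u.1.fst‖ ^ 2 + ‖u.1.snd‖ ^ 2 :=
      fun u => WithLp.prod_norm_sq_eq_of_L2 u.1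
    have h2 : ‖shiftLM k u‖ ^ 2 = ‖u‖ ^ 2 := by
      rw [h1, h1]
      congr 2
      · exact LinearIsometry.norm_map (Lp.compMeasurePreservingₗᵢ ℝ _ _) u.1.fst
      · exact LinearIsometry.norm_map (Lp.compMeasurePreservingₗᵢ ℝ _ _) u.1.snd
    exact (sq_eq_sq₀ (norm_nonneg _) (norm_nonneg _)).1 h2

lemma val_shift (k : Sp N) (u : H1 N) : val (shift k u) =ᵐ[volume] fun x => val u (x + k) :=
  val_shiftLM k u

lemma grad_shift (k : Sp N) (u : H1 N) : grad (shift k u) =ᵐ[volume] fun x => grad u (x + k) :=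
  grad_shiftLM k u

end HamSys
end

noncomputable section

namespace HamSys

variable {N : ℕ}

/-! ### Pointwise properties of the nonlinearity -/

/-- The assumptions on `W`, apart from superquadratic growth. -/
structure Admissible (W : Sp N → Plane → ℝ) : Prop where
  base : CondW0 W
  zero : ∀ x, W x 0 = 0
  smallo : CondW1 W
  periodic : OnePeriodic W
  ineq : CondW4 W

/-- The vector with integer coordinates `k`. -/
def intVec (k : Fin N → ℤ) : Sp N := WithLp.toLp 2 fun i => (k i : ℝ)

/-- The periods of `f` form an additive subgroup, which contains the unit vectors. -/
lemma OnePeriodic.add_intVec {α : Type*} {f : Sp N → α} (hf : OnePeriodic f) (k : Fin N → ℤ)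
    (x : Sp N) : f (x + intVec k) = f x := by
  let P : AddSubgroup (Sp N) :=
    { carrier := {v | ∀ x, f (x + v) = f x}
      zero_mem' := fun x => by rw [add_zero]
      add_mem' := fun {u v} hu hv x => by rw [← add_assoc, hv, hu]
      neg_mem' := fun {u} hu x => by rw [← hu (x + -u), neg_add_cancel_right] }
  have h1 : ∀ i, (EuclideanSpace.single i (1 : ℝ) : Sp N) ∈ P := fun i x => hf i x
  have h2 : intVec k = ∑ i, k i • (EuclideanSpace.single i (1 : ℝ) : Sp N) := by
    ext j
    simp only [intVec, WithLp.ofLp_sum, WithLp.ofLp_smul, Finset.sum_apply, zsmul_eq_mul]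
    rw [Finset.sum_eq_single j]
    · simp
    · intro i _ hij
      simp [hij.symm]
    · simp
  have h3 : intVec k ∈ P := by
    rw [h2]
    exact P.sum_mem fun i _ => P.zsmul_mem (h1 i) _
  exact h3 x

/-- Take integer parts. Each coordinate error is below `1`, so `√N` would do; `N` is a convenient
larger bound. -/
lemma exists_intVec_near (x : Sp N) : ∃ k : Fin N → ℤ, ‖x - intVec k‖ ≤ N := by
  refine ⟨fun i => ⌊x i⌋, ?_⟩
  have h1 : ∀ i, ‖(x - intVec fun i => ⌊x i⌋) i‖ ≤ 1 := by
    intro i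
    have h2 : (x - intVec fun i => ⌊x i⌋) i = Int.fract (x i) := by
      simp [intVec]
    rw [h2, Real.norm_of_nonneg (Int.fract_nonneg _)]
    exact (Int.fract_lt_one _).le
  rw [EuclideanSpace.norm_eq]
  calc Real.sqrt (∑ i, ‖(x - intVec fun i => ⌊x i⌋) i‖ ^ 2) ≤ Real.sqrt ((N : ℝ) ^ 2) := by
        refine Real.sqrt_le_sqrt ?_
        calc ∑ i, ‖(x - intVec fun i => ⌊x i⌋) i‖ ^ 2 ≤ ∑ _i : Fin N, (1 : ℝ) :=
              Finset.sum_le_sum fun i _ => pow_le_one₀ (norm_nonneg _) (h1 i)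
          _ = N := by simp
          _ ≤ (N : ℝ) ^ 2 := by
            rcases Nat.eq_zero_or_pos N with h | h
            · simp [h]
            · have : (1 : ℝ) ≤ N := by exact_mod_cast h
              nlinarith
    _ = N := Real.sqrt_sq (Nat.cast_nonneg N)

variable {W : Sp N → Plane → ℝ}

namespace Admissible

lemma convex_ineq (hW : Admissible W) (x : Sp N) (z h : Plane) :
    W x z + ⟪gradient (W x) z, h⟫_ℝ ≤ W x (z + h) := by
  have := hW.ineq x 1 zero_le_one z h
  simp only [one_smul] at this
  linarith

lemma hasFDerivAt (hW : Admissible W) (x : Sp N) (z : Plane) :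
    HasFDerivAt (W x) (innerSL ℝ (gradient (W x) z)) z := by
  have h := ((hW.base.contDiff x).differentiable (by simp) z).hasGradientAt
  exact h.hasFDerivAt

/-- A differentiable function has only one candidate for a subgradient at a point. -/
lemma gradient_unique (hW : Admissible W) {x : Sp N} {z ξ : Plane}
    (h : ∀ h, W x z + ⟪ξ, h⟫_ℝ ≤ W x (z + h)) : ξ = gradient (W x) z := by
  have hmin : IsLocalMin (fun y => W x y - ⟪ξ, y⟫_ℝ) z := Eventually.of_forall fun y => by
    have h1 := h (y - z)
    rw [add_sub_cancel, inner_sub_right] at h1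
    show W x z - ⟪ξ, z⟫_ℝ ≤ W x y - ⟪ξ, y⟫_ℝ
    linarith
  have hd : HasFDerivAt (fun y => W x y - ⟪ξ, y⟫_ℝ)
      (innerSL ℝ (gradient (W x) z) - innerSL ℝ ξ) z :=
    (hW.hasFDerivAt x z).sub (innerSL ℝ ξ).hasFDerivAt
  have h0 := hmin.hasFDerivAt_eq_zero hd
  rw [← map_sub] at h0
  have h1 : gradient (W x) z - ξ = 0 := by
    rw [← norm_eq_zero, ← innerSL_apply_norm (𝕜 := ℝ), h0, norm_zero]
  exact (sub_eq_zero.1 h1).symm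

/-- Joint continuity of `W_z` is not assumed. The gradients are locally bounded, and any cluster
point satisfies the limiting subgradient inequality by continuity of `W`; hence it is the gradient.
-/
lemma continuous_gradient (hW : Admissible W) :
    Continuous fun p : Sp N × Plane => gradient (W p.1) p.2 := by
  obtain ⟨p, C₀, hp, -, hC₀, hgrow⟩ := hW.base.growth
  rw [continuous_iff_continuousAt]
  rintro ⟨x₀, z₀⟩
  have hbd : ∀ᶠ q : Sp N × Plane in 𝓝 (x₀, z₀),
      gradient (W q.1) q.2 ∈ Metric.closedBall (0 : Plane) (C₀ * (1 + (‖z₀‖ + 1) ^ (p - 1))) := by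
    have h1 : ∀ᶠ q : Sp N × Plane in 𝓝 (x₀, z₀), ‖q.2‖ < ‖z₀‖ + 1 :=
      (continuous_snd.norm.tendsto (x₀, z₀)).eventually (gt_mem_nhds (by simp))
    filter_upwards [h1] with q hq
    rw [mem_closedBall_zero_iff]
    refine (hgrow q.1 q.2).trans ?_
    have : ‖q.2‖ ^ (p - 1) ≤ (‖z₀‖ + 1) ^ (p - 1) :=
      Real.rpow_le_rpow (norm_nonneg _) hq.le (by linarith)
    gcongr
  refine (isCompact_closedBall _ _).tendsto_nhds_of_unique_mapClusterPt hbd ?_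
  intro ξ _ hξ
  obtain ⟨U, hU, hUξ⟩ := mapClusterPt_iff_ultrafilter.1 hξ
  refine hW.gradient_unique fun h => ?_
  have c1 : Tendsto (fun q : Sp N × Plane => W q.1 q.2) U (𝓝 (W x₀ z₀)) :=
    (hW.base.continuous.tendsto (x₀, z₀)).mono_left hU
  have c2 : Tendsto (fun q : Sp N × Plane => W q.1 (q.2 + h)) U (𝓝 (W x₀ (z₀ + h))) := by
    have : Continuous fun q : Sp N × Plane => W q.1 (q.2 + h) :=
      hW.base.continuous.comp (continuous_fst.prodMk (continuous_snd.add continuous_const))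
    exact (this.tendsto (x₀, z₀)).mono_left hU
  have c3 : Tendsto (fun q : Sp N × Plane => ⟪gradient (W q.1) q.2, h⟫_ℝ) U (𝓝 ⟪ξ, h⟫_ℝ) :=
    Tendsto.inner hUξ tendsto_const_nhds
  exact le_of_tendsto_of_tendsto' (c1.add c3) c2 fun q => hW.convex_ineq q.1 q.2 h

/-- Periodicity brings `x` into a compact ball, where joint continuity is uniform; radius `M + 1`
leaves room for `‖h‖ < 1`. -/
lemma exists_unif_cont (hW : Admissible W) (M : ℝ) {ε : ℝ} (hε : 0 < ε) : ∃ ρ : ℝ, 0 < ρ ∧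
    ∀ (x : Sp N) (z h : Plane), ‖z‖ ≤ M → ‖h‖ < ρ →
      ‖gradient (W x) (z + h) - gradient (W x) z‖ ≤ ε := by
  have hK : IsCompact (Metric.closedBall (0 : Sp N) N ×ˢ Metric.closedBall (0 : Plane) (M + 1)) :=
    (isCompact_closedBall _ _).prod (isCompact_closedBall _ _)
  have huc := hK.uniformContinuousOn_of_continuous hW.continuous_gradient.continuousOn
  rw [Metric.uniformContinuousOn_iff] at huc
  obtain ⟨ρ, hρ, h⟩ := huc ε hε
  refine ⟨min ρ 1, lt_min hρ one_pos, fun x z k hz hk => ?_⟩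
  obtain ⟨m, hm⟩ := exists_intVec_near x
  have hper : W x = W (x - intVec m) := by
    have := hW.periodic.add_intVec m (x - intVec m)
    rwa [sub_add_cancel] at this
  rw [hper, ← dist_eq_norm]
  have hk1 := hk.trans_le (min_le_left _ _)
  have hk2 := hk.trans_le (min_le_right _ _)
  refine (h (x - intVec m, z + k) ⟨?_, ?_⟩ (x - intVec m, z) ⟨?_, ?_⟩ ?_).le
  · simpa using hm
  · rw [mem_closedBall_zero_iff]
    exact (norm_add_le _ _).trans (by linarith)
  · simpa using hm
  · rw [mem_closedBall_zero_iff]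
    linarith
  · rw [Prod.dist_eq]
    simpa [dist_eq_norm, hρ] using hk1

end Admissible

/-- The growth function `s + s^(2^* - 1)`. -/
def growthFn (N : ℕ) (s : ℝ) : ℝ := s + s ^ (critExp N - 1)

lemma growthFn_nonneg {s : ℝ} (hs : 0 ≤ s) : 0 ≤ growthFn N s := by
  unfold growthFn
  positivity

lemma le_growthFn {s : ℝ} (hs : 0 ≤ s) : s ≤ growthFn N s := by
  unfold growthFn
  have : 0 ≤ s ^ (critExp N - 1) := by positivity
  linarith

lemma rpow_le_growthFn {s : ℝ} (hs : 0 ≤ s) : s ^ (critExp N - 1) ≤ growthFn N s := by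
  unfold growthFn
  linarith

lemma growthFn_add_le (hN : 3 ≤ N) {s t : ℝ} (hs : 0 ≤ s) (ht : 0 ≤ t) :
    growthFn N (s + t) ≤ 2 ^ (critExp N - 1) * (growthFn N s + growthFn N t) := by
  have hr := critExp_pos hN
  set r := critExp N
  have h1 : (s + t) ^ (r - 1) ≤ 2 ^ (r - 1) * (s ^ (r - 1) + t ^ (r - 1)) := by
    have h2 : (s + t) ≤ 2 * max s t := by
      rw [two_mul]; exact add_le_add (le_max_left _ _) (le_max_right _ _)
    calc (s + t) ^ (r - 1) ≤ (2 * max s t) ^ (r - 1) :=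
          Real.rpow_le_rpow (by positivity) h2 (by linarith)
      _ = 2 ^ (r - 1) * max s t ^ (r - 1) := Real.mul_rpow (by norm_num) (le_max_of_le_left hs)
      _ ≤ _ := by
        have h3 : 0 ≤ s ^ (r - 1) := by positivity
        have h4 : 0 ≤ t ^ (r - 1) := by positivity
        gcongr
        rcases max_choice s t with h | h <;> rw [h] <;> linarith
  have h5 : (1 : ℝ) ≤ 2 ^ (r - 1) := Real.one_le_rpow (by norm_num) (by linarith)
  unfold growthFn
  change s + t + (s + t) ^ (r - 1) ≤ _
  have h6 : s + t ≤ 2 ^ (r - 1) * (s + t) := le_mul_of_one_le_left (by positivity) h5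
  calc _ ≤ 2 ^ (r - 1) * (s + t) + 2 ^ (r - 1) * (s ^ (r - 1) + t ^ (r - 1)) := add_le_add h6 h1
    _ = _ := by ring

namespace Admissible

lemma exists_growth_regions (hW : Admissible W) {ε : ℝ} (hε : 0 < ε) :
    ∃ δ M C : ℝ, 0 < δ ∧ 0 < M ∧ 0 ≤ C ∧ (∀ x z, ‖z‖ < δ → ‖gradient (W x) z‖ ≤ ε * ‖z‖) ∧
      (∀ x z, M ≤ ‖z‖ → ‖gradient (W x) z‖ ≤ ε * ‖z‖ ^ (critExp N - 1)) ∧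
      (∀ x z, ‖z‖ ≤ M → ‖gradient (W x) z‖ ≤ C) := by
  obtain ⟨p, C₀, hp, hpr, hC₀, hgrow⟩ := hW.base.growth
  obtain ⟨δ, hδ, hsm⟩ := hW.smallo ε hε
  have hr : 0 < critExp N - p := by unfold critExp; linarith
  -- For `‖z‖ ≥ 1` the bound `C₀ (1 + ‖z‖^(p-1))` is at most `2 C₀ ‖z‖^(p-1)`, and the gap `critExp
  -- N - p > 0` absorbs `2 C₀ / ε`.
  obtain ⟨M, hM⟩ := (((tendsto_rpow_atTop hr).eventually_ge_atTop (2 * C₀ / ε)).and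
    (eventually_ge_atTop 1)).exists_forall_of_atTop
  refine ⟨δ, max M 1, C₀ * (1 + (max M 1) ^ (p - 1)), hδ, by positivity, by positivity, hsm,
    fun x z hz => ?_, fun x z hz => ?_⟩
  · obtain ⟨h1, h2⟩ := hM ‖z‖ ((le_max_left _ _).trans hz)
    refine (hgrow x z).trans ?_
    have h3 : 1 ≤ ‖z‖ ^ (p - 1) := Real.one_le_rpow h2 (by linarith)
    have h4 : ‖z‖ ^ (critExp N - 1) = ‖z‖ ^ (critExp N - p) * ‖z‖ ^ (p - 1) := by
      rw [← Real.rpow_add (by linarith)]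
      congr 1
      ring
    rw [div_le_iff₀ hε] at h1
    rw [h4]
    calc C₀ * (1 + ‖z‖ ^ (p - 1)) ≤ C₀ * (‖z‖ ^ (p - 1) + ‖z‖ ^ (p - 1)) := by gcongr
      _ = 2 * C₀ * ‖z‖ ^ (p - 1) := by ring
      _ ≤ ‖z‖ ^ (critExp N - p) * ε * ‖z‖ ^ (p - 1) := by gcongr
      _ = _ := by ring
  · refine (hgrow x z).trans ?_
    have : ‖z‖ ^ (p - 1) ≤ (max M 1) ^ (p - 1) :=
      Real.rpow_le_rpow (norm_nonneg _) hz (by linarith)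
    gcongr

/-- Only the middle range of `‖z‖` is not small relative to `growthFn`. There `‖z‖ ≥ δ`, so any
power `e` can carry the constant; `0`, `midExp N - 1` and `critExp N - 1` are used. -/
lemma exists_growth_rpow (hW : Admissible W) {ε : ℝ} (hε : 0 < ε) {e : ℝ}
    (he : 0 ≤ e) : ∃ C : ℝ, 0 ≤ C ∧
      ∀ x z, ‖gradient (W x) z‖ ≤ ε * growthFn N ‖z‖ + C * ‖z‖ ^ e := by
  obtain ⟨δ, M, C, hδ, hM, hC, h1, h2, h3⟩ := hW.exists_growth_regions hε
  refine ⟨C / δ ^ e, by positivity, fun x z => ?_⟩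
  have h0 : 0 ≤ C / δ ^ e * ‖z‖ ^ e := by positivity
  have hs := norm_nonneg z
  rcases lt_or_ge ‖z‖ δ with hz | hz
  · have := mul_le_mul_of_nonneg_left (le_growthFn (N := N) hs) hε.le
    linarith [h1 x z hz]
  · rcases le_total M ‖z‖ with hz' | hz'
    · have := mul_le_mul_of_nonneg_left (rpow_le_growthFn (N := N) hs) hε.le
      linarith [h2 x z hz']
    · have h4 : C ≤ C / δ ^ e * ‖z‖ ^ e := by
        rw [div_mul_eq_mul_div, le_div_iff₀ (by positivity)]
        exact mul_le_mul_of_nonneg_left (Real.rpow_le_rpow hδ.le hz he) hC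
      have h5 := mul_nonneg hε.le (growthFn_nonneg (N := N) hs)
      linarith [h3 x z hz']

lemma exists_growth_crit (hN : 3 ≤ N) (hW : Admissible W) {ε : ℝ} (hε : 0 < ε) :
    ∃ C : ℝ, 0 ≤ C ∧ ∀ x z, ‖gradient (W x) z‖ ≤ ε * ‖z‖ + C * ‖z‖ ^ (critExp N - 1) := by
  obtain ⟨C, hC, h⟩ := hW.exists_growth_rpow hε (e := critExp N - 1)
    (by linarith [critExp_pos hN])
  refine ⟨ε + C, by positivity, fun x z => (h x z).trans (le_of_eq ?_)⟩
  unfold growthFn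
  ring

lemma exists_growth (hN : 3 ≤ N) (hW : Admissible W) :
    ∃ C : ℝ, 0 < C ∧ ∀ x z, ‖gradient (W x) z‖ ≤ C * growthFn N ‖z‖ := by
  obtain ⟨C, hC, h⟩ := hW.exists_growth_crit hN one_pos
  refine ⟨1 + C, by positivity, fun x z => (h x z).trans ?_⟩
  have h1 := le_growthFn (N := N) (norm_nonneg z)
  have h2 := mul_le_mul_of_nonneg_left (rpow_le_growthFn (N := N) (norm_nonneg z)) hC
  linarith

/-- For `h` not small, `C * growthFn N ‖h‖` absorbs every constant. For small `h` there are three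
ranges of `z`: near zero and near infinity both gradients are small relative to `growthFn`, and in
between uniform continuity applies. -/
lemma exists_gradient_sub_le (hN : 3 ≤ N) (hW : Admissible W) {ε : ℝ} (hε : 0 < ε) :
    ∃ C : ℝ, 0 ≤ C ∧ ∀ x z h, ‖gradient (W x) (z + h) - gradient (W x) z‖ ≤
      ε * growthFn N ‖z‖ + C * growthFn N ‖h‖ := by
  set c : ℝ := 2 ^ (critExp N - 1) with hc
  have hc1 : 1 ≤ c := Real.one_le_rpow (by norm_num) (by linarith [critExp_pos hN])
  set e := ε / (c + 1) with he
  have hepos : 0 < e := by positivity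
  have hece : e * (c + 1) = ε := by rw [he]; field_simp
  obtain ⟨δ, M, C, hδ, hM, hC, h1, h2, h3⟩ := hW.exists_growth_regions hepos
  obtain ⟨C', hC', h4⟩ := hW.exists_growth_rpow hepos (e := 0) le_rfl
  -- This is used only for `‖z‖ ≥ δ / 2`, where an error `e * (δ / 2)` is at most `e * ‖z‖`.
  obtain ⟨ρ, hρ, h5⟩ := hW.exists_unif_cont (M + 1) (ε := e * (δ / 2)) (by positivity)
  set ρ' := min ρ (min (δ / 2) 1) with hρ'
  have hρ'pos : 0 < ρ' := by positivity
  refine ⟨e * c + 2 * C' / ρ', by positivity, fun x z h => ?_⟩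
  have hs := norm_nonneg z
  have ht := norm_nonneg h
  have hgs := growthFn_nonneg (N := N) hs
  have hgt := growthFn_nonneg (N := N) ht
  have hsle := le_growthFn (N := N) hs
  have htle := le_growthFn (N := N) ht
  have hadd : growthFn N ‖z + h‖ ≤ c * (growthFn N ‖z‖ + growthFn N ‖h‖) := by
    refine le_trans ?_ (growthFn_add_le hN hs ht)
    have := norm_add_le z h
    have := critExp_pos hN
    unfold growthFn
    gcongr
    linarith
  have hrest : 0 ≤ 2 * C' / ρ' * growthFn N ‖h‖ := by positivity
  have htri := norm_sub_le (gradient (W x) (z + h)) (gradient (W x) z)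
  have hadd' := mul_le_mul_of_nonneg_left hadd hepos.le
  have expand : ε * growthFn N ‖z‖ + (e * c + 2 * C' / ρ') * growthFn N ‖h‖
      = e * (c * (growthFn N ‖z‖ + growthFn N ‖h‖)) + e * growthFn N ‖z‖
        + 2 * C' / ρ' * growthFn N ‖h‖ := by
    rw [← hece]; ring
  have hleft : 0 ≤ e * (c * (growthFn N ‖z‖ + growthFn N ‖h‖)) := by positivity
  have hez : e * ‖z‖ ≤ e * growthFn N ‖z‖ := mul_le_mul_of_nonneg_left hsle hepos.le
  rw [expand]
  rcases le_or_gt ρ' ‖h‖ with hh | hh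
  · have h6 := h4 x (z + h)
    have h7 := h4 x z
    simp only [Real.rpow_zero, mul_one] at h6 h7
    have h8 : 2 * C' ≤ 2 * C' / ρ' * growthFn N ‖h‖ := by
      rw [div_mul_eq_mul_div, le_div_iff₀ hρ'pos]
      exact mul_le_mul_of_nonneg_left (hh.trans htle) (by positivity)
    linarith
  · have hh1 : ‖h‖ < ρ := hh.trans_le (min_le_left _ _)
    have hh2 : ‖h‖ < δ / 2 := hh.trans_le ((min_le_right _ _).trans (min_le_left _ _))
    have hh3 : ‖h‖ < 1 := hh.trans_le ((min_le_right _ _).trans (min_le_right _ _))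
    rcases lt_or_ge ‖z‖ (δ / 2) with hz | hz
    · have h6 := h1 x z (by linarith)
      have h7 := h1 x (z + h) ((norm_add_le _ _).trans_lt (by linarith))
      have h8 := mul_le_mul_of_nonneg_left (le_growthFn (N := N) (norm_nonneg (z + h))) hepos.le
      linarith
    · rcases le_total ‖z‖ (M + 1) with hz' | hz'
      · have h6 := h5 x z h hz' hh1
        have h7 := mul_le_mul_of_nonneg_left hz hepos.le
        linarith
      · have h6 := h2 x z (by linarith)
        have h7 := h2 x (z + h) (by
          have := norm_sub_norm_le z (-h)
          rw [norm_neg, sub_neg_eq_add] at this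
          linarith)
        have h8 := mul_le_mul_of_nonneg_left (rpow_le_growthFn (N := N) (norm_nonneg (z + h)))
          hepos.le
        have h9 := mul_le_mul_of_nonneg_left (rpow_le_growthFn (N := N) hs) hepos.le
        linarith

/-- Convexity compared with the value `W x 0 = 0`. -/
lemma le_gradient_mul (hW : Admissible W) (x : Sp N) (z : Plane) :
    W x z ≤ ‖gradient (W x) z‖ * ‖z‖ := by
  have h := hW.convex_ineq x z (-z)
  rw [add_neg_cancel, hW.zero, inner_neg_right] at h
  have := real_inner_le_norm (gradient (W x) z) z
  linarith

/-- The monotonicity inequality at `θ = 0`, `ζ = 0`. -/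
lemma half_inner_sub_nonneg (hW : Admissible W) (x : Sp N) (z : Plane) :
    0 ≤ 1 / 2 * ⟪gradient (W x) z, z⟫_ℝ - W x z := by
  have h := hW.ineq x 0 le_rfl z 0
  simp only [zero_smul, add_zero, hW.zero, inner_zero_right] at h
  linarith

end Admissible

end HamSys
end

noncomputable section

namespace HamSys

variable {N : ℕ} {W : Sp N → Plane → ℝ}

/-! ### Integrability of vector-valued `H¹` functions -/

lemma vec_eq (z : E N) (x : Sp N) : vec z x =
    val z.fst x • EuclideanSpace.single (0 : Fin 2) (1 : ℝ)
      + val z.snd x • EuclideanSpace.single (1 : Fin 2) (1 : ℝ) := by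
  ext i
  fin_cases i <;> simp [vec]

lemma vec_congr {z : E N} {x : Sp N} {u v : ℝ} (h1 : val z.fst x = u) (h2 : val z.snd x = v) :
    vec z x = !₂[u, v] := by rw [vec, h1, h2]

lemma vec_add (z h : E N) : vec (z + h) =ᵐ[volume] fun x => vec z x + vec h x := by
  filter_upwards [val_add z.fst h.fst, val_add z.snd h.snd] with x h1 h2
  simp only [vec_eq, WithLp.add_fst, WithLp.add_snd, h1, h2, add_smul]
  abel

lemma vec_smul (c : ℝ) (z : E N) : vec (c • z) =ᵐ[volume] fun x => c • vec z x := by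
  filter_upwards [val_smul c z.fst, val_smul c z.snd] with x h1 h2
  simp only [vec_eq, WithLp.smul_fst, WithLp.smul_snd, h1, h2, smul_add, smul_smul]

lemma aestronglyMeasurable_vec (z : E N) : AEStronglyMeasurable (vec z) volume := by
  have h : vec z = fun x => val z.fst x • EuclideanSpace.single (0 : Fin 2) (1 : ℝ)
      + val z.snd x • EuclideanSpace.single (1 : Fin 2) (1 : ℝ) := funext (vec_eq z)
  rw [h]
  exact ((memLp_val z.fst).1.smul_const _).add ((memLp_val z.snd).1.smul_const _)

lemma eLpNorm_vec_le {p : ℝ≥0∞} (hp : 1 ≤ p) (z : E N) :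
    eLpNorm (vec z) p volume ≤ eLpNorm (val z.fst) p volume + eLpNorm (val z.snd) p volume := by
  have h : vec z = (fun x => val z.fst x • EuclideanSpace.single (0 : Fin 2) (1 : ℝ))
      + (fun x => val z.snd x • EuclideanSpace.single (1 : Fin 2) (1 : ℝ)) := funext (vec_eq z)
  rw [h]
  refine (eLpNorm_add_le ((memLp_val z.fst).1.smul_const _) ((memLp_val z.snd).1.smul_const _)
    hp).trans (le_of_eq ?_)
  congr 1 <;> exact eLpNorm_congr_norm_ae (Eventually.of_forall fun x => by simp [norm_smul])

/-- `S` is a constant for the embeddings of `H¹` into `L²` and into `L^(2^*)`. -/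
def IsEmbeddingConst (N : ℕ) (S : ℝ) : Prop :=
  0 < S ∧ ∀ s : ℝ, s = 2 ∨ s = critExp N → ∀ z : E N,
    MemLp (vec z) (ENNReal.ofReal s) volume ∧
      (eLpNorm (vec z) (ENNReal.ofReal s) volume).toReal ≤ S * ‖z‖

lemma exists_isEmbeddingConst (hN : 3 ≤ N) : ∃ S, IsEmbeddingConst N S := by
  obtain ⟨C, hC⟩ := exists_sobolev hN
  have hr := critExp_pos hN
  refine ⟨2 * (C + 1), by positivity, fun s hs z => ?_⟩
  have h1 : ∀ u : H1 N, eLpNorm (val u) (ENNReal.ofReal s) volume ≤ (C + 1) * ‖u‖ₑ := by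
    intro u
    rcases hs with rfl | rfl
    · rw [ENNReal.ofReal_ofNat]
      exact (eLpNorm_val_le u).trans (le_mul_of_one_le_left' (by simp))
    · exact (hC u).trans (mul_le_mul' le_self_add le_rfl)
  have hs1 : 1 ≤ ENNReal.ofReal s := by
    rw [ENNReal.one_le_ofReal]
    rcases hs with rfl | rfl <;> linarith
  have h2 : eLpNorm (vec z) (ENNReal.ofReal s) volume ≤ ENNReal.ofReal (2 * (C + 1) * ‖z‖) := by
    refine (eLpNorm_vec_le hs1 z).trans ((add_le_add (h1 _) (h1 _)).trans ?_)
    have e1 : ‖z.fst‖ₑ ≤ ENNReal.ofReal ‖z‖ := by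
      rw [← ofReal_norm]; exact ENNReal.ofReal_le_ofReal (WithLp.norm_fst_le (x := z))
    have e2 : ‖z.snd‖ₑ ≤ ENNReal.ofReal ‖z‖ := by
      rw [← ofReal_norm]; exact ENNReal.ofReal_le_ofReal (WithLp.norm_snd_le (x := z))
    calc (C + 1 : ℝ≥0∞) * ‖z.fst‖ₑ + (C + 1) * ‖z.snd‖ₑ
        ≤ (C + 1) * ENNReal.ofReal ‖z‖ + (C + 1) * ENNReal.ofReal ‖z‖ := by gcongr
      _ = ENNReal.ofReal (2 * (C + 1) * ‖z‖) := by
        rw [ENNReal.ofReal_mul (by positivity), ENNReal.ofReal_mul (by norm_num),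
          ENNReal.ofReal_add (by positivity) (by norm_num)]
        simp only [ENNReal.ofReal_ofNat, ENNReal.ofReal_coe_nnreal, ENNReal.ofReal_one]
        ring
  exact ⟨⟨aestronglyMeasurable_vec z, h2.trans_lt ENNReal.ofReal_lt_top⟩,
    ENNReal.toReal_le_of_le_ofReal (by positivity) h2⟩

lemma integral_sub_sub {α : Type*} [MeasurableSpace α] {μ : Measure α} {f g h : α → ℝ}
    (hf : Integrable f μ) (hg : Integrable g μ) (hh : Integrable h μ) :
    ∫ x, (f x - g x - h x) ∂μ = ∫ x, f x ∂μ - ∫ x, g x ∂μ - ∫ x, h x ∂μ := by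
  rw [← integral_sub hf hg]
  exact integral_sub (hf.sub hg) hh

lemma integral_mul_sub_mul_add_sub {α : Type*} [MeasurableSpace α] {μ : Measure α}
    {f g h k : α → ℝ} (c d : ℝ)
    (hf : Integrable f μ) (hg : Integrable g μ) (hh : Integrable h μ) (hk : Integrable k μ) :
    ∫ x, (c * f x - d * g x + h x - k x) ∂μ =
      c * ∫ x, f x ∂μ - d * ∫ x, g x ∂μ + ∫ x, h x ∂μ - ∫ x, k x ∂μ := by
  have hc := hf.const_mul c
  have hd := hg.const_mul d
  rw [← integral_const_mul, ← integral_const_mul, ← integral_sub hc hd]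
  have e := integral_add (hc.sub hd) hh
  have e2 := integral_sub ((hc.sub hd).add hh) hk
  simp only [Pi.sub_apply, Pi.add_apply] at e e2
  rw [e2, e]

lemma toReal_eLpNorm_ofReal {α G : Type*} [MeasurableSpace α] {μ : Measure α}
    [NormedAddCommGroup G] {k : α → G} {s : ℝ} (hs : 0 < s) (hk : MemLp k (ENNReal.ofReal s) μ) :
    (eLpNorm k (ENNReal.ofReal s) μ).toReal = (∫ x, ‖k x‖ ^ s ∂μ) ^ (1 / s) := by
  rw [hk.eLpNorm_eq_integral_rpow_norm (by simpa using hs) ENNReal.ofReal_ne_top,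
    ENNReal.toReal_ofReal hs.le, ENNReal.toReal_ofReal (by positivity), one_div]

lemma holder_rpow {α F F' : Type*} [MeasurableSpace α] {μ : Measure α} [NormedAddCommGroup F]
    [NormedAddCommGroup F'] {f : α → F} {g : α → F'} {s : ℝ} (hs : 1 < s)
    (hf : MemLp f (ENNReal.ofReal s) μ) (hg : MemLp g (ENNReal.ofReal s) μ) :
    Integrable (fun x => ‖f x‖ ^ (s - 1) * ‖g x‖) μ ∧
    ∫ x, ‖f x‖ ^ (s - 1) * ‖g x‖ ∂μ ≤
      (eLpNorm f (ENNReal.ofReal s) μ).toReal ^ (s - 1) *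
        (eLpNorm g (ENNReal.ofReal s) μ).toReal := by
  have hs1 : 0 < s - 1 := by linarith
  have hs0 : 0 < s := by linarith
  have hconj : (s / (s - 1)).HolderConjugate s := by
    rw [Real.holderConjugate_iff]
    refine ⟨by rw [lt_div_iff₀ hs1]; linarith, ?_⟩
    field_simp
    ring
  have hf' : MemLp (fun x => ‖f x‖ ^ (s - 1)) (ENNReal.ofReal (s / (s - 1))) μ := by
    have := hf.norm_rpow_div (ENNReal.ofReal (s - 1))
    rwa [ENNReal.toReal_ofReal hs1.le, ← ENNReal.ofReal_div_of_pos hs1] at this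
  refine ⟨?_, ?_⟩
  · have : (ENNReal.ofReal (s / (s - 1))).HolderConjugate (ENNReal.ofReal s) :=
      ⟨by rw [← ENNReal.ofReal_inv_of_pos (by positivity), ← ENNReal.ofReal_inv_of_pos hs0,
        ← ENNReal.ofReal_add (by positivity) (by positivity), hconj.inv_add_inv_eq_one]; simp⟩
    exact hf'.integrable_mul hg.norm
  · have h := integral_mul_le_Lp_mul_Lq_of_nonneg hconj (μ := μ) (f := fun x => ‖f x‖ ^ (s - 1))
      (g := fun x => ‖g x‖) (Eventually.of_forall fun x => by positivity)
      (Eventually.of_forall fun x => norm_nonneg _) hf' hg.norm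
    refine h.trans (le_of_eq ?_)
    rw [toReal_eLpNorm_ofReal hs0 hf, toReal_eLpNorm_ofReal hs0 hg]
    congr 1
    have e : ∀ x, (‖f x‖ ^ (s - 1)) ^ (s / (s - 1)) = ‖f x‖ ^ s := fun x => by
      rw [← Real.rpow_mul (norm_nonneg _)]
      congr 1
      field_simp
    simp_rw [e]
    rw [← Real.rpow_mul (by positivity)]
    congr 1
    field_simp

/-- The bound for `∫ growthFn |z| |h|` in terms of the norm of `z`. -/
def growthBound (N : ℕ) (S t : ℝ) : ℝ := S * (S * t) + S * (S * t) ^ (critExp N - 1)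

lemma growthBound_nonneg {S t : ℝ} (hS : 0 ≤ S) (ht : 0 ≤ t) : 0 ≤ growthBound N S t := by
  unfold growthBound
  positivity

lemma integral_rpow_vec_le {S s : ℝ} (hS : IsEmbeddingConst N S) (hs : s = 2 ∨ s = critExp N)
    (hs1 : 1 < s) (z h : E N) :
    Integrable (fun x => ‖vec z x‖ ^ (s - 1) * ‖vec h x‖) ∧
    ∫ x, ‖vec z x‖ ^ (s - 1) * ‖vec h x‖ ≤ S * (S * ‖z‖) ^ (s - 1) * ‖h‖ := by
  obtain ⟨h1, h2⟩ := holder_rpow hs1 (hS.2 s hs z).1 (hS.2 s hs h).1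
  refine ⟨h1, h2.trans ?_⟩
  have hS0 := hS.1
  calc _ ≤ (S * ‖z‖) ^ (s - 1) * (S * ‖h‖) :=
        mul_le_mul (Real.rpow_le_rpow ENNReal.toReal_nonneg (hS.2 s hs z).2 (by linarith))
          (hS.2 s hs h).2 ENNReal.toReal_nonneg (by positivity)
    _ = _ := by ring

lemma integral_growthFn_le (hN : 3 ≤ N) {S : ℝ} (hS : IsEmbeddingConst N S) (z h : E N) :
    Integrable (fun x => growthFn N ‖vec z x‖ * ‖vec h x‖) ∧
    ∫ x, growthFn N ‖vec z x‖ * ‖vec h x‖ ≤ growthBound N S ‖z‖ * ‖h‖ := by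
  obtain ⟨h1, h2⟩ := integral_rpow_vec_le hS (Or.inl rfl) one_lt_two z h
  obtain ⟨h3, h4⟩ := integral_rpow_vec_le hS (Or.inr rfl) (by linarith [critExp_pos hN]) z h
  norm_num at h1 h2
  have e : (fun x => growthFn N ‖vec z x‖ * ‖vec h x‖) = fun x =>
      ‖vec z x‖ * ‖vec h x‖ + ‖vec z x‖ ^ (critExp N - 1) * ‖vec h x‖ := by
    funext x
    rw [growthFn, add_mul]
  rw [e]
  refine ⟨h1.add h3, ?_⟩
  rw [integral_add h1 h3, growthBound, add_mul]
  exact add_le_add h2 h4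

/-! ### The nonlinear part of the functional -/

/-- The functional `∫ W(x, z(x)) dx`. -/
def nonlin (W : Sp N → Plane → ℝ) (z : E N) : ℝ := ∫ x, W x (vec z x)

namespace Admissible

lemma aestronglyMeasurable_comp (hW : Admissible W) {z : Sp N → Plane}
    (hz : AEStronglyMeasurable z volume) : AEStronglyMeasurable (fun x => W x (z x)) volume :=
  hW.base.continuous.comp_aestronglyMeasurable
    (continuous_id.aestronglyMeasurable.prodMk hz)

lemma aestronglyMeasurable_gradient (hW : Admissible W) {z : Sp N → Plane}
    (hz : AEStronglyMeasurable z volume) :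
    AEStronglyMeasurable (fun x => gradient (W x) (z x)) volume :=
  hW.continuous_gradient.comp_aestronglyMeasurable
    (continuous_id.aestronglyMeasurable.prodMk hz)

lemma integrable_norm_gradient_mul (hN : 3 ≤ N) (hW : Admissible W) (z h : E N) :
    Integrable (fun x => ‖gradient (W x) (vec z x)‖ * ‖vec h x‖) := by
  obtain ⟨S, hS⟩ := exists_isEmbeddingConst hN
  obtain ⟨C, hC, hg⟩ := hW.exists_growth hN
  refine ((integral_growthFn_le hN hS z h).1.const_mul C).mono'
    ((hW.aestronglyMeasurable_gradient (aestronglyMeasurable_vec z)).norm.mul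
      (aestronglyMeasurable_vec h).norm) (Eventually.of_forall fun x => ?_)
  rw [Real.norm_of_nonneg (by positivity), ← mul_assoc]
  exact mul_le_mul_of_nonneg_right (hg x _) (norm_nonneg _)

lemma integrable_inner_gradient (hN : 3 ≤ N) (hW : Admissible W) (z h : E N) :
    Integrable (fun x => ⟪gradient (W x) (vec z x), vec h x⟫_ℝ) :=
  (hW.integrable_norm_gradient_mul hN z h).mono'
    ((hW.aestronglyMeasurable_gradient (aestronglyMeasurable_vec z)).inner
      (aestronglyMeasurable_vec h)) (Eventually.of_forall fun _ => norm_inner_le_norm _ _)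

lemma integrable_comp (hN : 3 ≤ N) (hW : Admissible W) (z : E N) :
    Integrable (fun x => W x (vec z x)) :=
  (hW.integrable_norm_gradient_mul hN z z).mono'
    (hW.aestronglyMeasurable_comp (aestronglyMeasurable_vec z)) (Eventually.of_forall fun x => by
      rw [Real.norm_of_nonneg (hW.base.nonneg _ _)]
      exact hW.le_gradient_mul _ _)

lemma integral_inner_gradient_add (hN : 3 ≤ N) (hW : Admissible W) (z h k : E N) :
    ∫ x, ⟪gradient (W x) (vec z x), vec (h + k) x⟫_ℝ =
      (∫ x, ⟪gradient (W x) (vec z x), vec h x⟫_ℝ)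
        + ∫ x, ⟪gradient (W x) (vec z x), vec k x⟫_ℝ := by
  rw [← integral_add (hW.integrable_inner_gradient hN z h) (hW.integrable_inner_gradient hN z k)]
  refine integral_congr_ae ?_
  filter_upwards [vec_add h k] with x hx
  rw [hx, inner_add_right]

lemma integral_inner_gradient_smul (W : Sp N → Plane → ℝ) (z : E N) (c : ℝ) (h : E N) :
    ∫ x, ⟪gradient (W x) (vec z x), vec (c • h) x⟫_ℝ =
      c * ∫ x, ⟪gradient (W x) (vec z x), vec h x⟫_ℝ := by
  rw [← integral_const_mul]
  refine integral_congr_ae ?_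
  filter_upwards [vec_smul c h] with x hx
  rw [hx, inner_smul_right]

lemma exists_norm_integral_inner_gradient_le (hN : 3 ≤ N) (hW : Admissible W) (z : E N) :
    ∃ C : ℝ, ∀ h : E N, ‖∫ x, ⟪gradient (W x) (vec z x), vec h x⟫_ℝ‖ ≤ C * ‖h‖ := by
  obtain ⟨S, hS⟩ := exists_isEmbeddingConst hN
  obtain ⟨C, hC, hg⟩ := hW.exists_growth hN
  refine ⟨C * growthBound N S ‖z‖, fun h => ?_⟩
  obtain ⟨h1, h2⟩ := integral_growthFn_le hN hS z h
  have h3 : ‖∫ x, ⟪gradient (W x) (vec z x), vec h x⟫_ℝ‖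
      ≤ ∫ x, C * (growthFn N ‖vec z x‖ * ‖vec h x‖) := by
    refine norm_integral_le_of_norm_le (h1.const_mul C) (Eventually.of_forall fun x => ?_)
    refine (norm_inner_le_norm _ _).trans ?_
    rw [← mul_assoc]
    exact mul_le_mul_of_nonneg_right (hg x _) (norm_nonneg _)
  rw [integral_const_mul] at h3
  refine h3.trans ?_
  rw [mul_assoc]
  exact mul_le_mul_of_nonneg_left h2 hC.le

/-- The linear form `h ↦ ∫ W_z(x, z(x)) · h(x) dx`. -/
def derivLinear (hN : 3 ≤ N) (hW : Admissible W) (z : E N) : E N →ₗ[ℝ] ℝ where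
  toFun h := ∫ x, ⟪gradient (W x) (vec z x), vec h x⟫_ℝ
  map_add' := hW.integral_inner_gradient_add hN z
  map_smul' := integral_inner_gradient_smul W z

/-- The derivative `h ↦ ∫ W_z(x, z(x)) · h(x) dx` of the nonlinear part. -/
def deriv (hN : 3 ≤ N) (hW : Admissible W) (z : E N) : E N →L[ℝ] ℝ :=
  (hW.derivLinear hN z).mkContinuousOfExistsBound
    (hW.exists_norm_integral_inner_gradient_le hN z)

lemma deriv_apply (hN : 3 ≤ N) (hW : Admissible W) (z h : E N) :
    hW.deriv hN z h = ∫ x, ⟪gradient (W x) (vec z x), vec h x⟫_ℝ := rfl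

set_option maxHeartbeats 1000000 in
-- By convexity the remainder `W(z + h) - W(z) - W_z(z) · h` lies between `0` and `(W_z(z + h) -
-- W_z(z)) · h`, so `exists_gradient_sub_le` and Hölder give `o(‖h‖)`.
lemma hasFDerivAt_nonlin (hN : 3 ≤ N) (hW : Admissible W) (z : E N) :
    HasFDerivAt (nonlin W) (hW.deriv hN z) z := by
  obtain ⟨S, hS⟩ := exists_isEmbeddingConst hN
  have hr := critExp_pos hN
  rw [hasFDerivAt_iff_isLittleO_nhds_zero, Asymptotics.isLittleO_iff]
  intro c hc
  set B := growthBound N S ‖z‖ with hB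
  have hB0 : 0 ≤ B := growthBound_nonneg hS.1.le (norm_nonneg _)
  obtain ⟨C, hC, hg⟩ := hW.exists_gradient_sub_le hN (ε := c / (2 * (B + 1))) (by positivity)
  have hlim : Tendsto (fun h : E N => C * growthBound N S ‖h‖) (𝓝 0) (𝓝 0) := by
    have h1 : Continuous fun h : E N => C * growthBound N S ‖h‖ := by
      unfold growthBound
      refine continuous_const.mul (Continuous.add (by fun_prop) ?_)
      refine continuous_const.mul (Continuous.rpow_const (by fun_prop) fun _ => Or.inr ?_)
      linarith
    have h2 := h1.tendsto 0
    have h3 : C * growthBound N S ‖(0 : E N)‖ = 0 := by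
      simp [growthBound, Real.zero_rpow (show critExp N - 1 ≠ 0 by linarith)]
    rwa [h3] at h2
  filter_upwards [hlim.eventually (gt_mem_nhds (half_pos hc))] with h hh
  obtain ⟨i1, b1⟩ := integral_growthFn_le hN hS z h
  obtain ⟨i2, b2⟩ := integral_growthFn_le hN hS h h
  have e1 : nonlin W (z + h) - nonlin W z - hW.deriv hN z h =
      ∫ x, (W x (vec (z + h) x) - W x (vec z x) - ⟪gradient (W x) (vec z x), vec h x⟫_ℝ) := by
    rw [integral_sub_sub (hW.integrable_comp hN _) (hW.integrable_comp hN _)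
      (hW.integrable_inner_gradient hN z h), nonlin, nonlin, deriv_apply]
  rw [e1]
  calc ‖∫ x, (W x (vec (z + h) x) - W x (vec z x) - ⟪gradient (W x) (vec z x), vec h x⟫_ℝ)‖
      ≤ ∫ x, (c / (2 * (B + 1)) * (growthFn N ‖vec z x‖ * ‖vec h x‖)
        + C * (growthFn N ‖vec h x‖ * ‖vec h x‖)) := by
        refine norm_integral_le_of_norm_le ((i1.const_mul _).add (i2.const_mul _)) ?_
        filter_upwards [vec_add z h] with x hx
        rw [hx]
        have c1 := hW.convex_ineq x (vec z x) (vec h x)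
        have c2 := hW.convex_ineq x (vec z x + vec h x) (-vec h x)
        rw [add_neg_cancel_right, inner_neg_right] at c2
        rw [Real.norm_of_nonneg (by linarith)]
        have c3 := real_inner_le_norm
          (gradient (W x) (vec z x + vec h x) - gradient (W x) (vec z x)) (vec h x)
        rw [inner_sub_left] at c3
        have c4 := mul_le_mul_of_nonneg_right (hg x (vec z x) (vec h x)) (norm_nonneg (vec h x))
        linarith
    _ ≤ c / (2 * (B + 1)) * (B * ‖h‖) + C * (growthBound N S ‖h‖ * ‖h‖) := by
        rw [integral_add (i1.const_mul _) (i2.const_mul _), integral_const_mul, integral_const_mul]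
        gcongr
    _ ≤ c / 2 * ‖h‖ + c / 2 * ‖h‖ := by
        refine add_le_add ?_ ?_
        · rw [← mul_assoc]
          refine mul_le_mul_of_nonneg_right ?_ (norm_nonneg _)
          rw [div_mul_eq_mul_div, div_le_div_iff₀ (by positivity) (by norm_num)]
          nlinarith
        · rw [← mul_assoc]
          exact mul_le_mul_of_nonneg_right hh.le (norm_nonneg _)
    _ = c * ‖h‖ := by ring

lemma nonlin_nonneg (hW : Admissible W) (z : E N) : 0 ≤ nonlin W z :=
  integral_nonneg fun _ => hW.base.nonneg _ _

lemma nonlin_zero (hW : Admissible W) : nonlin W (0 : E N) = 0 := by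
  have h : ∀ᵐ x, W x (vec (0 : E N) x) = 0 := by
    have h0 := vec_smul (0 : ℝ) (0 : E N)
    rw [zero_smul] at h0
    filter_upwards [h0] with x hx
    rw [hx, zero_smul, hW.zero]
  unfold nonlin
  rw [integral_congr_ae h]
  simp

lemma nonlin_ineq (hN : 3 ≤ N) (hW : Admissible W) {θ : ℝ} (hθ : 0 ≤ θ) (z ζ : E N) :
    0 ≤ (1 - θ ^ 2) / 2 * hW.deriv hN z z - θ * hW.deriv hN z ζ + nonlin W (θ • z + ζ)
      - nonlin W z := by
  have i1 := hW.integrable_inner_gradient hN z z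
  have i2 := hW.integrable_inner_gradient hN z ζ
  have i3 := hW.integrable_comp hN (θ • z + ζ)
  have i4 := hW.integrable_comp hN z
  have e : (1 - θ ^ 2) / 2 * hW.deriv hN z z - θ * hW.deriv hN z ζ + nonlin W (θ • z + ζ)
      - nonlin W z = ∫ x, ((1 - θ ^ 2) / 2 * ⟪gradient (W x) (vec z x), vec z x⟫_ℝ
        - θ * ⟪gradient (W x) (vec z x), vec ζ x⟫_ℝ + W x (vec (θ • z + ζ) x) - W x (vec z x)) := by
    rw [integral_mul_sub_mul_add_sub ((1 - θ ^ 2) / 2) θ i1 i2 i3 i4]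
    rfl
  rw [e]
  refine integral_nonneg_of_ae ?_
  filter_upwards [vec_add (θ • z) ζ, vec_smul θ z] with x h1 h2
  rw [h1, h2]
  exact hW.ineq x θ hθ _ _

lemma exists_nonlin_le (hN : 3 ≤ N) (hW : Admissible W) {S : ℝ} (hS : IsEmbeddingConst N S)
    {ε : ℝ} (hε : 0 < ε) : ∃ C : ℝ, 0 ≤ C ∧ ∀ z : E N,
      nonlin W z ≤ ε * ‖z‖ ^ 2 + C * ‖z‖ ^ critExp N := by
  have hS0 := hS.1
  obtain ⟨C, hC, hg⟩ := hW.exists_growth_crit hN (ε := ε / S ^ 2) (by positivity)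
  refine ⟨C * S ^ critExp N, by positivity, fun z => ?_⟩
  obtain ⟨h1, h2⟩ := integral_rpow_vec_le hS (Or.inl rfl) one_lt_two z z
  obtain ⟨h3, h4⟩ := integral_rpow_vec_le hS (Or.inr rfl) (by linarith [critExp_pos hN]) z z
  norm_num at h1 h2
  calc nonlin W z ≤ ∫ x, (ε / S ^ 2 * (‖vec z x‖ * ‖vec z x‖)
        + C * (‖vec z x‖ ^ (critExp N - 1) * ‖vec z x‖)) := by
        refine integral_mono (hW.integrable_comp hN z) ((h1.const_mul _).add (h3.const_mul _))
          fun x => (hW.le_gradient_mul x (vec z x)).trans ?_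
        have := mul_le_mul_of_nonneg_right (hg x (vec z x)) (norm_nonneg (vec z x))
        linarith
    _ ≤ ε / S ^ 2 * (S * (S * ‖z‖) * ‖z‖)
        + C * (S * (S * ‖z‖) ^ (critExp N - 1) * ‖z‖) := by
        rw [integral_add (h1.const_mul _) (h3.const_mul _), integral_const_mul, integral_const_mul]
        gcongr
    _ = _ := by
        have e1 : S * (S * ‖z‖) ^ (critExp N - 1) * ‖z‖ = S ^ critExp N * ‖z‖ ^ critExp N := by
          have hr : critExp N - 1 ≠ 0 := by linarith [critExp_pos hN]
          have e2 : ∀ t : ℝ, 0 ≤ t → t ^ critExp N = t ^ (critExp N - 1) * t := by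
            intro t ht
            conv_rhs => rw [← Real.rpow_one t, ← Real.rpow_mul ht, one_mul]
            rw [← Real.rpow_add_of_nonneg ht (by linarith [critExp_pos hN]) zero_le_one]
            simp
          rw [Real.mul_rpow hS0.le (norm_nonneg _), e2 S hS0.le, e2 ‖z‖ (norm_nonneg _)]
          ring
        rw [e1]
        field_simp

end Admissible

end HamSys
end

noncomputable section

namespace HamSys

variable {N : ℕ} {W : Sp N → Plane → ℝ}

/-! ### Limits along weakly convergent sequences -/

/-- Dominated convergence with a dominating function that is controlled up to a small multiple of
a sequence bounded in `L¹`. -/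
lemma tendsto_integral_zero_of_le {α : Type*} [MeasurableSpace α] {μ : Measure α}
    {f h : ℕ → α → ℝ} {B : ℝ} (hf : ∀ n, Integrable (f n) μ) (hf0 : ∀ n x, 0 ≤ f n x)
    (hlim : ∀ᵐ x ∂μ, Tendsto (fun n => f n x) atTop (𝓝 0)) (hh : ∀ n, Integrable (h n) μ)
    (hh0 : ∀ n x, 0 ≤ h n x) (hB : ∀ n, ∫ x, h n x ∂μ ≤ B)
    (hle : ∀ ε : ℝ, 0 < ε → ∃ G : α → ℝ, Integrable G μ ∧ ∀ n x, f n x ≤ ε * h n x + G x) :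
    Tendsto (fun n => ∫ x, f n x ∂μ) atTop (𝓝 0) := by
  have hB0 : 0 ≤ B := (integral_nonneg (hh0 0)).trans (hB 0)
  rw [Metric.tendsto_atTop]
  intro ε hε
  set e := ε / (2 * (B + 1)) with he
  have hepos : 0 < e := by positivity
  have heB : e * B ≤ ε / 2 := by
    rw [he, div_mul_eq_mul_div, div_le_div_iff₀ (by positivity) (by norm_num)]
    nlinarith
  obtain ⟨G, hG, hfG⟩ := hle e hepos
  -- The excess of `f n` over `e * h n` is dominated by `|G|`, so its integral tends to `0`; the
  -- rest contributes at most `e * B`.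
  set m : ℕ → α → ℝ := fun n x => max (f n x - e * h n x) 0 with hm
  have hmint : ∀ n, Integrable (m n) μ := fun n => ((hf n).sub ((hh n).const_mul e)).pos_part
  have hm0 : ∀ n x, 0 ≤ m n x := fun n x => le_max_right _ _
  have hmlim : Tendsto (fun n => ∫ x, m n x ∂μ) atTop (𝓝 0) := by
    have h1 : Tendsto (fun n => ∫ x, m n x ∂μ) atTop (𝓝 (∫ _x, (0 : ℝ) ∂μ)) := by
      refine tendsto_integral_of_dominated_convergence (fun x => |G x|)
        (fun n => (hmint n).1) hG.abs (fun n => Eventually.of_forall fun x => ?_) ?_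
      · rw [Real.norm_of_nonneg (hm0 n x)]
        refine max_le ?_ (abs_nonneg _)
        linarith [hfG n x, le_abs_self (G x)]
      · filter_upwards [hlim] with x hx
        refine squeeze_zero (fun n => hm0 n x) (fun n => ?_) hx
        refine max_le ?_ (hf0 n x)
        linarith [mul_nonneg hepos.le (hh0 n x)]
    simpa using h1
  obtain ⟨n₀, hn₀⟩ := Metric.tendsto_atTop.1 hmlim (ε / 2) (half_pos hε)
  refine ⟨n₀, fun n hn => ?_⟩
  have h2 := hn₀ n hn
  rw [Real.dist_0_eq_abs, abs_of_nonneg (integral_nonneg (hm0 n))] at h2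
  rw [Real.dist_0_eq_abs, abs_of_nonneg (integral_nonneg (hf0 n))]
  have h3 : ∫ x, f n x ∂μ ≤ ∫ x, (e * h n x + m n x) ∂μ := by
    refine integral_mono (hf n) (((hh n).const_mul e).add (hmint n)) fun x => ?_
    have := le_max_left (f n x - e * h n x) 0
    change f n x ≤ e * h n x + max (f n x - e * h n x) 0
    linarith
  rw [integral_add ((hh n).const_mul e) (hmint n), integral_const_mul] at h3
  have h4 := mul_le_mul_of_nonneg_left (hB n) hepos.le
  linarith

lemma integral_le_of_tendsto_ae {α : Type*} [MeasurableSpace α] {μ : Measure α}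
    {f : ℕ → α → ℝ} {g : α → ℝ} {l : ℝ} (hf : ∀ n, Integrable (f n) μ) (hf0 : ∀ n x, 0 ≤ f n x)
    (hg : Integrable g μ)
    (hlim : ∀ᵐ x ∂μ, Tendsto (fun n => f n x) atTop (𝓝 (g x)))
    (hl : Tendsto (fun n => ∫ x, f n x ∂μ) atTop (𝓝 l)) : ∫ x, g x ∂μ ≤ l := by
  have hl0 : 0 ≤ l := ge_of_tendsto' hl fun n => integral_nonneg (hf0 n)
  have hg0 : 0 ≤ᵐ[μ] g := by
    filter_upwards [hlim] with x hx
    exact ge_of_tendsto' hx fun n => hf0 n x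
  rw [← ENNReal.ofReal_le_ofReal_iff hl0, ofReal_integral_eq_lintegral_ofReal hg hg0]
  have h1 : Tendsto (fun n => ∫⁻ x, ENNReal.ofReal (f n x) ∂μ) atTop (𝓝 (ENNReal.ofReal l)) :=
    (ENNReal.tendsto_ofReal hl).congr fun n =>
      ofReal_integral_eq_lintegral_ofReal (hf n) (Eventually.of_forall (hf0 n))
  calc ∫⁻ x, ENNReal.ofReal (g x) ∂μ
      = ∫⁻ x, liminf (fun n => ENNReal.ofReal (f n x)) atTop ∂μ := by
        refine lintegral_congr_ae ?_
        filter_upwards [hlim] with x hx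
        exact ((ENNReal.tendsto_ofReal hx).liminf_eq).symm
    _ ≤ liminf (fun n => ∫⁻ x, ENNReal.ofReal (f n x) ∂μ) atTop :=
        lintegral_liminf_le' fun n => (hf n).1.aemeasurable.ennreal_ofReal
    _ = ENNReal.ofReal l := h1.liminf_eq

lemma growthFn_mono (hN : 3 ≤ N) {s t : ℝ} (hs : 0 ≤ s) (hst : s ≤ t) :
    growthFn N s ≤ growthFn N t := by
  have := critExp_pos hN
  unfold growthFn
  gcongr
  linarith

/-- A Young-type inequality: either `t ≤ ε s`, or `s ≤ ε⁻¹ t` and `growthFn` is monotone. -/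
lemma growthFn_mul_le (hN : 3 ≤ N) {s t ε : ℝ} (hs : 0 ≤ s) (ht : 0 ≤ t) (hε : 0 < ε) :
    growthFn N s * t ≤ ε * (growthFn N s * s) + growthFn N (ε⁻¹ * t) * t := by
  have h1 := growthFn_nonneg (N := N) hs
  have h2 := growthFn_nonneg (N := N) (s := ε⁻¹ * t) (by positivity)
  rcases le_total t (ε * s) with h | h
  · have h3 := mul_le_mul_of_nonneg_left h h1
    have h4 := mul_nonneg h2 ht
    linarith
  · have h3 : s ≤ ε⁻¹ * t := by rwa [le_inv_mul_iff₀ hε]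
    have h4 := mul_le_mul_of_nonneg_right (growthFn_mono hN hs h3) ht
    have h5 : 0 ≤ ε * (growthFn N s * s) := by positivity
    linarith

lemma exists_subseq_ae_tendsto_vec {u : ℕ → E N} {z : E N} (hu : WeaklyTendsto u z) :
    ∃ σ : ℕ → ℕ, StrictMono σ ∧ ∀ᵐ x, Tendsto (fun n => vec (u (σ n)) x) atTop (𝓝 (vec z x)) := by
  obtain ⟨σ, hσ, h1⟩ := exists_subseq_ae_tendsto (hu.map (WithLp.fstL 2 ℝ (H1 N) (H1 N)))
  obtain ⟨τ, hτ, h2⟩ := exists_subseq_ae_tendsto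
    ((hu.map (WithLp.sndL 2 ℝ (H1 N) (H1 N))).subseq hσ.tendsto_atTop)
  refine ⟨σ ∘ τ, hσ.comp hτ, ?_⟩
  filter_upwards [h1, h2] with x h1 h2
  simp only [vec_eq]
  exact ((h1.comp hτ.tendsto_atTop).smul_const _).add (h2.smul_const _)

lemma growthBound_mono (hN : 3 ≤ N) {S s t : ℝ} (hS : 0 ≤ S) (hs : 0 ≤ s) (hst : s ≤ t) :
    growthBound N S s ≤ growthBound N S t := by
  have := critExp_pos hN
  unfold growthBound
  gcongr
  linarith

namespace Admissible

set_option maxHeartbeats 1000000 in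
-- The critical power prevents strong convergence from being used. Instead the integrand is
-- dominated by a fixed integrable function plus a small multiple of `growthFn |u n| |u n|`, which
-- is bounded in `L¹`.
lemma tendsto_deriv_of_ae (hN : 3 ≤ N) (hW : Admissible W) {u : ℕ → E N} {z : E N} {B : ℝ}
    (hB : ∀ n, ‖u n‖ ≤ B)
    (hu : ∀ᵐ x, Tendsto (fun n => vec (u n) x) atTop (𝓝 (vec z x))) (φ : E N) :
    Tendsto (fun n => hW.deriv hN (u n) φ) atTop (𝓝 (hW.deriv hN z φ)) := by
  obtain ⟨S, hS⟩ := exists_isEmbeddingConst hN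
  obtain ⟨C, hC, hg⟩ := hW.exists_growth hN
  set f : ℕ → Sp N → ℝ := fun n x =>
    ‖gradient (W x) (vec (u n) x) - gradient (W x) (vec z x)‖ * ‖vec φ x‖ with hf
  have hB0 : 0 ≤ B := (norm_nonneg _).trans (hB 0)
  have hbd : ∀ n x, f n x ≤ C * (growthFn N ‖vec (u n) x‖ * ‖vec φ x‖)
      + C * (growthFn N ‖vec z x‖ * ‖vec φ x‖) := by
    intro n x
    have h1 := norm_sub_le (gradient (W x) (vec (u n) x)) (gradient (W x) (vec z x))
    have h2 := mul_le_mul_of_nonneg_right (h1.trans (add_le_add (hg x _) (hg x _)))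
      (norm_nonneg (vec φ x))
    linarith
  have hfint : ∀ n, Integrable (f n) := by
    intro n
    refine (((integral_growthFn_le hN hS (u n) φ).1.const_mul C).add
      ((integral_growthFn_le hN hS z φ).1.const_mul C)).mono'
      (((hW.aestronglyMeasurable_gradient (aestronglyMeasurable_vec _)).sub
        (hW.aestronglyMeasurable_gradient (aestronglyMeasurable_vec _))).norm.mul
        (aestronglyMeasurable_vec φ).norm) (Eventually.of_forall fun x => ?_)
    rw [Real.norm_of_nonneg (by positivity)]
    exact hbd n x
  have hmain : Tendsto (fun n => ∫ x, f n x) atTop (𝓝 0) := by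
    refine tendsto_integral_zero_of_le (h := fun n x => growthFn N ‖vec (u n) x‖ * ‖vec (u n) x‖)
      (B := growthBound N S B * B) hfint (fun n x => by positivity) ?_
      (fun n => (integral_growthFn_le hN hS (u n) (u n)).1)
      (fun n x => mul_nonneg (growthFn_nonneg (norm_nonneg _)) (norm_nonneg _)) (fun n => ?_) ?_
    · filter_upwards [hu] with x hx
      have hc : Continuous fun ζ : Plane => gradient (W x) ζ :=
        hW.continuous_gradient.comp (continuous_const.prodMk continuous_id)
      have h1 := ((((hc.tendsto _).comp hx).sub_const (gradient (W x) (vec z x))).norm).mul_const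
        ‖vec φ x‖
      simpa using h1
    · refine (integral_growthFn_le hN hS (u n) (u n)).2.trans ?_
      exact mul_le_mul (growthBound_mono hN hS.1.le (norm_nonneg _) (hB n)) (hB n) (norm_nonneg _)
        (growthBound_nonneg hS.1.le hB0)
    · intro ε hε
      have hε' : 0 < ε / C := by positivity
      refine ⟨fun x => C * (growthFn N ((ε / C)⁻¹ * ‖vec φ x‖) * ‖vec φ x‖)
        + C * (growthFn N ‖vec z x‖ * ‖vec φ x‖), ?_, fun n x => ?_⟩
      · refine Integrable.add (Integrable.const_mul ?_ C)
          ((integral_growthFn_le hN hS z φ).1.const_mul C)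
        refine (integral_growthFn_le hN hS ((ε / C)⁻¹ • φ) φ).1.congr ?_
        filter_upwards [vec_smul (ε / C)⁻¹ φ] with x hx
        rw [hx, norm_smul, Real.norm_of_nonneg (inv_pos.2 hε').le]
      · refine (hbd n x).trans ?_
        have h1 := mul_le_mul_of_nonneg_left (growthFn_mul_le hN (norm_nonneg (vec (u n) x))
          (norm_nonneg (vec φ x)) hε') hC.le
        have h2 : C * (ε / C * (growthFn N ‖vec (u n) x‖ * ‖vec (u n) x‖)) =
            ε * (growthFn N ‖vec (u n) x‖ * ‖vec (u n) x‖) := by field_simp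
        linarith
  rw [tendsto_iff_norm_sub_tendsto_zero]
  refine squeeze_zero (fun n => norm_nonneg _) (fun n => ?_) hmain
  rw [deriv_apply, deriv_apply, ← integral_sub (hW.integrable_inner_gradient hN _ _)
    (hW.integrable_inner_gradient hN _ _)]
  refine norm_integral_le_of_norm_le (hfint n) (Eventually.of_forall fun x => ?_)
  rw [← inner_sub_left]
  exact norm_inner_le_norm _ _

lemma tendsto_deriv (hN : 3 ≤ N) (hW : Admissible W) {u : ℕ → E N} {z : E N}
    (hu : WeaklyTendsto u z) (φ : E N) :
    Tendsto (fun n => hW.deriv hN (u n) φ) atTop (𝓝 (hW.deriv hN z φ)) := by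
  obtain ⟨B, hB⟩ := hu.bounded
  refine tendsto_of_subseq_tendsto fun ns hns => ?_
  obtain ⟨σ, hσ, h⟩ := exists_subseq_ae_tendsto_vec (hu.subseq hns)
  exact ⟨σ, hW.tendsto_deriv_of_ae hN (u := fun n => u (ns (σ n))) (fun n => hB _) h φ⟩

lemma half_deriv_sub_nonlin (hN : 3 ≤ N) (hW : Admissible W) (z : E N) :
    Integrable (fun x => 1 / 2 * ⟪gradient (W x) (vec z x), vec z x⟫_ℝ - W x (vec z x)) ∧
    1 / 2 * hW.deriv hN z z - nonlin W z =
      ∫ x, (1 / 2 * ⟪gradient (W x) (vec z x), vec z x⟫_ℝ - W x (vec z x)) := by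
  have h1 := (hW.integrable_inner_gradient hN z z).const_mul (1 / 2)
  have h2 := hW.integrable_comp hN z
  refine ⟨h1.sub h2, ?_⟩
  rw [integral_sub h1 h2, integral_const_mul, nonlin, deriv_apply]

/-- Fatou's lemma along an a.e. convergent subsequence; the integrand is nonnegative by
`half_inner_sub_nonneg`. -/
lemma half_deriv_sub_nonlin_le (hN : 3 ≤ N) (hW : Admissible W) {u : ℕ → E N} {z : E N}
    (hu : WeaklyTendsto u z) {l : ℝ}
    (hl : Tendsto (fun n => 1 / 2 * hW.deriv hN (u n) (u n) - nonlin W (u n)) atTop (𝓝 l)) :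
    1 / 2 * hW.deriv hN z z - nonlin W z ≤ l := by
  obtain ⟨σ, hσ, h⟩ := exists_subseq_ae_tendsto_vec hu
  rw [(hW.half_deriv_sub_nonlin hN z).2]
  refine integral_le_of_tendsto_ae (f := fun n x =>
    1 / 2 * ⟪gradient (W x) (vec (u (σ n)) x), vec (u (σ n)) x⟫_ℝ - W x (vec (u (σ n)) x))
    (fun n => (hW.half_deriv_sub_nonlin hN _).1) (fun n x => hW.half_inner_sub_nonneg _ _)
    (hW.half_deriv_sub_nonlin hN z).1 ?_ ?_
  · filter_upwards [h] with x hx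
    have hc : Continuous fun ζ : Plane => gradient (W x) ζ :=
      hW.continuous_gradient.comp (continuous_const.prodMk continuous_id)
    have hc' : Continuous fun ζ : Plane => 1 / 2 * ⟪gradient (W x) ζ, ζ⟫_ℝ - W x ζ :=
      (continuous_const.mul (hc.inner continuous_id)).sub (hW.base.contDiff x).continuous
    exact (hc'.tendsto _).comp hx
  · exact (hl.comp hσ.tendsto_atTop).congr fun n => (hW.half_deriv_sub_nonlin hN _).2

end Admissible

/-! ### Superquadratic growth -/

/-- A weak gradient of the zero function vanishes by testing. Hence a nonzero element of `H¹` has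
nonzero values on a set of positive measure. -/
lemma eq_zero_of_val {u : H1 N} (h : val u =ᵐ[volume] fun _ => 0) : u = 0 := by
  have hg : ∀ i, ∀ᵐ x, grad u x i = 0 := by
    intro i
    refine ae_eq_zero_of_integral_contDiff_smul_eq_zero
      ((memLp_two_coord (memLp_grad u) i).locallyIntegrable (by norm_num)) fun φ hφ hc => ?_
    have h1 := isWeakGradient_val u φ hφ hc i
    have h2 : ∫ x, val u x * fderiv ℝ φ x (EuclideanSpace.single i 1) = 0 := by
      refine integral_eq_zero_of_ae ?_
      filter_upwards [h] with x hx
      simp [hx]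
    rw [h2] at h1
    simp_rw [smul_eq_mul, mul_comm (φ _)]
    linarith
  refine H1_ext (h.trans val_zero.symm) ?_
  have h0 : grad (0 : H1 N) =ᵐ[volume] fun _ => 0 := Lp.coeFn_zero _ _ _
  filter_upwards [ae_all_iff.2 hg, h0] with x hx h0
  rw [h0]
  ext i
  exact hx i

/-- Where `y₀ ≠ 0`, `|a u + b v| = 2 |t n| |y n|` tends to infinity and `W / t² = (W / |a u + b v|²)
* 4 |y n|²` blows up. That set has positive measure and `W ≥ 0`, so Fatou's lemma gives an infinite
limit. -/
lemma Admissible.tendsto_nonlin_div_of_ae (hN : 3 ≤ N) (hW : Admissible W) {a b : ℝ}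
    (hW2 : CondW2 a b W) {y : ℕ → H1 N} {y₀ : H1 N} (hy₀ : y₀ ≠ 0)
    (hy : ∀ᵐ x, Tendsto (fun n => val (y n) x) atTop (𝓝 (val y₀ x))) {t : ℕ → ℝ}
    (ht : Tendsto t atTop atTop) {ζ : ℕ → E N}
    (hζ : ∀ n, ∀ᵐ x, a * vec (ζ n) x 0 + b * vec (ζ n) x 1 = 2 * (t n * val (y n) x)) :
    Tendsto (fun n => nonlin W (ζ n) / t n ^ 2) atTop atTop := by
  have hint : ∀ n, Integrable (fun x => W x (vec (ζ n) x) / t n ^ 2) := fun n =>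
    (hW.integrable_comp hN (ζ n)).div_const _
  have hnn : ∀ n x, 0 ≤ W x (vec (ζ n) x) / t n ^ 2 := fun n x =>
    div_nonneg (hW.base.nonneg _ _) (sq_nonneg _)
  have hpt : ∀ᵐ x, val y₀ x ≠ 0 →
      liminf (fun n => ENNReal.ofReal (W x (vec (ζ n) x) / t n ^ 2)) atTop = ⊤ := by
    filter_upwards [hW2, hy, ae_all_iff.2 hζ] with x h1 h2 h3 hx
    have h4 : Tendsto (fun n => |val (y n) x|) atTop (𝓝 |val y₀ x|) := h2.abs
    have h5 : Tendsto (fun n => |a * vec (ζ n) x 0 + b * vec (ζ n) x 1|) atTop atTop := by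
      have h6 : Tendsto (fun n => 2 * (|t n| * |val (y n) x|)) atTop atTop :=
        Tendsto.const_mul_atTop two_pos
          ((tendsto_abs_atTop_atTop.comp ht).atTop_mul_pos (abs_pos.2 hx) h4)
      refine h6.congr fun n => ?_
      rw [h3 n, abs_mul, abs_mul, abs_two]
    have h7 := h1.comp (tendsto_comap_iff.2 h5)
    have h8 : Tendsto (fun n => W x (vec (ζ n) x) / t n ^ 2) atTop atTop := by
      have h9 : Tendsto (fun n => 4 * |val (y n) x| ^ 2) atTop (𝓝 (4 * |val y₀ x| ^ 2)) :=
        (h4.pow 2).const_mul 4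
      have h10 := h7.atTop_mul_pos (by have := abs_pos.2 hx; positivity) h9
      refine h10.congr' ?_
      filter_upwards [ht.eventually_gt_atTop 0, (tendsto_order.1 h4).1 _ (abs_pos.2 hx)] with n hn hn'
      have hne : val (y n) x ≠ 0 := abs_pos.1 hn'
      simp only [Function.comp_apply]
      rw [h3 n, abs_of_nonneg (hW.base.nonneg _ _), sq_abs, sq_abs]
      field_simp
      ring
    exact (ENNReal.tendsto_ofReal_nhds_top.2 h8).liminf_eq
  have hpos : volume {x | val y₀ x ≠ 0} ≠ 0 := fun h => hy₀ (eq_zero_of_val h)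
  have hmeas : ∀ n, AEMeasurable (fun x => ENNReal.ofReal (W x (vec (ζ n) x) / t n ^ 2)) volume :=
    fun n => (hint n).1.aemeasurable.ennreal_ofReal
  have hF := lintegral_liminf_le' (μ := volume) hmeas (u := atTop)
  have htop : ∫⁻ x, liminf (fun n => ENNReal.ofReal (W x (vec (ζ n) x) / t n ^ 2)) atTop = ⊤ := by
    have hset : MeasurableSet {x | val y₀ x ≠ 0} :=
      (Lp.stronglyMeasurable _).measurable (measurableSet_singleton (0 : ℝ)).compl
    rw [← top_le_iff, ← ENNReal.top_mul hpos, ← lintegral_indicator_const hset]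
    refine lintegral_mono_ae ?_
    filter_upwards [hpt] with x hx
    by_cases h : val y₀ x ≠ 0
    · rw [hx h]
      exact le_top
    · rw [Set.indicator_of_notMem h]
      exact zero_le
  rw [htop, top_le_iff] at hF
  have h1 : Tendsto (fun n => ∫⁻ x, ENNReal.ofReal (W x (vec (ζ n) x) / t n ^ 2)) atTop (𝓝 ⊤) :=
    tendsto_of_le_liminf_of_limsup_le hF.ge le_top
  rw [← ENNReal.tendsto_ofReal_nhds_top]
  refine h1.congr fun n => ?_
  rw [← ofReal_integral_eq_lintegral_ofReal (hint n) (Eventually.of_forall (hnn n)),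
    integral_div, nonlin]

end HamSys
end

noncomputable section

namespace HamSys

variable {N : ℕ} {W : Sp N → Plane → ℝ}

/-! ### Nonvanishing -/

namespace Admissible

lemma ofReal_nonlin_le (hN : 3 ≤ N) (hW : Admissible W) {S ε B K : ℝ}
    (hS : IsEmbeddingConst N S) (hε : 0 < ε) (hK : 0 ≤ K) :
    ∃ C : NNReal, ∀ (z : E N) (y : H1 N), ‖z‖ ≤ B → (∀ᵐ x, ‖vec z x‖ ≤ K * ‖val y x‖) →
      ENNReal.ofReal (nonlin W z) ≤ ENNReal.ofReal (ε * (growthBound N S B * B))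
        + C * ∫⁻ x, ‖val y x‖ₑ ^ midExp N := by
  have hmid : 2 ≤ midExp N := by
    unfold midExp
    have : (0 : ℝ) ≤ 4 / N := by positivity
    linarith
  obtain ⟨C, hC, hg⟩ := hW.exists_growth_rpow hε (e := midExp N - 1) (by linarith)
  refine ⟨Real.toNNReal (C * K ^ midExp N), fun z y hz hzy => ?_⟩
  obtain ⟨h1, h2⟩ := integral_growthFn_le hN hS z z
  have hB0 : 0 ≤ B := (norm_nonneg z).trans hz
  rw [nonlin, ofReal_integral_eq_lintegral_ofReal (hW.integrable_comp hN z)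
    (Eventually.of_forall fun x => hW.base.nonneg _ _)]
  calc ∫⁻ x, ENNReal.ofReal (W x (vec z x))
      ≤ ∫⁻ x, (ENNReal.ofReal (ε * (growthFn N ‖vec z x‖ * ‖vec z x‖))
          + Real.toNNReal (C * K ^ midExp N) * ‖val y x‖ₑ ^ midExp N) := by
        refine lintegral_mono_ae ?_
        filter_upwards [hzy] with x hx
        have e1 : ‖vec z x‖ ^ (midExp N - 1) * ‖vec z x‖ = ‖vec z x‖ ^ midExp N := by
          conv_lhs => rw [← Real.rpow_one ‖vec z x‖, ← Real.rpow_mul (norm_nonneg _), one_mul]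
          rw [← Real.rpow_add_of_nonneg (norm_nonneg _) (by linarith) zero_le_one]
          simp
        have e2 : ‖vec z x‖ ^ midExp N ≤ K ^ midExp N * ‖val y x‖ ^ midExp N := by
          rw [← Real.mul_rpow hK (norm_nonneg _)]
          exact Real.rpow_le_rpow (norm_nonneg _) hx (by linarith)
        have e3 : W x (vec z x) ≤ ε * (growthFn N ‖vec z x‖ * ‖vec z x‖)
            + C * K ^ midExp N * ‖val y x‖ ^ midExp N := by
          refine (hW.le_gradient_mul x (vec z x)).trans ?_
          have e4 := mul_le_mul_of_nonneg_right (hg x (vec z x)) (norm_nonneg (vec z x))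
          have e5 := mul_le_mul_of_nonneg_left e2 hC
          rw [add_mul, mul_assoc, mul_assoc C, e1] at e4
          linarith
        refine (ENNReal.ofReal_le_ofReal e3).trans ?_
        rw [ENNReal.ofReal_add (mul_nonneg hε.le (mul_nonneg (growthFn_nonneg (norm_nonneg _))
          (norm_nonneg _))) (by positivity), ENNReal.ofReal_mul (p := C * K ^ midExp N) (by positivity),
          ← ENNReal.ofReal_rpow_of_nonneg (norm_nonneg _) (by linarith), ofReal_norm]
        rfl
    _ = ENNReal.ofReal (∫ x, ε * (growthFn N ‖vec z x‖ * ‖vec z x‖))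
          + Real.toNNReal (C * K ^ midExp N) * ∫⁻ x, ‖val y x‖ₑ ^ midExp N := by
        rw [lintegral_add_left' (h1.const_mul ε).1.aemeasurable.ennreal_ofReal,
          lintegral_const_mul' _ _ ENNReal.coe_ne_top,
          ofReal_integral_eq_lintegral_ofReal (h1.const_mul ε) (Eventually.of_forall fun x =>
            mul_nonneg hε.le (mul_nonneg (growthFn_nonneg (norm_nonneg _)) (norm_nonneg _)))]
    _ ≤ _ := by
        gcongr
        rw [integral_const_mul]
        refine mul_le_mul_of_nonneg_left (h2.trans ?_) hε.le
        exact mul_le_mul (growthBound_mono hN hS.1.le (norm_nonneg _) hz) hz (norm_nonneg _)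
          (growthBound_nonneg hS.1.le hB0)

/-- If every unit ball carried little mass of `y`, Lions' lemma would make `∫ |y|^midExp` small, and
`nonlin W z` would stay below `δ`. -/
lemma exists_lintegral_ball_gt (hN : 3 ≤ N) (hW : Admissible W) {K B δ : ℝ} (hK : 0 ≤ K)
    (hB : 0 ≤ B) (hδ : 0 < δ) : ∃ d : ℝ≥0∞, 0 < d ∧ ∀ (z : E N) (y : H1 N), ‖y‖ ≤ 1 →
      ‖z‖ ≤ B → (∀ᵐ x, ‖vec z x‖ ≤ K * ‖val y x‖) → δ ≤ nonlin W z →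
      ∃ c : Sp N, d < ∫⁻ x in Metric.ball c 1, ‖val y x‖ₑ ^ 2 := by
  obtain ⟨S, hS⟩ := exists_isEmbeddingConst hN
  set G := growthBound N S B * B with hG
  have hG0 : 0 ≤ G := mul_nonneg (growthBound_nonneg hS.1.le hB) hB
  obtain ⟨C, hC⟩ := hW.ofReal_nonlin_le hN hS (B := B) (ε := δ / (2 * (G + 1))) (by positivity) hK
  obtain ⟨L, hL⟩ := exists_lions_const hN
  have hN0 : (0 : ℝ) < N := by
    have : 0 < N := by omega
    exact_mod_cast this
  -- The mass threshold `κ ^ (N / 2)` becomes `κ` under the power `2 / N` of Lions' lemma. The two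
  -- contributions are then at most `δ / 2` and `δ / 4`.
  set κ : ℝ := δ / (4 * (C * L + 1)) with hκ
  have hκ0 : 0 < κ := by positivity
  refine ⟨ENNReal.ofReal (κ ^ ((N : ℝ) / 2)), by simpa using Real.rpow_pos_of_pos hκ0 _,
    fun z y hy hz hzy hle => ?_⟩
  by_contra! hcon
  have h1 := hL y _ hcon
  have e1 : ENNReal.ofReal (κ ^ ((N : ℝ) / 2)) ^ (2 / (N : ℝ)) = ENNReal.ofReal κ := by
    rw [ENNReal.ofReal_rpow_of_nonneg (by positivity) (by positivity), ← Real.rpow_mul hκ0.le]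
    congr 1
    have : (N : ℝ) / 2 * (2 / N) = 1 := by field_simp
    rw [this, Real.rpow_one]
  have e2 : ‖y‖ₑ ^ 2 ≤ 1 := by
    refine pow_le_one' ?_ 2
    rw [← ofReal_norm]
    exact ENNReal.ofReal_le_one.2 hy
  have h2 : ∫⁻ x, ‖val y x‖ₑ ^ midExp N ≤ L * ENNReal.ofReal κ := by
    rw [e1] at h1
    exact h1.trans (mul_le_of_le_one_right' e2)
  have h3 := (ENNReal.ofReal_le_ofReal hle).trans
    ((hC z y hz hzy).trans (add_le_add le_rfl (mul_le_mul' le_rfl h2)))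
  have h4 : ENNReal.ofReal (δ / (2 * (G + 1)) * G) + C * (L * ENNReal.ofReal κ)
      = ENNReal.ofReal (δ / (2 * (G + 1)) * G + C * (L * κ)) := by
    rw [ENNReal.ofReal_add (by positivity) (by positivity), ENNReal.ofReal_mul C.coe_nonneg,
      ENNReal.ofReal_mul L.coe_nonneg, ENNReal.ofReal_coe_nnreal, ENNReal.ofReal_coe_nnreal]
  rw [h4, ENNReal.ofReal_le_ofReal_iff (by positivity)] at h3
  have h5 : δ / (2 * (G + 1)) * G ≤ δ / 2 := by
    rw [div_mul_eq_mul_div, div_le_div_iff₀ (by positivity) (by norm_num)]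
    nlinarith
  have h6 : C * (L * κ) ≤ δ / 4 := by
    have hCL : 0 ≤ (C : ℝ) * L := by positivity
    rw [hκ, ← mul_assoc, mul_div_assoc', div_le_div_iff₀ (by positivity) (by norm_num)]
    nlinarith
  linarith

set_option maxHeartbeats 1000000 in
-- An integer translation brings the centre of a non-negligible ball within distance `N` of the
-- origin. The mass then stays in the ball of radius `N + 1`, and Rellich's theorem forbids a zero
-- weak limit.
lemma exists_shift_weaklyTendsto (hN : 3 ≤ N) (hW : Admissible W) {K B δ : ℝ} (hK : 0 ≤ K)
    (hB : 0 ≤ B) (hδ : 0 < δ) {z : ℕ → E N} {y : ℕ → H1 N} (hy : ∀ n, ‖y n‖ ≤ 1)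
    (hz : ∀ n, ‖z n‖ ≤ B) (hzy : ∀ n, ∀ᵐ x, ‖vec (z n) x‖ ≤ K * ‖val (y n) x‖)
    (hle : ∀ n, δ ≤ nonlin W (z n)) :
    ∃ (k : ℕ → Fin N → ℤ) (σ : ℕ → ℕ) (y₀ : H1 N), StrictMono σ ∧ y₀ ≠ 0 ∧
      WeaklyTendsto (fun n => shift (intVec (k n)) (y (σ n))) y₀ := by
  obtain ⟨d, hd, hball⟩ := hW.exists_lintegral_ball_gt hN hK hB hδ
  choose c hc using fun n => hball (z n) (y n) (hy n) (hz n) (hzy n) (hle n)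
  choose k hk using fun n => exists_intVec_near (c n)
  obtain ⟨v, hv⟩ : ∃ v : ℕ → H1 N, ∀ n, v n = shift (intVec (k n)) (y n) := ⟨_, fun _ => rfl⟩
  obtain ⟨y₀, σ, hσ, hlim⟩ := exists_weaklyTendsto_subseq (u := v) (C := 1) fun n =>
    ((congrArg norm (hv n)).trans (LinearIsometryEquiv.norm_map _ _)).le.trans (hy n)
  refine ⟨fun n => k (σ n), σ, y₀, hσ, fun h0 => ?_, by
    simpa only [Function.comp_def, hv] using hlim⟩
  rw [h0] at hlim
  have h1 := tendsto_lintegral_ball_of_weaklyTendsto hlim (N + 1)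
  have h2 : ∀ n, d ≤ ∫⁻ x in Metric.ball (0 : Sp N) (N + 1), ‖val (v n) x‖ₑ ^ 2 := by
    intro n
    refine (hc n).le.trans ?_
    have e1 : ∫⁻ x in Metric.ball (0 : Sp N) (N + 1), ‖val (v n) x‖ₑ ^ 2
        = ∫⁻ x in Metric.ball (intVec (k n)) (N + 1), ‖val (y n) x‖ₑ ^ 2 := by
      rw [setLIntegral_congr_fun_ae (g := fun x => ‖val (y n) (x + intVec (k n))‖ₑ ^ 2)
        Metric.isOpen_ball.measurableSet (by
          filter_upwards [val_shift (intVec (k n)) (y n)] with x hx _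
          rw [hv n, hx])]
      rw [← lintegral_indicator Metric.isOpen_ball.measurableSet,
        ← lintegral_indicator Metric.isOpen_ball.measurableSet,
        ← lintegral_add_right_eq_self ((Metric.ball (intVec (k n)) (N + 1)).indicator
          fun x => ‖val (y n) x‖ₑ ^ 2) (intVec (k n))]
      refine lintegral_congr fun x => ?_
      simp only [Set.indicator, Metric.mem_ball, dist_eq_norm, add_sub_cancel_right,
        sub_zero]
    rw [e1]
    refine lintegral_mono_set fun x hx => ?_
    rw [Metric.mem_ball, dist_eq_norm] at hx ⊢
    calc ‖x - intVec (k n)‖ = ‖(x - c n) + (c n - intVec (k n))‖ := by rw [sub_add_sub_cancel]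
      _ ≤ ‖x - c n‖ + ‖c n - intVec (k n)‖ := norm_add_le _ _
      _ < N + 1 := by linarith [hk n]
  exact absurd (ge_of_tendsto' h1 fun n => h2 (σ n)) (not_le.2 hd)

end Admissible

end HamSys
end

noncomputable section

namespace HamSys

variable {N : ℕ}

/-! ### The quadratic part of the functional -/

/-- The weak gradient as a continuous linear map into `L²`. -/
def gradL (N : ℕ) : H1 N →L[ℝ] Lp (Sp N) 2 (volume : Measure (Sp N)) :=
  (WithLp.sndL 2 ℝ _ _).comp (H1 N).subtypeL

/-- The Dirichlet integral `∫ ∇u · ∇w`. -/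
def dirichlet (u w : H1 N) : ℝ := ∫ x, ⟪grad u x, grad w x⟫_ℝ

/-- The integral `∫ V u w`. -/
def pot (V : Sp N → ℝ) (u w : H1 N) : ℝ := ∫ x, V x * (val u x * val w x)

/-- The Dirichlet integral as a bounded bilinear form. -/
def gradForm (N : ℕ) : H1 N →L[ℝ] H1 N →L[ℝ] ℝ :=
  (innerSL ℝ).bilinearComp (gradL N) (gradL N)

lemma gradForm_apply (u w : H1 N) : gradForm N u w = dirichlet u w := by
  change ⟪gradL N u, gradL N w⟫_ℝ = _
  rw [L2.inner_def]
  rfl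

lemma integrable_inner_grad (u w : H1 N) : Integrable (fun x => ⟪grad u x, grad w x⟫_ℝ) :=
  L2.integrable_inner (gradL N u) (gradL N w)

lemma integral_norm_val_mul_le (u w : H1 N) : Integrable (fun x => ‖val u x‖ * ‖val w x‖) ∧
    ∫ x, ‖val u x‖ * ‖val w x‖ ≤ ‖u‖ * ‖w‖ := by
  have h2 : ∀ v : H1 N, (eLpNorm (val v) (ENNReal.ofReal 2) volume).toReal ≤ ‖v‖ := fun v => by
    rw [ENNReal.ofReal_ofNat]
    refine ENNReal.toReal_le_of_le_ofReal (norm_nonneg _) ?_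
    rw [ofReal_norm]
    exact eLpNorm_val_le v
  have hm : ∀ v : H1 N, MemLp (val v) (ENNReal.ofReal 2) volume := fun v => by
    rw [ENNReal.ofReal_ofNat]
    exact memLp_val v
  have h := holder_rpow one_lt_two (hm u) (hm w)
  norm_num at h
  refine ⟨h.1, h.2.trans ?_⟩
  have hu := h2 u
  have hw := h2 w
  rw [ENNReal.ofReal_ofNat] at hu hw
  exact mul_le_mul hu hw ENNReal.toReal_nonneg (norm_nonneg _)

lemma integrable_mul_val {V : Sp N → ℝ} {M : ℝ} (hV : Continuous V) (hM : ∀ x, |V x| ≤ M)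
    (u w : H1 N) : Integrable (fun x => V x * (val u x * val w x)) := by
  refine ((integral_norm_val_mul_le u w).1.const_mul M).mono'
    (hV.aestronglyMeasurable.mul ((memLp_val u).1.mul (memLp_val w).1))
    (Eventually.of_forall fun x => ?_)
  rw [norm_mul, norm_mul]
  exact mul_le_mul_of_nonneg_right (hM x) (by positivity)

lemma norm_integral_mul_val_le {V : Sp N → ℝ} {M : ℝ} (hM : ∀ x, |V x| ≤ M) (u w : H1 N) :
    ‖∫ x, V x * (val u x * val w x)‖ ≤ M * ‖u‖ * ‖w‖ := by
  have hM0 : 0 ≤ M := (abs_nonneg _).trans (hM 0)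
  obtain ⟨h1, h2⟩ := integral_norm_val_mul_le u w
  have h3 : ‖∫ x, V x * (val u x * val w x)‖ ≤ ∫ x, M * (‖val u x‖ * ‖val w x‖) := by
    refine norm_integral_le_of_norm_le (h1.const_mul M) (Eventually.of_forall fun x => ?_)
    rw [norm_mul, norm_mul]
    exact mul_le_mul_of_nonneg_right (hM x) (by positivity)
  rw [integral_const_mul] at h3
  rw [mul_assoc]
  exact h3.trans (mul_le_mul_of_nonneg_left h2 hM0)

lemma integral_mul_val_comm (V : Sp N → ℝ) (u w : H1 N) :
    ∫ x, V x * (val u x * val w x) = ∫ x, V x * (val w x * val u x) := by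
  simp_rw [mul_comm (val u _)]

lemma integral_mul_val_add {V : Sp N → ℝ} {M : ℝ} (hV : Continuous V) (hM : ∀ x, |V x| ≤ M)
    (u w w' : H1 N) : ∫ x, V x * (val u x * val (w + w') x) =
      (∫ x, V x * (val u x * val w x)) + ∫ x, V x * (val u x * val w' x) := by
  rw [← integral_add (integrable_mul_val hV hM u w) (integrable_mul_val hV hM u w')]
  refine integral_congr_ae ?_
  filter_upwards [val_add w w'] with x hx
  rw [hx]
  ring

lemma integral_mul_val_smul (V : Sp N → ℝ) (c : ℝ) (u w : H1 N) :
    ∫ x, V x * (val u x * val (c • w) x) = c * ∫ x, V x * (val u x * val w x) := by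
  rw [← integral_const_mul]
  refine integral_congr_ae ?_
  filter_upwards [val_smul c w] with x hx
  rw [hx]
  ring

/-- The form `(u, w) ↦ ∫ V u w` for a bounded potential `V`. -/
def potForm {V : Sp N → ℝ} {M : ℝ} (hV : Continuous V) (hM : ∀ x, |V x| ≤ M) :
    H1 N →L[ℝ] H1 N →L[ℝ] ℝ :=
  LinearMap.mkContinuous₂
    (LinearMap.mk₂ ℝ (fun u w : H1 N => ∫ x, V x * (val u x * val w x))
      (fun u u' w => by
        simp only [integral_mul_val_comm V _ w]
        exact integral_mul_val_add hV hM w u u')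
      (fun c u w => by
        simp only [integral_mul_val_comm V _ w]
        exact integral_mul_val_smul V c w u)
      (integral_mul_val_add hV hM)
      (fun c u w => integral_mul_val_smul V c u w))
    M (norm_integral_mul_val_le hM)

lemma potForm_apply {V : Sp N → ℝ} {M : ℝ} (hV : Continuous V) (hM : ∀ x, |V x| ≤ M)
    (u w : H1 N) : potForm hV hM u w = pot V u w := rfl

attribute [irreducible] gradForm potForm

lemma dirichlet_comm (u w : H1 N) : dirichlet u w = dirichlet w u := by
  unfold dirichlet
  simp_rw [real_inner_comm]

lemma dirichlet_shift (k : Sp N) (u w : H1 N) :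
    dirichlet (shift k u) (shift k w) = dirichlet u w := by
  refine (integral_congr_ae ?_).trans
    (integral_add_right_eq_self (fun x => ⟪grad u x, grad w x⟫_ℝ) k)
  filter_upwards [grad_shift k u, grad_shift k w] with x h1 h2
  rw [h1, h2]

lemma pot_shift {V : Sp N → ℝ} (hper : OnePeriodic V) (k : Fin N → ℤ) (u w : H1 N) :
    pot V (shift (intVec k) u) (shift (intVec k) w) = pot V u w := by
  refine (integral_congr_ae ?_).trans
    (integral_add_right_eq_self (fun x => V x * (val u x * val w x)) (intVec k))
  filter_upwards [val_shift (intVec k) u, val_shift (intVec k) w] with x h1 h2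
  rw [h1, h2, hper.add_intVec]

/-! ### Bilinear forms on a product of two copies of a Hilbert space -/

section Product

variable {H : Type*} [NormedAddCommGroup H] [InnerProductSpace ℝ H]

/-- The bilinear form on `H × H` whose quadratic form is `(u, v) ↦ 2 Q(u, v) + P(u, u) + P(v, v)`
for symmetric `Q`. -/
def crossForm (Q P : H →L[ℝ] H →L[ℝ] ℝ) :
    WithLp 2 (H × H) →L[ℝ] WithLp 2 (H × H) →L[ℝ] ℝ :=
  Q.bilinearComp (WithLp.fstL 2 ℝ H H) (WithLp.sndL 2 ℝ H H)
    + Q.bilinearComp (WithLp.sndL 2 ℝ H H) (WithLp.fstL 2 ℝ H H)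
    + P.bilinearComp (WithLp.fstL 2 ℝ H H) (WithLp.fstL 2 ℝ H H)
    + P.bilinearComp (WithLp.sndL 2 ℝ H H) (WithLp.sndL 2 ℝ H H)

lemma crossForm_apply (Q P : H →L[ℝ] H →L[ℝ] ℝ) (z ζ : WithLp 2 (H × H)) : crossForm Q P z ζ =
    Q z.fst ζ.snd + Q z.snd ζ.fst + P z.fst ζ.fst + P z.snd ζ.snd := rfl

/-- The map `w ↦ (α w, β w)` from `H` to `H × H`. -/
def pairL (H : Type*) [NormedAddCommGroup H] [InnerProductSpace ℝ H] (α β : ℝ) :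
    H →L[ℝ] WithLp 2 (H × H) :=
  ((WithLp.prodContinuousLinearEquiv 2 ℝ H H).symm : (H × H) →L[ℝ] WithLp 2 (H × H)).comp
    ((α • ContinuousLinearMap.id ℝ H).prod (β • ContinuousLinearMap.id ℝ H))

lemma pairL_apply (α β : ℝ) (w : H) : pairL H α β w = WithLp.toLp 2 (α • w, β • w) := rfl

lemma smul_pairL_add_pairL_fst (t α β α' β' : ℝ) (y w : H) :
    (t • pairL H α β y + pairL H α' β' w).fst = t • α • y + α' • w := rfl

lemma smul_pairL_add_pairL_snd (t α β α' β' : ℝ) (y w : H) :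
    (t • pairL H α β y + pairL H α' β' w).snd = t • β • y + β' • w := rfl

lemma smul_pairL_fst (t α β : ℝ) (y : H) : (t • pairL H α β y).fst = t • α • y := rfl

lemma smul_pairL_snd (t α β : ℝ) (y : H) : (t • pairL H α β y).snd = t • β • y := rfl

lemma exists_norm_pairL_le (H : Type*) [NormedAddCommGroup H] [InnerProductSpace ℝ H] (α β : ℝ) :
    ∃ κ : ℝ, 0 ≤ κ ∧ ∀ y : H, ‖pairL H α β y‖ ≤ κ * ‖y‖ := by
  obtain ⟨κ, hκ, h⟩ := (pairL H α β).bound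
  exact ⟨κ, hκ.le, h⟩

lemma crossForm_pairL (Q P : H →L[ℝ] H →L[ℝ] ℝ) (α β : ℝ) (w : H) :
    crossForm Q P (pairL H α β w) (pairL H α β w) =
      2 * (α * β) * Q w w + (α ^ 2 + β ^ 2) * P w w := by
  have h : ∀ (T : H →L[ℝ] H →L[ℝ] ℝ) (s t : ℝ), T (s • w) (t • w) = s * t * T w w :=
    fun T s t => by
      rw [map_smul, map_smul, smul_apply, smul_eq_mul, smul_eq_mul]
      ring
  rw [crossForm_apply]
  change Q (α • w) (β • w) + Q (β • w) (α • w) + P (α • w) (α • w) + P (β • w) (β • w) = _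
  rw [h, h, h, h]
  ring

lemma exists_eq_pairL_add_pairL {a b : ℝ} (ha : a ≠ 0) (hb : b ≠ 0) (z : WithLp 2 (H × H)) :
    ∃ y w, z = pairL H a⁻¹ b⁻¹ y + pairL H (-a⁻¹) b⁻¹ w := by
  refine ⟨(1 / 2 : ℝ) • (a • z.fst + b • z.snd), (1 / 2 : ℝ) • (b • z.snd - a • z.fst), ?_⟩
  have h1 : ∀ u v : H, u = a⁻¹ • (1 / 2 : ℝ) • (a • u + b • v)
      + (-a⁻¹) • (1 / 2 : ℝ) • (b • v - a • u) := fun u v => by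
    have e : a⁻¹ • (1 / 2 : ℝ) • (a • u + b • v) + (-a⁻¹) • (1 / 2 : ℝ) • (b • v - a • u)
        = (a⁻¹ * a) • u := by module
    rw [e, inv_mul_cancel₀ ha, one_smul]
  have h2 : ∀ u v : H, v = b⁻¹ • (1 / 2 : ℝ) • (a • u + b • v)
      + b⁻¹ • (1 / 2 : ℝ) • (b • v - a • u) := fun u v => by
    have e : b⁻¹ • (1 / 2 : ℝ) • (a • u + b • v) + b⁻¹ • (1 / 2 : ℝ) • (b • v - a • u)
        = (b⁻¹ * b) • v := by module
    rw [e, inv_mul_cancel₀ hb, one_smul]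
  rw [pairL_apply, pairL_apply, ← WithLp.toLp_add, Prod.mk_add_mk, ← h1, ← h2]
  rfl

lemma pairL_add_pairL_map (τ : H →ₗ[ℝ] H) (α β α' β' : ℝ) (y w : H) :
    pairL H α β (τ y) + pairL H α' β' (τ w) =
      WithLp.toLp 2 (τ (pairL H α β y + pairL H α' β' w).fst,
        τ (pairL H α β y + pairL H α' β' w).snd) := by
  change _ = WithLp.toLp 2 (τ (α • y + α' • w), τ (β • y + β' • w))
  rw [pairL_apply, pairL_apply, ← WithLp.toLp_add, Prod.mk_add_mk, map_add, map_add, map_smul,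
    map_smul, map_smul, map_smul]

end Product

/-- The bounded bilinear form on `E` whose quadratic form is twice the quadratic part of `Φ`. -/
def quadForm {V₁ V₂ : Sp N → ℝ} {M : ℝ} (hV₁ : Continuous V₁) (hM₁ : ∀ x, |V₁ x| ≤ M)
    (hV₂ : Continuous V₂) (hM₂ : ∀ x, |V₂ x| ≤ M) : E N →L[ℝ] E N →L[ℝ] ℝ :=
  crossForm (gradForm N + potForm hV₁ hM₁) (potForm hV₂ hM₂)

lemma quadForm_apply {V₁ V₂ : Sp N → ℝ} {M : ℝ} (hV₁ : Continuous V₁) (hM₁ : ∀ x, |V₁ x| ≤ M)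
    (hV₂ : Continuous V₂) (hM₂ : ∀ x, |V₂ x| ≤ M) (z ζ : E N) : quadForm hV₁ hM₁ hV₂ hM₂ z ζ =
    (dirichlet z.fst ζ.snd + pot V₁ z.fst ζ.snd)
      + (dirichlet z.snd ζ.fst + pot V₁ z.snd ζ.fst)
      + pot V₂ z.fst ζ.fst + pot V₂ z.snd ζ.snd := by
  exact congrArg₂ (· + ·) (congrArg₂ (· + ·) (congrArg₂ (· + ·)
    (congrArg₂ (· + ·) (gradForm_apply _ _) (potForm_apply _ _ _ _))
    (congrArg₂ (· + ·) (gradForm_apply _ _) (potForm_apply _ _ _ _)))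
    (potForm_apply _ _ _ _)) (potForm_apply _ _ _ _)

namespace CondV0

variable {a b η : ℝ} {V₁ V₂ : Sp N → ℝ}

lemma exists_bound (h : CondV0 a b η V₁ V₂) :
    ∃ M, (∀ x, |V₁ x| ≤ M) ∧ ∀ x, |V₂ x| ≤ M := by
  obtain ⟨m, hm, hm'⟩ := h.inf_pos
  obtain ⟨M, hM⟩ := h.sup_lt
  have h1 : ∀ x, |V₁ x| ≤ M := fun x => by
    rw [abs_of_nonneg (hm.le.trans (hm' x))]
    exact hM x
  have ha := h.a_pos
  have hb := h.b_pos
  have hη := h.η_pos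
  refine ⟨max M (2 * η * a * b / (a ^ 2 + b ^ 2) * M), fun x => (h1 x).trans (le_max_left _ _),
    fun x => (h.abs_le x).trans (le_trans ?_ (le_max_right _ _))⟩
  exact mul_le_mul_of_nonneg_left (hM x) (by positivity)

/-- The constant in the bound on `V₂` is the one for which `(a⁻² + b⁻²) * 2 η a b / (a² + b²) = 2 η
a⁻¹ b⁻¹`. -/
lemma abs_pot_le (h : CondV0 a b η V₁ V₂) {M : ℝ} (hM₁ : ∀ x, |V₁ x| ≤ M)
    (w : H1 N) :
    (a⁻¹ ^ 2 + b⁻¹ ^ 2) * |pot V₂ w w|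
      ≤ 2 * (a⁻¹ * b⁻¹) * η * pot V₁ w w := by
  have ha := h.a_pos
  have hb := h.b_pos
  have h1 : |pot V₂ w w|
      ≤ 2 * η * a * b / (a ^ 2 + b ^ 2) * pot V₁ w w := by
    rw [pot, pot, ← integral_const_mul]
    refine norm_integral_le_of_norm_le (f := fun x => V₂ x * (val w x * val w x))
      ((integrable_mul_val h.continuous₁ hM₁ w w).const_mul _) (Eventually.of_forall fun x => ?_)
    rw [norm_mul, Real.norm_of_nonneg (mul_self_nonneg (val w x)),
      ← mul_assoc _ (V₁ x)]
    exact mul_le_mul_of_nonneg_right (h.abs_le x) (mul_self_nonneg _)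
  calc (a⁻¹ ^ 2 + b⁻¹ ^ 2) * |pot V₂ w w|
      ≤ (a⁻¹ ^ 2 + b⁻¹ ^ 2)
        * (2 * η * a * b / (a ^ 2 + b ^ 2) * pot V₁ w w) := by gcongr
    _ = _ := by
      field_simp
      ring

lemma mul_integral_sq_le (h : CondV0 a b η V₁ V₂) {M m : ℝ} (hM₁ : ∀ x, |V₁ x| ≤ M)
    (hm : 0 < m) (hm' : ∀ x, m ≤ V₁ x) (w : H1 N) :
    m * ∫ x, val w x * val w x ≤ pot V₁ w w := by
  rw [pot, ← integral_const_mul]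
  refine integral_mono (f := fun x => m * (val w x * val w x)) ?_
    (integrable_mul_val h.continuous₁ hM₁ w w) fun x =>
    mul_le_mul_of_nonneg_right (hm' x) (mul_self_nonneg _)
  exact (integrable_mul_val continuous_const (V := fun _ => m) (M := m)
    (fun _ => (abs_of_pos hm).le) w w)

end CondV0

lemma dirichlet_self_nonneg (w : H1 N) : 0 ≤ dirichlet w w :=
  integral_nonneg fun _ => real_inner_self_nonneg

lemma norm_sq_eq_dirichlet (w : H1 N) : ‖w‖ ^ 2 = dirichlet w w + ∫ x, val w x * val w x :=
  norm_sq_eq_integral w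

/-- Here `g` is the Dirichlet integral, `n` the squared `L²` norm, `p` and `q` the integrals with
`V₁` and `|V₂|`. A fraction `1 - η` of `p` survives the subtraction and controls `n`. -/
lemma coercive_of_le {g p q n η m s t : ℝ} (hg : 0 ≤ g) (hn : 0 ≤ n) (hs : 0 ≤ s) (hη : η < 1)
    (hp : m * n ≤ p) (hq : t * q ≤ s * η * p) :
    s * min 1 ((1 - η) * m) * (g + n) ≤ s * (g + p) - t * q := by
  have h1 : min 1 ((1 - η) * m) * g ≤ g := mul_le_of_le_one_left hg (min_le_left _ _)
  have h2 : min 1 ((1 - η) * m) * n ≤ (1 - η) * m * n :=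
    mul_le_mul_of_nonneg_right (min_le_right _ _) hn
  have h3 := mul_le_mul_of_nonneg_left hp (sub_nonneg.2 hη.le)
  have h4 : min 1 ((1 - η) * m) * (g + n) ≤ g + (1 - η) * p := by linarith
  have h5 := mul_le_mul_of_nonneg_left h4 hs
  linarith

namespace CondV0

variable {a b η : ℝ} {V₁ V₂ : Sp N → ℝ}

/-- With the absolute value of the `V₂` term, one constant serves the positive and the negative
subspace, where that term enters with opposite effect. -/
lemma exists_coercive (h : CondV0 a b η V₁ V₂) {M : ℝ} (hM₁ : ∀ x, |V₁ x| ≤ M) :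
    ∃ c : ℝ, 0 < c ∧ ∀ w : H1 N,
    c * ‖w‖ ^ 2 ≤ 2 * (a⁻¹ * b⁻¹) * (dirichlet w w + pot V₁ w w)
      - (a⁻¹ ^ 2 + b⁻¹ ^ 2) * |pot V₂ w w| := by
  have ha := h.a_pos
  have hb := h.b_pos
  have hη := h.η_lt_one
  obtain ⟨m, hm, hm'⟩ := h.inf_pos
  have hκ0 : 0 < min 1 ((1 - η) * m) := lt_min one_pos (mul_pos (by linarith) hm)
  refine ⟨2 * (a⁻¹ * b⁻¹) * min 1 ((1 - η) * m), by positivity, fun w => ?_⟩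
  rw [norm_sq_eq_dirichlet]
  exact coercive_of_le (dirichlet_self_nonneg w) (integral_nonneg fun _ => mul_self_nonneg _)
    (by positivity) hη (h.mul_integral_sq_le hM₁ hm hm' w) (h.abs_pot_le hM₁ w)

end CondV0

end HamSys
end

noncomputable section

namespace HamSys

variable {N : ℕ} {W : Sp N → Plane → ℝ} {V₁ V₂ : Sp N → ℝ}

/-! ### Evaluation of the functional and of its derivative -/

lemma norm_vec_sq (z : E N) (x : Sp N) :
    ‖vec z x‖ ^ 2 = val z.fst x * val z.fst x + val z.snd x * val z.snd x := by
  rw [EuclideanSpace.norm_sq_eq, Fin.sum_univ_two]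
  simp [vec, sq]

lemma norm_vec_le (z : E N) (x : Sp N) : ‖vec z x‖ ≤ ‖val z.fst x‖ + ‖val z.snd x‖ := by
  rw [vec_eq]
  refine (norm_add_le _ _).trans (le_of_eq ?_)
  simp [norm_smul]

lemma inner_plane (p : Plane) (s t : ℝ) : ⟪p, !₂[s, t]⟫_ℝ = p 0 * s + p 1 * t := by
  rw [PiLp.inner_apply, Fin.sum_univ_two]
  simp [mul_comm]

lemma dirichlet_zero (u : H1 N) : dirichlet u 0 = 0 := by
  refine integral_eq_zero_of_ae ?_
  have h0 : grad (0 : H1 N) =ᵐ[volume] fun _ => 0 := Lp.coeFn_zero _ _ _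
  filter_upwards [h0] with x hx
  rw [hx, inner_zero_right]
  rfl

lemma pot_zero (V : Sp N → ℝ) (u : H1 N) : pot V u 0 = 0 := by
  refine integral_eq_zero_of_ae ?_
  filter_upwards [val_zero (N := N)] with x hx
  rw [hx, mul_zero, mul_zero]
  rfl

lemma nonlin_shift (hper : OnePeriodic W) (k : Fin N → ℤ) (z : E N) :
    nonlin W (WithLp.toLp 2 (shift (intVec k) z.fst, shift (intVec k) z.snd)) = nonlin W z := by
  refine (integral_congr_ae ?_).trans
    (integral_add_right_eq_self (fun x => W x (vec z x)) (intVec k))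
  filter_upwards [val_shift (intVec k) z.fst, val_shift (intVec k) z.snd] with x h1 h2
  rw [hper.add_intVec, vec_congr (z := WithLp.toLp 2 (shift (intVec k) z.fst,
    shift (intVec k) z.snd)) h1 h2]
  rfl

lemma norm_vec_smul_pairL_le (R α β : ℝ) (y : H1 N) :
    ∀ᵐ x, ‖vec (R • pairL (H1 N) α β y) x‖ ≤ |R| * (|α| + |β|) * ‖val y x‖ := by
  filter_upwards [val_smul R (α • y), val_smul R (β • y), val_smul α y, val_smul β y]
    with x h1 h2 h3 h4
  refine (norm_vec_le _ _).trans (le_of_eq ?_)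
  have e1 := (congrArg (fun u => val u x) (smul_pairL_fst R α β y)).trans
    (h1.trans (congrArg (R * ·) h3))
  have e2 := (congrArg (fun u => val u x) (smul_pairL_snd R α β y)).trans
    (h2.trans (congrArg (R * ·) h4))
  refine (congrArg₂ (fun s t : ℝ => ‖s‖ + ‖t‖) e1 e2).trans ?_
  simp only [norm_mul, Real.norm_eq_abs]
  ring

/-- The `Tm` component cancels in `a u + b v`, so superquadratic growth sees `y` only. -/
lemma ae_combination_eq {a b : ℝ} (ha : a ≠ 0) (hb : b ≠ 0) (t : ℝ) (y w : H1 N) :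
    ∀ᵐ x, a * vec (t • pairL (H1 N) a⁻¹ b⁻¹ y + pairL (H1 N) (-a⁻¹) b⁻¹ w) x 0
      + b * vec (t • pairL (H1 N) a⁻¹ b⁻¹ y + pairL (H1 N) (-a⁻¹) b⁻¹ w) x 1
      = 2 * (t * val y x) := by
  filter_upwards [val_add (t • a⁻¹ • y) (-a⁻¹ • w), val_add (t • b⁻¹ • y) (b⁻¹ • w),
    val_smul t (a⁻¹ • y), val_smul t (b⁻¹ • y), val_smul a⁻¹ y, val_smul b⁻¹ y,
    val_smul (-a⁻¹) w, val_smul b⁻¹ w] with x h1 h2 h3 h4 h5 h6 h7 h8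
  have e1 := (congrArg (fun u => val u x)
    (smul_pairL_add_pairL_fst t a⁻¹ b⁻¹ (-a⁻¹) b⁻¹ y w)).trans
    (h1.trans (congrArg₂ (· + ·) (h3.trans (congrArg (t * ·) h5)) h7))
  have e2 := (congrArg (fun u => val u x)
    (smul_pairL_add_pairL_snd t a⁻¹ b⁻¹ (-a⁻¹) b⁻¹ y w)).trans
    (h2.trans (congrArg₂ (· + ·) (h4.trans (congrArg (t * ·) h6)) h8))
  refine (congrArg₂ (fun s r : ℝ => a * s + b * r) e1 e2).trans ?_
  field_simp
  ring

lemma integral_three {f g h : Sp N → ℝ} (hf : Integrable f) (hg : Integrable g)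
    (hh : Integrable h) : ∫ x, (f x + g x + h x) = (∫ x, f x) + (∫ x, g x) + ∫ x, h x := by
  rw [← integral_add hf hg]
  exact integral_add (hf.add hg) hh

lemma integral_quadratic_eq {M : ℝ} (hV₁ : Continuous V₁) (hM₁ : ∀ x, |V₁ x| ≤ M)
    (hV₂ : Continuous V₂) (hM₂ : ∀ x, |V₂ x| ≤ M) (u v : H1 N) :
    ∫ x, (⟪grad u x, grad v x⟫_ℝ + V₁ x * (val u x * val v x)
      + 1 / 2 * (V₂ x * (val u x * val u x) + V₂ x * (val v x * val v x)))
      = dirichlet u v + pot V₁ u v + 1 / 2 * (pot V₂ u u + pot V₂ v v) := by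
  have i1 := integrable_mul_val hV₂ hM₂ u u
  have i2 := integrable_mul_val hV₂ hM₂ v v
  refine (integral_three (h := fun x => 1 / 2 * (V₂ x * (val u x * val u x)
    + V₂ x * (val v x * val v x))) (integrable_inner_grad u v)
    (integrable_mul_val hV₁ hM₁ u v) ((i1.add i2).const_mul (1 / 2))).trans ?_
  rw [integral_const_mul, integral_add i1 i2]
  rfl

lemma quadForm_self {M : ℝ} (hV₁ : Continuous V₁) (hM₁ : ∀ x, |V₁ x| ≤ M)
    (hV₂ : Continuous V₂) (hM₂ : ∀ x, |V₂ x| ≤ M) (z : E N) :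
    quadForm hV₁ hM₁ hV₂ hM₂ z z = 2 * (dirichlet z.fst z.snd + pot V₁ z.fst z.snd
      + 1 / 2 * (pot V₂ z.fst z.fst + pot V₂ z.snd z.snd)) := by
  refine (quadForm_apply hV₁ hM₁ hV₂ hM₂ z z).trans ?_
  rw [dirichlet_comm z.snd z.fst,
    show pot V₁ z.snd z.fst = pot V₁ z.fst z.snd from integral_mul_val_comm V₁ _ _]
  ring

lemma Phi_eq {M : ℝ} (hV₁ : Continuous V₁) (hM₁ : ∀ x, |V₁ x| ≤ M) (hV₂ : Continuous V₂)
    (hM₂ : ∀ x, |V₂ x| ≤ M) (z : E N) :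
    Phi V₁ V₂ W z = energy (X := E N) (quadForm hV₁ hM₁ hV₂ hM₂) (nonlin W) z := by
  have h1 := integral_quadratic_eq hV₁ hM₁ hV₂ hM₂ z.fst z.snd
  have h2 : ∀ x, ⟪grad z.fst x, grad z.snd x⟫_ℝ + V₁ x * (val z.fst x * val z.snd x)
      + 1 / 2 * V₂ x * ‖vec z x‖ ^ 2 =
      ⟪grad z.fst x, grad z.snd x⟫_ℝ + V₁ x * (val z.fst x * val z.snd x)
      + 1 / 2 * (V₂ x * (val z.fst x * val z.fst x) + V₂ x * (val z.snd x * val z.snd x)) := by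
    intro x
    rw [norm_vec_sq]
    ring
  have h3 := congrArg (fun s => 1 / 2 * s - nonlin W z) (quadForm_self hV₁ hM₁ hV₂ hM₂ z)
  refine Eq.trans ?_ h3.symm
  rw [Phi, integral_congr_ae (Eventually.of_forall h2), h1, nonlin]
  ring

lemma integral_weak_eq {M : ℝ} (hV₁ : Continuous V₁) (hM₁ : ∀ x, |V₁ x| ≤ M)
    (hV₂ : Continuous V₂) (hM₂ : ∀ x, |V₂ x| ≤ M) (u v φ : H1 N) :
    ∫ x, (⟪grad u x, grad φ x⟫_ℝ + V₁ x * val u x * val φ x + V₂ x * val v x * val φ x)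
      = dirichlet u φ + pot V₁ u φ + pot V₂ v φ := by
  simp_rw [mul_assoc]
  exact integral_three (integrable_inner_grad u φ) (integrable_mul_val hV₁ hM₁ u φ)
    (integrable_mul_val hV₂ hM₂ v φ)

lemma Admissible.deriv_inl (hN : 3 ≤ N) (hW : Admissible W) (z : E N) (φ : H1 N) :
    Integrable (fun x => gradient (W x) (vec z x) 0 * val φ x) ∧
    hW.deriv hN z (WithLp.toLp 2 (φ, 0)) = ∫ x, gradient (W x) (vec z x) 0 * val φ x := by
  have h : (fun x => ⟪gradient (W x) (vec z x), vec (WithLp.toLp 2 (φ, 0) : E N) x⟫_ℝ)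
      =ᵐ[volume] fun x => gradient (W x) (vec z x) 0 * val φ x := by
    filter_upwards [val_zero (N := N)] with x hx
    rw [vec_congr (z := WithLp.toLp 2 (φ, 0)) (u := val φ x) rfl hx, inner_plane, mul_zero,
      add_zero]
  exact ⟨(hW.integrable_inner_gradient hN z _).congr h, integral_congr_ae h⟩

lemma Admissible.deriv_inr (hN : 3 ≤ N) (hW : Admissible W) (z : E N) (φ : H1 N) :
    Integrable (fun x => gradient (W x) (vec z x) 1 * val φ x) ∧
    hW.deriv hN z (WithLp.toLp 2 (0, φ)) = ∫ x, gradient (W x) (vec z x) 1 * val φ x := by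
  have h : (fun x => ⟪gradient (W x) (vec z x), vec (WithLp.toLp 2 (0, φ) : E N) x⟫_ℝ)
      =ᵐ[volume] fun x => gradient (W x) (vec z x) 1 * val φ x := by
    filter_upwards [val_zero (N := N)] with x hx
    rw [vec_congr (z := WithLp.toLp 2 (0, φ)) (v := val φ x) hx rfl, inner_plane, mul_zero,
      zero_add]
  exact ⟨(hW.integrable_inner_gradient hN z _).congr h, integral_congr_ae h⟩

lemma isWeakSolution_of_eq (hN : 3 ≤ N) (hW : Admissible W) {M : ℝ} (hV₁ : Continuous V₁)
    (hM₁ : ∀ x, |V₁ x| ≤ M) (hV₂ : Continuous V₂) (hM₂ : ∀ x, |V₂ x| ≤ M) {z : E N}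
    (hz : quadForm hV₁ hM₁ hV₂ hM₂ z = hW.deriv hN z) : IsWeakSolution V₁ V₂ W z := by
  intro φ
  obtain ⟨i0, e0⟩ := hW.deriv_inl hN z φ
  obtain ⟨i1, e1⟩ := hW.deriv_inr hN z φ
  refine ⟨i1, i0, ?_, ?_⟩
  -- The first equation comes from varying `v`, hence the test pair `(0, φ)`; the second from `(φ,
  -- 0)`.
  · rw [integral_weak_eq hV₁ hM₁ hV₂ hM₂, ← e1]
    have h := (quadForm_apply hV₁ hM₁ hV₂ hM₂ z (WithLp.toLp 2 (0, φ))).symm.trans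
      (DFunLike.congr_fun hz _)
    refine Eq.trans ?_ h
    change _ = dirichlet z.fst φ + pot V₁ z.fst φ + (dirichlet z.snd 0 + pot V₁ z.snd 0)
      + pot V₂ z.fst 0 + pot V₂ z.snd φ
    rw [dirichlet_zero, pot_zero, pot_zero]
    ring
  · rw [integral_weak_eq hV₁ hM₁ hV₂ hM₂, ← e0]
    have h := (quadForm_apply hV₁ hM₁ hV₂ hM₂ z (WithLp.toLp 2 (φ, 0))).symm.trans
      (DFunLike.congr_fun hz _)
    refine Eq.trans ?_ h
    change _ = dirichlet z.fst 0 + pot V₁ z.fst 0 + (dirichlet z.snd φ + pot V₁ z.snd φ)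
      + pot V₂ z.fst φ + pot V₂ z.snd 0
    rw [dirichlet_zero, pot_zero, pot_zero]
    ring

end HamSys
end

noncomputable section

namespace HamSys

variable {N : ℕ} {W : Sp N → Plane → ℝ} {V₁ V₂ : Sp N → ℝ} {a b η M : ℝ}

/-! ### The functional fits the abstract framework -/

lemma quadForm_pairL (hV₁ : Continuous V₁) (hM₁ : ∀ x, |V₁ x| ≤ M)
    (hV₂ : Continuous V₂) (hM₂ : ∀ x, |V₂ x| ≤ M) (α β : ℝ) (w : H1 N) :
    quadForm hV₁ hM₁ hV₂ hM₂ (pairL (H1 N) α β w) (pairL (H1 N) α β w) =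
      2 * (α * β) * (dirichlet w w + pot V₁ w w) + (α ^ 2 + β ^ 2) * pot V₂ w w :=
  (crossForm_pairL (gradForm N + potForm hV₁ hM₁) (potForm hV₂ hM₂) α β w).trans
    (congrArg₂ (fun s t => 2 * (α * β) * s + (α ^ 2 + β ^ 2) * t)
      (congrArg₂ (· + ·) (gradForm_apply w w) (potForm_apply hV₁ hM₁ w w))
      (potForm_apply hV₂ hM₂ w w))

lemma quadForm_comm (hV₁ : Continuous V₁) (hM₁ : ∀ x, |V₁ x| ≤ M)
    (hV₂ : Continuous V₂) (hM₂ : ∀ x, |V₂ x| ≤ M) (z ζ : E N) :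
    quadForm hV₁ hM₁ hV₂ hM₂ z ζ = quadForm hV₁ hM₁ hV₂ hM₂ ζ z := by
  refine (quadForm_apply hV₁ hM₁ hV₂ hM₂ z ζ).trans
    (Eq.trans ?_ (quadForm_apply hV₁ hM₁ hV₂ hM₂ ζ z).symm)
  have h : ∀ (V : Sp N → ℝ) (u v : H1 N), pot V u v = pot V v u := integral_mul_val_comm
  rw [dirichlet_comm z.fst, dirichlet_comm z.snd, h V₁ z.fst, h V₁ z.snd, h V₂ z.fst, h V₂ z.snd]
  ring

lemma quadForm_shift (hV₁ : Continuous V₁) (hM₁ : ∀ x, |V₁ x| ≤ M)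
    (hV₂ : Continuous V₂) (hM₂ : ∀ x, |V₂ x| ≤ M) (h₁ : OnePeriodic V₁) (h₂ : OnePeriodic V₂)
    (k : Fin N → ℤ) (z : E N) : quadForm hV₁ hM₁ hV₂ hM₂
      (WithLp.toLp 2 (shift (intVec k) z.fst, shift (intVec k) z.snd))
      (WithLp.toLp 2 (shift (intVec k) z.fst, shift (intVec k) z.snd))
      = quadForm hV₁ hM₁ hV₂ hM₂ z z := by
  refine (quadForm_apply hV₁ hM₁ hV₂ hM₂ _ _).trans
    (Eq.trans ?_ (quadForm_apply hV₁ hM₁ hV₂ hM₂ z z).symm)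
  exact congrArg₂ (· + ·) (congrArg₂ (· + ·) (congrArg₂ (· + ·)
    (congrArg₂ (· + ·) (dirichlet_shift _ _ _) (pot_shift h₁ _ _ _))
    (congrArg₂ (· + ·) (dirichlet_shift _ _ _) (pot_shift h₁ _ _ _)))
    (pot_shift h₂ _ _ _)) (pot_shift h₂ _ _ _)

set_option maxHeartbeats 2000000 in
lemma energy_shift (hV₁ : Continuous V₁) (hM₁ : ∀ x, |V₁ x| ≤ M)
    (hV₂ : Continuous V₂) (hM₂ : ∀ x, |V₂ x| ≤ M) (h₁ : OnePeriodic V₁) (h₂ : OnePeriodic V₂)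
    (hW : OnePeriodic W) (α β α' β' : ℝ) (k : Fin N → ℤ) (y w : H1 N) :
    energy (X := E N) (quadForm hV₁ hM₁ hV₂ hM₂) (nonlin W)
        (pairL (H1 N) α β (shift (intVec k) y) + pairL (H1 N) α' β' (shift (intVec k) w))
      = energy (X := E N) (quadForm hV₁ hM₁ hV₂ hM₂) (nonlin W)
        (pairL (H1 N) α β y + pairL (H1 N) α' β' w) := by
  have h := pairL_add_pairL_map (H := H1 N)
    ((shift (intVec k)).toLinearEquiv : H1 N →ₗ[ℝ] H1 N) α β α' β' y w
  refine (congrArg (energy (X := E N) (quadForm hV₁ hM₁ hV₂ hM₂) (nonlin W)) h).trans ?_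
  exact congrArg₂ (fun s t : ℝ => 1 / 2 * s - t)
    (quadForm_shift hV₁ hM₁ hV₂ hM₂ h₁ h₂ k _) (nonlin_shift hW k _)

lemma exists_pos_rpow_le {C κ ε r : ℝ} (hε : 0 < ε) (hr : 2 < r) (hκ : 0 ≤ κ) :
    ∃ ρ : ℝ, 0 < ρ ∧ C * (κ * ρ) ^ r ≤ ε * ρ ^ 2 := by
  have h1 : Tendsto (fun ρ : ℝ => C * κ ^ r * ρ ^ (r - 2)) (𝓝[>] 0) (𝓝 0) := by
    have h2 : Tendsto (fun ρ : ℝ => ρ ^ (r - 2)) (𝓝[>] 0) (𝓝 (0 ^ (r - 2))) :=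
      ((Real.continuousAt_rpow_const 0 (r - 2) (Or.inr (by linarith))).tendsto).mono_left
        nhdsWithin_le_nhds
    rw [Real.zero_rpow (by linarith)] at h2
    simpa using h2.const_mul (C * κ ^ r)
  obtain ⟨ρ, h3, h4⟩ := ((h1.eventually (gt_mem_nhds hε)).and self_mem_nhdsWithin).exists
  have hρ : 0 < ρ := h4
  refine ⟨ρ, hρ, ?_⟩
  have h5 : ρ ^ r = ρ ^ (r - 2) * ρ ^ 2 := by
    rw [← Real.rpow_natCast, ← Real.rpow_add hρ]
    norm_num
  rw [Real.mul_rpow hκ hρ.le, h5]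
  nlinarith [sq_nonneg ρ]

lemma exists_sphere_le_of_growth {H X : Type*} [NormedAddCommGroup H] [NormedAddCommGroup X]
    {I : X → ℝ} {T : H → X} {κ r c : ℝ} (hκ0 : 0 ≤ κ) (hκ : ∀ y, ‖T y‖ ≤ κ * ‖y‖) (hr : 2 < r)
    (hI : ∀ ε : ℝ, 0 < ε → ∃ C : ℝ, 0 ≤ C ∧ ∀ z, I z ≤ ε * ‖z‖ ^ 2 + C * ‖z‖ ^ r) (hc : 0 < c) :
    ∃ ρ : ℝ, 0 < ρ ∧ ∀ y, ‖y‖ = ρ → I (T y) ≤ c / 4 * ‖y‖ ^ 2 := by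
  -- The allowance `c / 4` is shared equally: `c / 8` for the quadratic term and, for small `ρ`, `c
  -- / 8` for the power `r > 2`.
  obtain ⟨C, hC, h⟩ := hI (c / (8 * (κ ^ 2 + 1))) (by positivity)
  obtain ⟨ρ, hρ, hle⟩ := exists_pos_rpow_le (C := C) (show 0 < c / 8 by positivity) hr hκ0
  refine ⟨ρ, hρ, fun y hy => (h _).trans ?_⟩
  have h1 : ‖T y‖ ≤ κ * ρ := by
    rw [← hy]
    exact hκ y
  have h2 : ‖T y‖ ^ r ≤ (κ * ρ) ^ r :=
    Real.rpow_le_rpow (norm_nonneg _) h1 (by linarith)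
  have h3 : ‖T y‖ ^ 2 ≤ (κ * ρ) ^ 2 := pow_le_pow_left₀ (norm_nonneg _) h1 2
  have h4 : c / (8 * (κ ^ 2 + 1)) * (κ * ρ) ^ 2 ≤ c / 8 * ρ ^ 2 := by
    rw [mul_pow, ← mul_assoc]
    refine mul_le_mul_of_nonneg_right ?_ (sq_nonneg ρ)
    rw [div_mul_eq_mul_div, div_le_div_iff₀ (by positivity) (by norm_num)]
    nlinarith
  have h5 := mul_le_mul_of_nonneg_left h3 (show 0 ≤ c / (8 * (κ ^ 2 + 1)) by positivity)
  have h6 := mul_le_mul_of_nonneg_left h2 hC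
  rw [hy]
  linarith

lemma Admissible.exists_nonlin_pairL_le (hN : 3 ≤ N) (hW : Admissible W) (α β : ℝ) {c : ℝ}
    (hc : 0 < c) : ∃ ρ : ℝ, 0 < ρ ∧ ∀ y : H1 N, ‖y‖ = ρ →
      nonlin W (pairL (H1 N) α β y) ≤ c / 4 * ‖y‖ ^ 2 :=
  (exists_isEmbeddingConst hN).elim fun _ hS => (exists_norm_pairL_le (H1 N) α β).elim fun _ hκ =>
    exists_sphere_le_of_growth hκ.1 hκ.2 (critExp_pos hN)
      (fun _ hε => hW.exists_nonlin_le hN hS hε) hc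

set_option maxHeartbeats 2000000 in
lemma Admissible.tendsto_nonlin_div (hN : 3 ≤ N) (hW : Admissible W) (ha : a ≠ 0) (hb : b ≠ 0)
    (hW2 : CondW2 a b W) {y : ℕ → H1 N} {y₀ : H1 N} (hy : WeaklyTendsto y y₀) (hy₀ : y₀ ≠ 0)
    {t : ℕ → ℝ} (ht : Tendsto t atTop atTop) (w : ℕ → H1 N) :
    Tendsto (fun n => nonlin W (t n • pairL (H1 N) a⁻¹ b⁻¹ (y n) + pairL (H1 N) (-a⁻¹) b⁻¹ (w n))
      / t n ^ 2) atTop atTop := by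
  refine tendsto_of_subseq_tendsto fun ns hns => ?_
  refine (exists_subseq_ae_tendsto (hy.subseq hns)).imp fun σ h => ?_
  exact hW.tendsto_nonlin_div_of_ae hN hW2 (y := fun n => y (ns (σ n))) hy₀ h.2
    (t := fun n => t (ns (σ n))) (ht.comp (hns.comp h.1.tendsto_atTop))
    (ζ := fun n => t (ns (σ n)) • pairL (H1 N) a⁻¹ b⁻¹ (y (ns (σ n)))
      + pairL (H1 N) (-a⁻¹) b⁻¹ (w (ns (σ n))))
    fun n => ae_combination_eq ha hb _ _ _

lemma Admissible.exists_shift_of_le_nonlin (hN : 3 ≤ N) (hW : Admissible W) (α β : ℝ)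
    {y : ℕ → H1 N} (hy : ∀ n, ‖y n‖ ≤ 1) (R : ℝ) {δ : ℝ} (hδ : 0 < δ)
    (hle : ∀ n, δ ≤ nonlin W (R • pairL (H1 N) α β (y n))) :
    ∃ (k : ℕ → Fin N → ℤ) (σ : ℕ → ℕ) (y₀ : H1 N), StrictMono σ ∧ y₀ ≠ 0 ∧
      WeaklyTendsto (fun n => shift (intVec (k n)) (y (σ n))) y₀ := by
  refine (exists_norm_pairL_le (H1 N) α β).elim fun κ hκ => ?_
  have hκ0 := hκ.1
  refine hW.exists_shift_weaklyTendsto hN (K := |R| * (|α| + |β|))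
    (B := |R| * κ) (by positivity) (by positivity) hδ
    (z := fun n => R • pairL (H1 N) α β (y n)) hy (fun n => ?_)
    (fun n => norm_vec_smul_pairL_le R α β (y n)) hle
  refine (norm_smul_le _ _).trans ?_
  exact mul_le_mul_of_nonneg_left ((hκ.2 (y n)).trans
    (mul_le_of_le_one_right hκ0 (hy n))) (abs_nonneg _)

set_option maxHeartbeats 2000000 in
theorem exists_indefiniteFunctional (hN : 3 ≤ N) (hV : CondV0 a b η V₁ V₂)
    (h₁ : OnePeriodic V₁) (h₂ : OnePeriodic V₂) (hW : Admissible W) (hW2 : CondW2 a b W)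
    (hM₁ : ∀ x, |V₁ x| ≤ M) (hM₂ : ∀ x, |V₂ x| ≤ M) :
    ∃ c, IndefiniteFunctional (pairL (H1 N) a⁻¹ b⁻¹) (pairL (H1 N) (-a⁻¹) b⁻¹)
      (quadForm hV.continuous₁ hM₁ hV.continuous₂ hM₂) (nonlin W) (hW.deriv hN) c := by
  have ha := hV.a_pos
  have hb := hV.b_pos
  refine (hV.exists_coercive hM₁).imp fun c h => ?_
  have hc := h.1
  have hco := h.2
  refine ⟨quadForm_comm _ _ _ _, hc, fun y => ?_, fun w => ?_,
    exists_eq_pairL_add_pairL ha.ne' hb.ne', hW.hasFDerivAt_nonlin hN, hW.nonlin_nonneg,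
    hW.nonlin_zero, fun θ hθ z ζ => hW.nonlin_ineq hN hθ z ζ,
    fun u z hu φ => hW.tendsto_deriv hN hu φ,
    fun y y₀ hy hy₀ t ht w => hW.tendsto_nonlin_div hN ha.ne' hb.ne' hW2 hy hy₀ ht w,
    hW.exists_nonlin_pairL_le hN _ _ hc, fun u z hu l hl => hW.half_deriv_sub_nonlin_le hN hu hl,
    fun y hy R δ hδ hle => ?_⟩
  · refine (hco y).trans (le_trans ?_ (quadForm_pairL _ _ _ _ _ _ y).ge)
    have h := mul_le_mul_of_nonneg_left (neg_abs_le (pot V₂ y y))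
      (show 0 ≤ a⁻¹ ^ 2 + b⁻¹ ^ 2 by positivity)
    linarith
  · refine (quadForm_pairL _ _ _ _ _ _ w).le.trans ?_
    have h := mul_le_mul_of_nonneg_left (le_abs_self (pot V₂ w w))
      (show 0 ≤ a⁻¹ ^ 2 + b⁻¹ ^ 2 by positivity)
    have h' := hco w
    rw [neg_sq]
    linarith
  · exact (hW.exists_shift_of_le_nonlin hN a⁻¹ b⁻¹ hy R hδ hle).elim fun k h =>
      ⟨fun n => shift (intVec (k n)), h.imp fun _ h => h.imp fun _ h =>
        ⟨fun n y w => energy_shift _ _ _ _ h₁ h₂ hW.periodic _ _ _ _ (k n) y w, h⟩⟩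

end HamSys
end

noncomputable section

namespace HamSys

/-! ### The Nehari–Pankov set in terms of the bilinear form, and the conclusion. -/

lemma range_pairL_eq_Eminus (N : ℕ) (a b : ℝ) :
    Set.range (pairL (H1 N) (-a⁻¹) b⁻¹) = Eminus N a b := by
  have h : ∀ w : H1 N, pairL (H1 N) (-a⁻¹) b⁻¹ w = WithLp.toLp 2 (-(a⁻¹ • w), b⁻¹ • w) := fun w =>
    (pairL_apply _ _ w).trans (congrArg (fun u => WithLp.toLp 2 (u, b⁻¹ • w)) (neg_smul a⁻¹ w))
  ext z
  constructor
  · rintro ⟨w, rfl⟩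
    exact ⟨w, h w⟩
  · rintro ⟨w, rfl⟩
    exact ⟨w, h w⟩

lemma fderiv_apply_eq_zero_iff {X : Type*} [NormedAddCommGroup X] [NormedSpace ℝ X] {f : X → ℝ}
    {A B : X →L[ℝ] ℝ} {z : X} (h : HasFDerivAt f (A - B) z) (ζ : X) :
    fderiv ℝ f z ζ = 0 ↔ A ζ = B ζ := by
  rw [h.fderiv]
  exact sub_eq_zero

set_option maxHeartbeats 1000000 in
-- `Φ` coincides with the abstract energy, so its Fréchet derivative is `A z - I' z` and the
-- defining equations become those of the abstract theorem.
lemma mem_NehariPankov_iff {N : ℕ} {a b M : ℝ} {V₁ V₂ : Sp N → ℝ} {W : Sp N → Plane → ℝ}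
    (hN : 3 ≤ N) (hW : Admissible W) (hV₁ : Continuous V₁) (hM₁ : ∀ x, |V₁ x| ≤ M)
    (hV₂ : Continuous V₂) (hM₂ : ∀ x, |V₂ x| ≤ M)
    (hderiv : ∀ z : E N, HasFDerivAt (energy (X := E N) (quadForm hV₁ hM₁ hV₂ hM₂) (nonlin W))
      (quadForm hV₁ hM₁ hV₂ hM₂ z - hW.deriv hN z) z) (z : E N) :
    z ∈ NehariPankov a b V₁ V₂ W ↔ z ∉ Set.range (pairL (H1 N) (-a⁻¹) b⁻¹) ∧
      quadForm hV₁ hM₁ hV₂ hM₂ z z = hW.deriv hN z z ∧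
      ∀ w, quadForm hV₁ hM₁ hV₂ hM₂ z (pairL (H1 N) (-a⁻¹) b⁻¹ w)
        = hW.deriv hN z (pairL (H1 N) (-a⁻¹) b⁻¹ w) := by
  have hd : HasFDerivAt (Phi V₁ V₂ W) (quadForm hV₁ hM₁ hV₂ hM₂ z - hW.deriv hN z) z :=
    (hderiv z).congr_of_eventuallyEq (Eventually.of_forall (Phi_eq hV₁ hM₁ hV₂ hM₂))
  have hf := fderiv_apply_eq_zero_iff hd
  have hmem : ∀ ζ, ζ ∈ Eminus N a b ↔ ∃ w, pairL (H1 N) (-a⁻¹) b⁻¹ w = ζ := fun ζ =>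
    Set.ext_iff.1 (range_pairL_eq_Eminus N a b).symm ζ
  exact and_congr (not_congr (hmem z)) (and_congr (hf z)
    ⟨fun h w => (hf _).1 (h _ ((hmem _).2 ⟨w, rfl⟩)),
      fun h ζ hζ => ((hmem ζ).1 hζ).elim fun w hw => hw ▸ (hf _).2 (h w)⟩)

end HamSys

end

theorem theorem1p8 (N : ℕ) (hN : 3 ≤ N) (a b η : ℝ)
    (V₁ V₂ : HamSys.Sp N → ℝ) (W : HamSys.Sp N → HamSys.Plane → ℝ)
    (hV0 : HamSys.CondV0 a b η V₁ V₂)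
    (hV1 : HamSys.OnePeriodic V₁ ∧ HamSys.OnePeriodic V₂)
    (hW0 : HamSys.CondW0 W)
    -- the normalization without which the integral of `W(x, z(x))` diverges for `z = 0`
    (hWzero : ∀ x, W x 0 = 0)
    (hW1 : HamSys.CondW1 W)
    (hW2 : HamSys.CondW2 a b W)
    (hW3 : HamSys.OnePeriodic W)
    (hW4 : HamSys.CondW4 W) :
    ∃ z : HamSys.E N,
      HamSys.IsWeakSolution V₁ V₂ W z ∧
      z ∈ HamSys.NehariPankov a b V₁ V₂ W ∧
      IsGLB (HamSys.Phi V₁ V₂ W '' HamSys.NehariPankov a b V₁ V₂ W) (HamSys.Phi V₁ V₂ W z) ∧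
      0 < HamSys.Phi V₁ V₂ W z := by
  obtain ⟨M, hM₁, hM₂⟩ := hV0.exists_bound
  have hW : HamSys.Admissible W := ⟨hW0, hWzero, hW1, hW3, hW4⟩
  obtain ⟨c, S⟩ := HamSys.exists_indefiniteFunctional hN hV0 hV1.1 hV1.2 hW hW2 hM₁ hM₂
  obtain ⟨z, hcrit, hz, hpos, hmin⟩ := S.exists_ground_state
  have hmem := HamSys.mem_NehariPankov_iff (a := a) (b := b) hN hW hV0.continuous₁ hM₁
    hV0.continuous₂ hM₂ S.hasFDerivAt_energy
  have hPhi := HamSys.Phi_eq (W := W) hV0.continuous₁ hM₁ hV0.continuous₂ hM₂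
  have hzmem : z ∈ HamSys.NehariPankov a b V₁ V₂ W :=
    (hmem z).2 ⟨hz, DFunLike.congr_fun hcrit z, fun w => DFunLike.congr_fun hcrit _⟩
  refine ⟨z, HamSys.isWeakSolution_of_eq hN hW hV0.continuous₁ hM₁ hV0.continuous₂ hM₂ hcrit,
    hzmem, IsLeast.isGLB ⟨⟨z, hzmem, rfl⟩, ?_⟩, (hPhi z).symm ▸ hpos⟩
  rintro _ ⟨ζ, hζ, rfl⟩
  obtain ⟨h1, h2, h3⟩ := (hmem ζ).1 hζ
  exact ((hPhi z).le.trans (hmin ζ h1 h2 h3)).trans (hPhi ζ).ge
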